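/- All algebras are associative over $\mathbb C$, possibly without identity, with non-degenerate product; $M(\cdot)$ denotes the multiplier algebra, $m$ the product, $\iota$ the identity map. A *regular multiplier Hopf algebra* is an algebra $A$ with a coassociative homomorphism $\Delta:A\to M(A\otimes A)$ such that $a\otimes b\mapsto \Delta(a)(1\otimes b)$, $(a\otimes 1)\Delta(b)$, $\Delta(a)(b\otimes 1)$, $(1\otimes a)\Delta(b)$ are bijections of $A\otimes A$; it has a unique counit $\varepsilon$ and a unique (bijective) antipode $S$. We use Sweedler notation $\Delta(a)=\sum a_{(1)}\otimes a_{(2)}$; formulas below that involve multipliers are read after multiplying by enough elements ("covering") to land in the algebraic tensor product. Let $C$ and $D$ be regular multiplier Hopf algebras. (1) Let $C$ be a left $D$-module algebra: there is a left action $\triangleright$ of $D$ on $C$ such that the elements $d\triangleright c$ span $C$ and $d\triangleright(cc')=\sum (d_{(1)}\triangleright c)(d_{(2)}\triangleright c')$. Put $$R(d\otimes c)=\sum (d_{(1)}\triangleright c)\otimes d_{(2)},\qquad R^{\mathrm{op}}(d\otimes c)=\sum (d_{(2)}\triangleright c)\otimes d_{(1)} .$$ The smash product $CD$ is the space $C\otimes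 D$ (with $c\otimes d$ written $cd$) with product $(m_C\otimes m_D)(\iota\otimes R\otimes\iota)$, so that $dc=\sum (d_{(1)}\triangleright c)d_{(2)}$. (2) Let $D$ be a right $C$-comodule coalgebra. That is, let $M_0(D\otimes C)$ be the completion of the $C$-bimodule $D\otimes C$ (elements $x$ with $(1\otimes c)x,\ x(1\otimes c)\in D\otimes C$ for all $c\in C$), and let $\Gamma:D\to M_0(D\otimes C)$, $\Gamma(d)=\sum d_{(0)}\otimes d_{(1)}$, be an injective linear map with $(\Gamma\otimes\iota)\Gamma=(\iota\otimes\Delta_C)\Gamma$. Put $$T(c\otimes d)=(1\otimes c)\Gamma(d),\qquad T^{\mathrm{op}}(c\otimes d)=\Gamma(d)(1\otimes c).$$ It is assumed that for all $c\in C$, $d,d'\in D$ the elements $(d'\otimes1\otimes1)\,(T\otimes\iota)(c\otimes\Delta_D(d))$ and $(T\otimes\iota)(c\otimes\Delta_D(d))\,(d'\otimes1\otimes1)$ lie in $D\otimes C\otimes D$, and that $$(\Delta_D\otimes\iota_C)T=(\iota_D\otimes T)(T\otimes\iota_D)(\iota_C\otimes\Delta_D)\quad\text{on } C\otimes D,$$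 read after multiplication by $d'\otimes1\otimes1$ from the left or from the right. (3) With $P=T^{\mathrm{op}}\circ R^{\mathrm{op}}$ on $D\otimes C$, i.e. $P(d\otimes c)=\sum\Gamma(d_{(1)})(1\otimes (d_{(2)}\triangleright c))$, assume $$P(m_D\otimes\iota_C)=(m_D\otimes\iota_C)P_{13}P_{23}\ \text{ on } D\otimes D\otimes C,\qquad(\iota_D\otimes\Delta_C)P=P_{12}P_{13}(\iota_D\otimes\Delta_C)\ \text{ on } D\otimes C,$$ and $P=T\circ R$ on $D\otimes C$. **Theorem.** There is a unique linear map $\Delta_\#:CD\to M(CD\otimes CD)$ with $$\Delta_\#(cd)=\sum \Delta_C(c)\,\Gamma(d_{(1)})(1\otimes d_{(2)})\qquad(c\in C,\ d\in D),$$ meaning that $(c'\otimes1)\Delta_\#(cd)(1\otimes d')=(\iota_C\otimes T\otimes\iota_D)\bigl((c'\otimes1)\Delta_C(c)\otimes\Delta_D(d)(1\otimes d')\bigr)$ in $CD\otimes CD$ for all $c,c'\in C$ and $d,d'\in D$. The pair $(CD,\Delta_\#)$ is a regular multiplier Hopf algebra. Its counit is given by $\varepsilon_\#(cd)=\varepsilon_C(c)\varepsilon_D(d)$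 and its antipode by $$S_\#(cd)=\sum S_D(d_{(0)})\,S_C(d_{(1)})\,S_C(c)\qquad(c\in C,\ d\in D),$$ where the sum is read as the sum of products $S_D(p)S_C(q)$ in $CD$ over $T(c\otimes d)=\sum p\otimes q$. -/

import Mathlib

open scoped TensorProduct

noncomputable section

/-! ## Leg numbering -/

section Legs

variable {X Y Z W Y' Z' : Type*}
  [AddCommGroup X] [Module ℂ X] [AddCommGroup Y] [Module ℂ Y] [AddCommGroup Z] [Module ℂ Z]
  [AddCommGroup W] [Module ℂ W] [AddCommGroup Y'] [Module ℂ Y'] [AddCommGroup Z'] [Module ℂ Z']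

/-- `ι ⊗ f ⊗ ι`, with `f` acting on the two middle factors. -/
def middle (X W : Type*) [AddCommGroup X] [Module ℂ X] [AddCommGroup W] [Module ℂ W]
    (f : Y ⊗[ℂ] Z →ₗ[ℂ] Y' ⊗[ℂ] Z') :
    (X ⊗[ℂ] Y) ⊗[ℂ] (Z ⊗[ℂ] W) →ₗ[ℂ] (X ⊗[ℂ] Y') ⊗[ℂ] (Z' ⊗[ℂ] W) :=
  (TensorProduct.assoc ℂ X Y' (Z' ⊗[ℂ] W)).symm.toLinearMap
    ∘ₗ ((TensorProduct.assoc ℂ Y' Z' W).toLinearMap ∘ₗ f.rTensor W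
        ∘ₗ (TensorProduct.assoc ℂ Y Z W).symm.toLinearMap).lTensor X
    ∘ₗ (TensorProduct.assoc ℂ X Y (Z ⊗[ℂ] W)).toLinearMap

/-- `f` acting on the first and second of three factors. -/
def leg12 (W : Type*) [AddCommGroup W] [Module ℂ W] (f : X ⊗[ℂ] Y →ₗ[ℂ] Y' ⊗[ℂ] Z') :
    X ⊗[ℂ] (Y ⊗[ℂ] W) →ₗ[ℂ] Y' ⊗[ℂ] (Z' ⊗[ℂ] W) :=
  (TensorProduct.assoc ℂ Y' Z' W).toLinearMap ∘ₗ f.rTensor W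
    ∘ₗ (TensorProduct.assoc ℂ X Y W).symm.toLinearMap

/-- `f` acting on the first and third of three factors. -/
def leg13 (W : Type*) [AddCommGroup W] [Module ℂ W] (f : X ⊗[ℂ] Y →ₗ[ℂ] Y' ⊗[ℂ] Z') :
    X ⊗[ℂ] (W ⊗[ℂ] Y) →ₗ[ℂ] Y' ⊗[ℂ] (W ⊗[ℂ] Z') :=
  (TensorProduct.leftComm ℂ W Y' Z').toLinearMap ∘ₗ f.lTensor W
    ∘ₗ (TensorProduct.leftComm ℂ X W Y).toLinearMap

/-- `f` acting on the second and third of three factors. -/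
def leg23 (W : Type*) [AddCommGroup W] [Module ℂ W] (f : X ⊗[ℂ] Y →ₗ[ℂ] Y' ⊗[ℂ] Z') :
    W ⊗[ℂ] (X ⊗[ℂ] Y) →ₗ[ℂ] W ⊗[ℂ] (Y' ⊗[ℂ] Z') :=
  f.lTensor W

end Legs

/-! ## Multiplier algebras

An algebra is given by a complex vector space `V` and its multiplication
`μ : V →ₗ[ℂ] V →ₗ[ℂ] V`; it need not have an identity. -/

/-- Pairs `(L, R)` of linear maps on `V`, read as left multiplication `v ↦ x v` and right
multiplication `v ↦ v x` by an element `x`. The product is `(L, R) (L', R') = (L ∘ L', R' ∘ R)`. -/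
abbrev PreMult (V : Type*) [AddCommGroup V] [Module ℂ V] : Type _ :=
  Module.End ℂ V × (Module.End ℂ V)ᵐᵒᵖ

section Multipliers

variable {V : Type*} [AddCommGroup V] [Module ℂ V]

/-- The multiplier algebra `M(V)`: the pairs `(L, R)` such that `a (L b) = (R a) b`. -/
def multiplierAlgebra (μ : V →ₗ[ℂ] V →ₗ[ℂ] V) : Subalgebra ℂ (PreMult V) where
  carrier := {x | ∀ a b, μ a (x.1 b) = μ (x.2.unop a) b}
  mul_mem' := by
    intro x y hx hy a b
    simp only [Set.mem_ofPred_eq] at hx hy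
    simp [hx, hy]
  add_mem' := by
    intro x y hx hy a b
    simp only [Set.mem_ofPred_eq] at hx hy
    simp [hx, hy]
  algebraMap_mem' := by
    intro r a b
    simp [Prod.algebraMap_apply, MulOpposite.algebraMap_apply, Module.algebraMap_end_apply]

/-- An element `v` of the algebra `V`, as the pair of its left and right multiplications. -/
def embed (μ : V →ₗ[ℂ] V →ₗ[ℂ] V) : V →ₗ[ℂ] PreMult V :=
  μ.prod ((MulOpposite.opLinearEquiv ℂ).toLinearMap ∘ₗ μ.flip)

/-- The multiplier `x ⊗ 1` of `V ⊗ W`. -/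
def inFirst (W : Type*) [AddCommGroup W] [Module ℂ W] (x : PreMult V) : PreMult (V ⊗[ℂ] W) :=
  (x.1.rTensor W, MulOpposite.op (x.2.unop.rTensor W))

/-- The multiplier `1 ⊗ x` of `W ⊗ V`. -/
def inSecond (W : Type*) [AddCommGroup W] [Module ℂ W] (x : PreMult V) : PreMult (W ⊗[ℂ] V) :=
  (x.1.lTensor W, MulOpposite.op (x.2.unop.lTensor W))

/-- The multiplication `(a ⊗ b) (a' ⊗ b') = a a' ⊗ b b'` of `V ⊗ V`. -/
abbrev tensorMul (μ : V →ₗ[ℂ] V →ₗ[ℂ] V) : V ⊗[ℂ] V →ₗ[ℂ] V ⊗[ℂ] V →ₗ[ℂ] V ⊗[ℂ] V :=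
  TensorProduct.map₂ μ μ

end Multipliers

/-! ## Regular multiplier Hopf algebras -/

/-- The structure of a regular multiplier Hopf algebra on the algebra `(V, μ)`: the product is
associative and non-degenerate, and `Δ : V → M(V ⊗ V)` is a coassociative homomorphism such that
`Δ(a)(1 ⊗ b)`, `(a ⊗ 1)Δ(b)`, `Δ(a)(b ⊗ 1)` and `(1 ⊗ a)Δ(b)` lie in `V ⊗ V` and depend bijectively
on `a ⊗ b`. The first two conditions say that `(V, Δ)` is a multiplier Hopf algebra, the last two
that `(V, Δᵒᵖ)` is one. The maps `T₁`, …, `T₄` are determined by `Δ`, as `V ⊗ V` embeds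
into `M(V ⊗ V)`. -/
structure RegularMultiplierHopfAlgebra {V : Type*} [AddCommGroup V] [Module ℂ V]
    (μ : V →ₗ[ℂ] V →ₗ[ℂ] V) where
  assoc : ∀ a b c, μ (μ a b) c = μ a (μ b c)
  nondegenerate_left : ∀ a, (∀ b, μ a b = 0) → a = 0
  nondegenerate_right : ∀ b, (∀ a, μ a b = 0) → b = 0
  /-- the coproduct -/
  Δ : V →ₗ[ℂ] multiplierAlgebra (tensorMul μ)
  Δ_mul : ∀ a b, Δ (μ a b) = Δ a * Δ b
  /-- `a ⊗ b ↦ Δ(a)(1 ⊗ b)` -/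
  T₁ : V ⊗[ℂ] V ≃ₗ[ℂ] V ⊗[ℂ] V
  /-- `a ⊗ b ↦ (a ⊗ 1)Δ(b)` -/
  T₂ : V ⊗[ℂ] V ≃ₗ[ℂ] V ⊗[ℂ] V
  /-- `a ⊗ b ↦ Δ(a)(b ⊗ 1)` -/
  T₃ : V ⊗[ℂ] V ≃ₗ[ℂ] V ⊗[ℂ] V
  /-- `a ⊗ b ↦ (1 ⊗ a)Δ(b)` -/
  T₄ : V ⊗[ℂ] V ≃ₗ[ℂ] V ⊗[ℂ] V
  T₁_spec : ∀ a b, embed (tensorMul μ) (T₁ (a ⊗ₜ[ℂ] b)) =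
    (Δ a : PreMult (V ⊗[ℂ] V)) * inSecond V (embed μ b)
  T₂_spec : ∀ a b, embed (tensorMul μ) (T₂ (a ⊗ₜ[ℂ] b)) =
    inFirst V (embed μ a) * (Δ b : PreMult (V ⊗[ℂ] V))
  T₃_spec : ∀ a b, embed (tensorMul μ) (T₃ (a ⊗ₜ[ℂ] b)) =
    (Δ a : PreMult (V ⊗[ℂ] V)) * inFirst V (embed μ b)
  T₄_spec : ∀ a b, embed (tensorMul μ) (T₄ (a ⊗ₜ[ℂ] b)) =
    inSecond V (embed μ a) * (Δ b : PreMult (V ⊗[ℂ] V))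
  /-- `(a ⊗ 1 ⊗ 1)(Δ ⊗ ι)(Δ(b)(1 ⊗ c)) = (ι ⊗ Δ)((a ⊗ 1)Δ(b))(1 ⊗ 1 ⊗ c)` -/
  coassoc : ∀ a b c, leg12 V T₂.toLinearMap (a ⊗ₜ[ℂ] T₁ (b ⊗ₜ[ℂ] c)) =
    leg23 V T₁.toLinearMap (TensorProduct.assoc ℂ V V V (T₂ (a ⊗ₜ[ℂ] b) ⊗ₜ[ℂ] c))

namespace RegularMultiplierHopfAlgebra

variable {V : Type*} [AddCommGroup V] [Module ℂ V] {μ : V →ₗ[ℂ] V →ₗ[ℂ] V}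
  (H : RegularMultiplierHopfAlgebra μ)

/-- `ε` is the counit: a homomorphism with `(ε ⊗ ι)(Δ(a)(1 ⊗ b)) = a b` and
`(ι ⊗ ε)((a ⊗ 1)Δ(b)) = a b`. -/
structure IsCounit (ε : V →ₗ[ℂ] ℂ) : Prop where
  map_mul : ∀ a b, ε (μ a b) = ε a * ε b
  left : ∀ a b, TensorProduct.lid ℂ V (ε.rTensor V (H.T₁ (a ⊗ₜ[ℂ] b))) = μ a b
  right : ∀ a b, TensorProduct.rid ℂ V (ε.lTensor V (H.T₂ (a ⊗ₜ[ℂ] b))) = μ a b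

/-- `S` is the antipode (relative to the counit `ε`): a bijective anti-homomorphism with
`m (S ⊗ ι)(Δ(a)(1 ⊗ b)) = ε(a) b` and `m (ι ⊗ S)((a ⊗ 1)Δ(b)) = ε(b) a`. -/
structure IsAntipode (ε : V →ₗ[ℂ] ℂ) (S : V →ₗ[ℂ] V) : Prop where
  bijective : Function.Bijective S
  map_mul : ∀ a b, S (μ a b) = μ (S b) (S a)
  left : ∀ a b, TensorProduct.lift μ (S.rTensor V (H.T₁ (a ⊗ₜ[ℂ] b))) = ε a • b
  right : ∀ a b, TensorProduct.lift μ (S.lTensor V (H.T₂ (a ⊗ₜ[ℂ] b))) = ε b • a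

/-- The counit of a regular multiplier Hopf algebra. -/
def counit : V →ₗ[ℂ] ℂ := Classical.epsilon H.IsCounit

/-- The antipode of a regular multiplier Hopf algebra. -/
def antipode : V →ₗ[ℂ] V := Classical.epsilon (H.IsAntipode H.counit)

/-- There is at most one counit. -/
theorem IsCounit.unique {ε ε' : V →ₗ[ℂ] ℂ} (h : H.IsCounit ε) (h' : H.IsCounit ε') : ε = ε' := by
  have key : ∀ x, TensorProduct.lid ℂ V (ε.rTensor V x) =
      TensorProduct.lid ℂ V (ε'.rTensor V x) := by
    intro x
    obtain ⟨y, rfl⟩ := H.T₁.surjective x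
    induction y with
    | zero => simp
    | tmul a b => rw [h.left, h'.left]
    | add p q hp hq => simp only [map_add, hp, hq]
  ext a
  by_cases ha : a = 0
  · simp [ha]
  have := key (a ⊗ₜ a)
  simp only [LinearMap.rTensor_tmul, TensorProduct.lid_tmul] at this
  exact smul_left_injective ℂ ha this

/-- There is at most one antipode. -/
theorem IsAntipode.unique {ε : V →ₗ[ℂ] ℂ} {S S' : V →ₗ[ℂ] V} (h : H.IsAntipode ε S)
    (h' : H.IsAntipode ε S') : S = S' := by
  have key : ∀ x, TensorProduct.lift μ (S.rTensor V x) =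
      TensorProduct.lift μ (S'.rTensor V x) := by
    intro x
    obtain ⟨y, rfl⟩ := H.T₁.surjective x
    induction y with
    | zero => simp
    | tmul a b => rw [h.left, h'.left]
    | add p q hp hq => simp only [map_add, hp, hq]
  ext a
  rw [← sub_eq_zero]
  refine H.nondegenerate_left _ fun b => ?_
  have := key (a ⊗ₜ b)
  simp only [LinearMap.rTensor_tmul, TensorProduct.lift.tmul] at this
  simp [this]

/-- A tensor in `X ⊗ V` is determined by its products with all `1 ⊗ b` from the right. -/
theorem ext_right (H : RegularMultiplierHopfAlgebra μ) {X : Type*} [AddCommGroup X] [Module ℂ X] {y y' : X ⊗[ℂ] V}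
    (h : ∀ b, (μ.flip b).lTensor X y = (μ.flip b).lTensor X y') : y = y' := by
  classical
  let B := Module.Basis.ofVectorSpace ℂ X
  let E (W : Type _) [AddCommGroup W] [Module ℂ W] :=
    TensorProduct.equivFinsuppOfBasisLeft (N := W) B
  have hE : ∀ (f : V →ₗ[ℂ] V) (z : X ⊗[ℂ] V) i, E V (f.lTensor X z) i = f (E V z i) := by
    intro f z i
    induction z with
    | zero => simp
    | tmul a b => simp [E]
    | add p q hp hq => simp only [map_add, Finsupp.add_apply, hp, hq]
  apply (E V).injective
  ext i
  rw [← sub_eq_zero]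
  refine H.nondegenerate_left _ fun b => ?_
  have := congrArg (fun z => E V z i) (h b)
  simp only [hE, LinearMap.flip_apply] at this
  simp [this]

/-- `V ⊗ V` embeds into its multiplier algebra. -/
theorem embed_injective (H : RegularMultiplierHopfAlgebra μ) : Function.Injective (embed (tensorMul μ)) := by
  intro x y hxy
  have h1 : ∀ p q, TensorProduct.map₂ μ μ x (p ⊗ₜ q) = TensorProduct.map₂ μ μ y (p ⊗ₜ q) := by
    intro p q
    have := congrArg (fun z : PreMult (V ⊗[ℂ] V) => z.1 (p ⊗ₜ q)) hxy
    simpa [embed] using this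
  have h2 : ∀ (z : V ⊗[ℂ] V) p q, TensorProduct.map₂ μ μ z (p ⊗ₜ q) =
      (μ.flip q).lTensor V ((μ.flip p).rTensor V z) := by
    intro z p q
    induction z with
    | zero => simp
    | tmul a b => simp
    | add p q hp hq => simp only [map_add, LinearMap.add_apply, hp, hq]
  have h3 : ∀ p, (μ.flip p).rTensor V x = (μ.flip p).rTensor V y := by
    intro p
    apply H.ext_right
    intro q
    rw [← h2, ← h2, h1]
  apply (TensorProduct.comm ℂ V V).injective
  apply H.ext_right
  intro p
  have := congrArg (TensorProduct.comm ℂ V V) (h3 p)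
  have h4 : ∀ z : V ⊗[ℂ] V, TensorProduct.comm ℂ V V ((μ.flip p).rTensor V z) =
      (μ.flip p).lTensor V (TensorProduct.comm ℂ V V z) := by
    intro z
    induction z with
    | zero => simp
    | tmul a b => simp
    | add p q hp hq => simp only [map_add, hp, hq]
  rw [← h4, ← h4, this]

/-- `(Δ(d)(e ⊗ 1))(1 ⊗ d') = (Δ(d)(1 ⊗ d'))(e ⊗ 1)`. -/
theorem T₃_mul_eq (d e d' : V) : (μ.flip d').lTensor V (H.T₃ (d ⊗ₜ e)) =
    (μ.flip e).rTensor V (H.T₁ (d ⊗ₜ d')) := by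
  apply H.embed_injective
  have h1 : ∀ z : V ⊗[ℂ] V, embed (tensorMul μ) ((μ.flip d').lTensor V z) =
      embed (tensorMul μ) z * inSecond V (embed μ d') := by
    intro z
    induction z with
    | zero => simp
    | tmul a b =>
      apply Prod.ext
      · ext; simp [embed, inSecond, H.assoc]
      · refine MulOpposite.unop_injective ?_
        ext; simp [embed, inSecond, H.assoc]
    | add p q hp hq => simp only [map_add, add_mul, hp, hq]
  have h2 : ∀ z : V ⊗[ℂ] V, embed (tensorMul μ) ((μ.flip e).rTensor V z) =
      embed (tensorMul μ) z * inFirst V (embed μ e) := by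
    intro z
    induction z with
    | zero => simp
    | tmul a b =>
      apply Prod.ext
      · ext; simp [embed, inFirst, H.assoc]
      · refine MulOpposite.unop_injective ?_
        ext; simp [embed, inFirst, H.assoc]
    | add p q hp hq => simp only [map_add, add_mul, hp, hq]
  rw [h1, h2, H.T₃_spec, H.T₁_spec, mul_assoc, mul_assoc]
  congr 1
  apply Prod.ext
  · ext; simp [embed, inFirst, inSecond]
  · refine MulOpposite.unop_injective ?_
    ext; simp [embed, inFirst, inSecond]

end RegularMultiplierHopfAlgebra

/-! ## Left module algebras, the twist map and the smash product -/

section Bicrossproduct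

variable {C D : Type*} [NonUnitalRing C] [Module ℂ C] [IsScalarTower ℂ C C] [SMulCommClass ℂ C C]
  [NonUnitalRing D] [Module ℂ D] [IsScalarTower ℂ D D] [SMulCommClass ℂ D D]

/-- A unital left action `d ▷ c` of `D` on the algebra `C` making it a left `D`-module algebra. -/
structure LeftModuleAlgebra (HD : RegularMultiplierHopfAlgebra (LinearMap.mul ℂ D))
    (C : Type*) [NonUnitalRing C] [Module ℂ C] [IsScalarTower ℂ C C] [SMulCommClass ℂ C C] where
  /-- the action `d ▷ c` -/
  act : D →ₗ[ℂ] C →ₗ[ℂ] C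
  mul_act : ∀ d d' c, act (d * d') c = act d (act d' c)
  /-- The elements `d ▷ c` span `C`. -/
  unital : Submodule.span ℂ {x : C | ∃ d c, x = act d c} = ⊤
  /-- `d ▷ (c x) = ∑ (d₁ ▷ c) (d₂ ▷ x)`; the elements `x = e ▷ c'` span `C`, and for them the
  right hand side is `∑ (d₁ ▷ c) (d₂ e ▷ c')`, with `∑ d₁ ⊗ d₂ e = Δ(d)(1 ⊗ e)`. -/
  act_mul : ∀ d e c c', act d (c * act e c') =
    LinearMap.mul' ℂ C (TensorProduct.map (act.flip c) (act.flip c') (HD.T₁ (d ⊗ₜ[ℂ] e)))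

namespace LeftModuleAlgebra

variable {HD : RegularMultiplierHopfAlgebra (LinearMap.mul ℂ D)} (α : LeftModuleAlgebra HD C)

theorem lift_act_surjective : Function.Surjective (TensorProduct.lift α.act) := by
  rw [← LinearMap.range_eq_top, eq_top_iff, ← α.unital, Submodule.span_le]
  rintro _ ⟨d, c, rfl⟩
  exact ⟨d ⊗ₜ c, by simp⟩

/-- A way to write each `c` as a sum of elements `e ▷ c'`. The maps defined with it do not depend on
this choice, see `twist_tmul_act` and `twistOp_tmul_act`. -/
def actSection : C →ₗ[ℂ] D ⊗[ℂ] C :=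
  ((TensorProduct.lift α.act).exists_rightInverse_of_surjective
    (LinearMap.range_eq_top.2 α.lift_act_surjective)).choose

theorem lift_act_section (c : C) : TensorProduct.lift α.act (α.actSection c) = c :=
  LinearMap.congr_fun ((TensorProduct.lift α.act).exists_rightInverse_of_surjective
    (LinearMap.range_eq_top.2 α.lift_act_surjective)).choose_spec c

/-- `(p ⊗ q) ⊗ c ↦ (p ▷ c) ⊗ q`. -/
def actFirst : (D ⊗[ℂ] D) ⊗[ℂ] C →ₗ[ℂ] C ⊗[ℂ] D :=
  (TensorProduct.lift α.act).rTensor D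
    ∘ₗ (TensorProduct.assoc ℂ D C D).symm.toLinearMap
    ∘ₗ (TensorProduct.comm ℂ D C).toLinearMap.lTensor D
    ∘ₗ (TensorProduct.assoc ℂ D D C).toLinearMap

@[simp] theorem actFirst_tmul (p q : D) (c : C) :
    α.actFirst ((p ⊗ₜ[ℂ] q) ⊗ₜ[ℂ] c) = α.act p c ⊗ₜ[ℂ] q := by
  simp [actFirst]

/-- The twist map `R(d ⊗ c) = ∑ (d₁ ▷ c) ⊗ d₂`. -/
def twist : D ⊗[ℂ] C →ₗ[ℂ] C ⊗[ℂ] D :=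
  α.actFirst ∘ₗ HD.T₃.toLinearMap.rTensor C ∘ₗ (TensorProduct.assoc ℂ D D C).symm.toLinearMap
    ∘ₗ α.actSection.lTensor D

/-- The map `Rᵒᵖ(d ⊗ c) = ∑ (d₂ ▷ c) ⊗ d₁`. -/
def twistOp : D ⊗[ℂ] C →ₗ[ℂ] C ⊗[ℂ] D :=
  α.actFirst ∘ₗ ((TensorProduct.comm ℂ D D).toLinearMap ∘ₗ HD.T₁.toLinearMap).rTensor C
    ∘ₗ (TensorProduct.assoc ℂ D D C).symm.toLinearMap ∘ₗ α.actSection.lTensor D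

theorem lTensor_actFirst (d' : D) (z : D ⊗[ℂ] D) (c : C) :
    ((LinearMap.mul ℂ D).flip d').lTensor C (α.actFirst (z ⊗ₜ[ℂ] c)) =
      α.actFirst (((LinearMap.mul ℂ D).flip d').lTensor D z ⊗ₜ[ℂ] c) := by
  induction z with
  | zero => simp
  | tmul a b => simp
  | add p q hp hq => simp only [map_add, TensorProduct.add_tmul, hp, hq]

theorem actFirst_rTensor (e : D) (z : D ⊗[ℂ] D) (c : C) :
    α.actFirst (((LinearMap.mul ℂ D).flip e).rTensor D z ⊗ₜ[ℂ] c) =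
      α.actFirst (z ⊗ₜ[ℂ] α.act e c) := by
  induction z with
  | zero => simp
  | tmul a b => simp [α.mul_act]
  | add p q hp hq => simp only [map_add, TensorProduct.add_tmul, hp, hq]

theorem lTensor_twist_aux (d d' : D) (x : D ⊗[ℂ] C) :
    ((LinearMap.mul ℂ D).flip d').lTensor C (α.actFirst (HD.T₃.toLinearMap.rTensor C
      ((TensorProduct.assoc ℂ D D C).symm (d ⊗ₜ[ℂ] x)))) =
      α.actFirst (HD.T₁ (d ⊗ₜ[ℂ] d') ⊗ₜ[ℂ] TensorProduct.lift α.act x) := by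
  induction x with
  | zero => simp
  | tmul e c =>
    simp only [TensorProduct.assoc_symm_tmul, LinearMap.rTensor_tmul, LinearEquiv.coe_coe,
      TensorProduct.lift.tmul]
    rw [lTensor_actFirst, HD.T₃_mul_eq, actFirst_rTensor]
  | add p q hp hq => simp only [map_add, TensorProduct.tmul_add, hp, hq]

theorem lTensor_twistOp_aux (d d' : D) (x : D ⊗[ℂ] C) :
    ((LinearMap.mul ℂ D).flip d').lTensor C (α.actFirst
      (((TensorProduct.comm ℂ D D).toLinearMap ∘ₗ HD.T₁.toLinearMap).rTensor C
      ((TensorProduct.assoc ℂ D D C).symm (d ⊗ₜ[ℂ] x)))) =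
      α.actFirst (TensorProduct.comm ℂ D D (HD.T₃ (d ⊗ₜ[ℂ] d'))
        ⊗ₜ[ℂ] TensorProduct.lift α.act x) := by
  have h4 : ∀ (p : D) (z : D ⊗[ℂ] D),
      ((LinearMap.mul ℂ D).flip p).lTensor D (TensorProduct.comm ℂ D D z) =
      TensorProduct.comm ℂ D D (((LinearMap.mul ℂ D).flip p).rTensor D z) := by
    intro p z
    induction z with
    | zero => simp
    | tmul a b => simp
    | add p q hp hq => simp only [map_add, hp, hq]
  have h5 : ∀ (p : D) (z : D ⊗[ℂ] D),
      ((LinearMap.mul ℂ D).flip p).rTensor D (TensorProduct.comm ℂ D D z) =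
      TensorProduct.comm ℂ D D (((LinearMap.mul ℂ D).flip p).lTensor D z) := by
    intro p z
    induction z with
    | zero => simp
    | tmul a b => simp
    | add p q hp hq => simp only [map_add, hp, hq]
  induction x with
  | zero => simp
  | tmul e c =>
    simp only [TensorProduct.assoc_symm_tmul, LinearMap.rTensor_tmul, LinearEquiv.coe_coe,
      TensorProduct.lift.tmul, LinearMap.comp_apply]
    rw [lTensor_actFirst, h4, ← HD.T₃_mul_eq, ← h5, actFirst_rTensor]
  | add p q hp hq => simp only [map_add, TensorProduct.tmul_add, hp, hq]

/-- `R(d ⊗ (e ▷ c)) = ∑ (d₁ e ▷ c) ⊗ d₂`, with `∑ d₁ e ⊗ d₂ = Δ(d)(e ⊗ 1)`. -/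
theorem twist_tmul_act (d e : D) (c : C) :
    α.twist (d ⊗ₜ[ℂ] α.act e c) =
      TensorProduct.map (α.act.flip c) LinearMap.id (HD.T₃ (d ⊗ₜ[ℂ] e)) := by
  have h : ∀ z : D ⊗[ℂ] D, TensorProduct.map (α.act.flip c) LinearMap.id z =
      α.actFirst (z ⊗ₜ[ℂ] c) := by
    intro z
    induction z with
    | zero => simp
    | tmul a b => simp
    | add p q hp hq => simp only [map_add, TensorProduct.add_tmul, hp, hq]
  rw [h]
  apply HD.ext_right
  intro d'
  have h1 := α.lTensor_twist_aux d d' (α.actSection (α.act e c))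
  have h2 := α.lTensor_twist_aux d d' (e ⊗ₜ c)
  rw [lift_act_section] at h1
  rw [TensorProduct.lift.tmul, ← h1] at h2
  simpa [twist] using h2.symm

/-- `Rᵒᵖ(d ⊗ (e ▷ c)) = ∑ (d₂ e ▷ c) ⊗ d₁`, with `∑ d₁ ⊗ d₂ e = Δ(d)(1 ⊗ e)`. -/
theorem twistOp_tmul_act (d e : D) (c : C) :
    α.twistOp (d ⊗ₜ[ℂ] α.act e c) = TensorProduct.comm ℂ D C
      (TensorProduct.map LinearMap.id (α.act.flip c) (HD.T₁ (d ⊗ₜ[ℂ] e))) := by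
  have h : ∀ z : D ⊗[ℂ] D, TensorProduct.comm ℂ D C
      (TensorProduct.map LinearMap.id (α.act.flip c) z) =
      α.actFirst (TensorProduct.comm ℂ D D z ⊗ₜ[ℂ] c) := by
    intro z
    induction z with
    | zero => simp
    | tmul a b => simp
    | add p q hp hq => simp only [map_add, TensorProduct.add_tmul, hp, hq]
  rw [h]
  apply HD.ext_right
  intro d'
  have h1 := α.lTensor_twistOp_aux d d' (α.actSection (α.act e c))
  have h2 := α.lTensor_twistOp_aux d d' (e ⊗ₜ c)
  rw [lift_act_section] at h1
  rw [TensorProduct.lift.tmul, ← h1] at h2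
  simpa [twistOp] using h2.symm

/-- The multiplication `m = (m_C ⊗ m_D)(ι ⊗ R ⊗ ι)` of the smash product `CD`, the vector space
`C ⊗ D` in which `c ⊗ d` is written `c d`. -/
def smashMul : C ⊗[ℂ] D →ₗ[ℂ] C ⊗[ℂ] D →ₗ[ℂ] C ⊗[ℂ] D :=
  TensorProduct.curry
    (TensorProduct.map (LinearMap.mul' ℂ C) (LinearMap.mul' ℂ D) ∘ₗ middle C D α.twist)

/-- `c ∈ C` as a multiplier of `CD`: `c (c' d') = (c c') d'` on the left, and
`(c' d') c = ∑ c' (d'₁ ▷ c) d'₂` on the right. -/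
def inclC (c : C) : PreMult (C ⊗[ℂ] D) :=
  ((LinearMap.mulLeft ℂ c).rTensor D,
    MulOpposite.op ((LinearMap.mul' ℂ C).rTensor D
      ∘ₗ (TensorProduct.assoc ℂ C C D).symm.toLinearMap
      ∘ₗ α.twist.lTensor C
      ∘ₗ (TensorProduct.assoc ℂ C D C).toLinearMap
      ∘ₗ (TensorProduct.mk ℂ (C ⊗[ℂ] D) C).flip c))

/-- `d ∈ D` as a multiplier of `CD`: `d (c' d') = ∑ (d₁ ▷ c') d₂ d'` on the left, and
`(c' d') d = c' (d' d)` on the right. -/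
def inclD (d : D) : PreMult (C ⊗[ℂ] D) :=
  ((LinearMap.mul' ℂ D).lTensor C
      ∘ₗ leg12 D α.twist
      ∘ₗ TensorProduct.mk ℂ D (C ⊗[ℂ] D) d,
    MulOpposite.op ((LinearMap.mulRight ℂ d).lTensor C))

end LeftModuleAlgebra

/-! ## Right comodule coalgebras and the cotwist map -/

/-- The completion `M₀(D ⊗ C)` of the `C`-bimodule `D ⊗ C`: its elements `x` are given by
`λ c = (1 ⊗ c) x` and `ρ c = x (1 ⊗ c)`, where `(1 ⊗ c) (ρ c') = (λ c) (1 ⊗ c')`. -/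
def completedModule (D C : Type*) [AddCommGroup D] [Module ℂ D]
    [NonUnitalRing C] [Module ℂ C] [IsScalarTower ℂ C C] [SMulCommClass ℂ C C] :
    Submodule ℂ ((C →ₗ[ℂ] D ⊗[ℂ] C) × (C →ₗ[ℂ] D ⊗[ℂ] C)) where
  carrier := {x | ∀ c c', (LinearMap.mulLeft ℂ c).lTensor D (x.2 c') =
    (LinearMap.mulRight ℂ c').lTensor D (x.1 c)}
  add_mem' := by
    intro x y hx hy c c'
    simp only [Set.mem_ofPred_eq] at hx hy
    simp [hx, hy]
  zero_mem' := by
    intro c c'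
    simp
  smul_mem' := by
    intro r x hx c c'
    simp only [Set.mem_ofPred_eq] at hx
    simp [hx]

/-- The cotwist map `T(c ⊗ d) = (1 ⊗ c) Γ(d)`. -/
def cotwist (Γ : D →ₗ[ℂ] completedModule D C) : C ⊗[ℂ] D →ₗ[ℂ] D ⊗[ℂ] C :=
  TensorProduct.lift (LinearMap.fst ℂ _ _ ∘ₗ (completedModule D C).subtype ∘ₗ Γ).flip

/-- The map `Tᵒᵖ(c ⊗ d) = Γ(d) (1 ⊗ c)`. -/
def cotwistOp (Γ : D →ₗ[ℂ] completedModule D C) : C ⊗[ℂ] D →ₗ[ℂ] D ⊗[ℂ] C :=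
  TensorProduct.lift (LinearMap.snd ℂ _ _ ∘ₗ (completedModule D C).subtype ∘ₗ Γ).flip

/-- A right coaction `Γ` of `C` on `D` making `D` a right `C`-comodule coalgebra. -/
structure RightComoduleCoalgebra (HC : RegularMultiplierHopfAlgebra (LinearMap.mul ℂ C))
    (HD : RegularMultiplierHopfAlgebra (LinearMap.mul ℂ D)) where
  /-- the coaction -/
  Γ : D →ₗ[ℂ] completedModule D C
  injective : Function.Injective Γ
  /-- `(Γ ⊗ ι)Γ = (ι ⊗ Δ)Γ` in the completion of `D ⊗ C ⊗ C`, multiplied from the left with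
  `1 ⊗ (p ⊗ 1)Δ(q)` (such elements span `1 ⊗ C ⊗ C`). The left hand side becomes
  `(T ⊗ ι)(ι ⊗ T)((p ⊗ 1)Δ(q) ⊗ d)`, the right hand side `(1 ⊗ p ⊗ 1)(ι ⊗ Δ)(T(q ⊗ d))`. -/
  coassoc : ∀ p q d,
    leg12 C (cotwist Γ) (leg23 C (cotwist Γ)
      (TensorProduct.assoc ℂ C C D (HC.T₂ (p ⊗ₜ[ℂ] q) ⊗ₜ[ℂ] d))) =
    (HC.T₂.toLinearMap ∘ₗ TensorProduct.mk ℂ C C p).lTensor D (cotwist Γ (q ⊗ₜ[ℂ] d))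
  /-- The element `x = (T ⊗ ι)(c ⊗ Δ(d))` of the completion of `D ⊗ C ⊗ D` for multiplication in
  the third factor satisfies `(d' ⊗ 1 ⊗ 1) x ∈ D ⊗ C ⊗ D`, and
  `(ι ⊗ T)(T ⊗ ι)(ι ⊗ Δ) = (Δ ⊗ ι)T` holds after multiplication with `d' ⊗ 1 ⊗ 1` from the left. -/
  comul_left : ∀ c d d', ∃ w : D ⊗[ℂ] (C ⊗[ℂ] D),
    (∀ e, ((LinearMap.mulRight ℂ e).lTensor C).lTensor D w =
      (LinearMap.mulLeft ℂ d').rTensor (C ⊗[ℂ] D)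
        (leg12 D (cotwist Γ) (c ⊗ₜ[ℂ] HD.T₁ (d ⊗ₜ[ℂ] e)))) ∧
    leg23 D (cotwist Γ) w = TensorProduct.assoc ℂ D D C
      ((HD.T₂.toLinearMap ∘ₗ TensorProduct.mk ℂ D D d').rTensor C (cotwist Γ (c ⊗ₜ[ℂ] d)))
  /-- The same with `x (d' ⊗ 1 ⊗ 1)`, and multiplication with `d' ⊗ 1 ⊗ 1` from the right. -/
  comul_right : ∀ c d d', ∃ w : D ⊗[ℂ] (C ⊗[ℂ] D),
    (∀ e, ((LinearMap.mulRight ℂ e).lTensor C).lTensor D w =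
      (LinearMap.mulRight ℂ d').rTensor (C ⊗[ℂ] D)
        (leg12 D (cotwist Γ) (c ⊗ₜ[ℂ] HD.T₁ (d ⊗ₜ[ℂ] e)))) ∧
    leg23 D (cotwist Γ) w = TensorProduct.assoc ℂ D D C
      ((HD.T₃.toLinearMap ∘ₗ (TensorProduct.mk ℂ D D).flip d').rTensor C
        (cotwist Γ (c ⊗ₜ[ℂ] d)))

/-! ## Compatibility of the action and the coaction, and the smash coproduct -/

variable {HC : RegularMultiplierHopfAlgebra (LinearMap.mul ℂ C)}
  {HD : RegularMultiplierHopfAlgebra (LinearMap.mul ℂ D)}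

/-- The map `P = Tᵒᵖ ∘ Rᵒᵖ`, that is, `P(d ⊗ c) = ∑ Γ(d₁) (1 ⊗ (d₂ ▷ c))`. -/
def mapP (α : LeftModuleAlgebra HD C) (β : RightComoduleCoalgebra HC HD) :
    D ⊗[ℂ] C →ₗ[ℂ] D ⊗[ℂ] C :=
  cotwistOp β.Γ ∘ₗ α.twistOp

/-- The compatibility conditions between the action and the coaction. -/
structure Compatible (α : LeftModuleAlgebra HD C) (β : RightComoduleCoalgebra HC HD) : Prop where
  /-- `P (m_D ⊗ ι) = (m_D ⊗ ι) P₁₃ P₂₃` on `D ⊗ D ⊗ C` -/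
  mul : mapP α β ∘ₗ (LinearMap.mul' ℂ D).rTensor C
      ∘ₗ (TensorProduct.assoc ℂ D D C).symm.toLinearMap =
    (LinearMap.mul' ℂ D).rTensor C ∘ₗ (TensorProduct.assoc ℂ D D C).symm.toLinearMap
      ∘ₗ leg13 D (mapP α β) ∘ₗ leg23 D (mapP α β)
  /-- `(ι ⊗ Δ_C) P = P₁₂ P₁₃ (ι ⊗ Δ_C)` on `D ⊗ C`, multiplied with `1 ⊗ 1 ⊗ c'` from the right.
  Here `w` is `(P₁₃ (d ⊗ Δ_C(c))) (1 ⊗ 1 ⊗ c')`, an element of `D ⊗ C ⊗ C` determined by its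
  products with the elements `1 ⊗ e ⊗ 1`. -/
  comul : ∀ d c c', ∃ w : D ⊗[ℂ] (C ⊗[ℂ] C),
    (∀ e, ((LinearMap.mulRight ℂ e).rTensor C).lTensor D w =
      ((LinearMap.mulRight ℂ c').lTensor C).lTensor D
        (leg13 C (mapP α β) (d ⊗ₜ[ℂ] HC.T₃ (c ⊗ₜ[ℂ] e)))) ∧
    leg12 C (mapP α β) w =
      (HC.T₁.toLinearMap ∘ₗ (TensorProduct.mk ℂ C C).flip c').lTensor D
        (mapP α β (d ⊗ₜ[ℂ] c))
  /-- `P = T ∘ R` -/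
  comm : mapP α β = cotwist β.Γ ∘ₗ α.twist

/-- `Δ` is the smash coproduct `Δ_#(c d) = ∑ Δ_C(c) Γ(d₁) (1 ⊗ d₂)`, that is,
`(ι ⊗ T ⊗ ι)(Δ_C(c) ⊗ Δ_D(d))`, on `CD`: multiplied with `c' ⊗ 1` from the left and `1 ⊗ d'` from
the right, where `c' ∈ C` and `d' ∈ D` are seen in `M(CD)`, it is the element
`(ι ⊗ T ⊗ ι)((c' ⊗ 1)Δ_C(c) ⊗ Δ_D(d)(1 ⊗ d'))` of `C ⊗ D ⊗ C ⊗ D = CD ⊗ CD`. -/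
def IsSmashCoproduct (α : LeftModuleAlgebra HD C) (β : RightComoduleCoalgebra HC HD)
    (Δ : C ⊗[ℂ] D →ₗ[ℂ] multiplierAlgebra (tensorMul α.smashMul)) : Prop :=
  ∀ c d c' d',
    inFirst (C ⊗[ℂ] D) (α.inclC c') * (Δ (c ⊗ₜ[ℂ] d) : PreMult ((C ⊗[ℂ] D) ⊗[ℂ] (C ⊗[ℂ] D)))
        * inSecond (C ⊗[ℂ] D) (α.inclD d') =
      embed (tensorMul α.smashMul)
        (middle C D (cotwist β.Γ) (HC.T₂ (c' ⊗ₜ[ℂ] c) ⊗ₜ[ℂ] HD.T₁ (d ⊗ₜ[ℂ] d')))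

/-- `ε_#(c d) = ε_C(c) ε_D(d)` -/
def smashCounit (HC : RegularMultiplierHopfAlgebra (LinearMap.mul ℂ C))
    (HD : RegularMultiplierHopfAlgebra (LinearMap.mul ℂ D)) : C ⊗[ℂ] D →ₗ[ℂ] ℂ :=
  LinearMap.mul' ℂ ℂ ∘ₗ TensorProduct.map HC.counit HD.counit

/-- `S_#(c d) = ∑ S_D(d₀) S_C(c d₁) = ∑ S_D(d₀) S_C(d₁) S_C(c)`, where `Γ(d) = ∑ d₀ ⊗ d₁`, so that
`T(c ⊗ d) = ∑ d₀ ⊗ c d₁`; the product `d c` in `CD` is `R(d ⊗ c)`. -/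
def smashAntipode (α : LeftModuleAlgebra HD C) (β : RightComoduleCoalgebra HC HD) :
    C ⊗[ℂ] D →ₗ[ℂ] C ⊗[ℂ] D :=
  α.twist ∘ₗ TensorProduct.map HD.antipode HC.antipode ∘ₗ cotwist β.Γ

end Bicrossproduct

end

/-! A regular multiplier Hopf algebra can be recognised from two bijections, T₁(a ⊗ b) = Δ(a)(1 ⊗ b)
and T₂(a ⊗ b) = (a ⊗ 1)Δ(b). They must satisfy (a ⊗ 1)T₁(b ⊗ c) = T₂(a ⊗ b)(1 ⊗ c), multiplicativity
and coassociativity (`CanonicalMaps`). Given a counit and a bijective S with m(S ⊗ ι)T₁(a ⊗ b) =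
ε(a)b, the two remaining canonical maps are T₂⁻¹ and T₁⁻¹ composed with S and S⁻¹ on one leg, so
regularity comes for free (`exists_regularMultiplierHopfAlgebra`). The proof produces these data for
CD.

The building blocks are R, T and P. The map R is bijective because its inverse can be written with
the antipode of the opposite coproduct of D. The map T is bijective by the analogous argument with
the antipodes of C. Hence P = T ∘ R is bijective. The counit rules (ι ⊗ ε)Γ(d) = d and (ε ⊗ ι)Γ(d) =
ε(d)1 are not hypotheses; they follow from injectivity of Γ and of T (`sliceR_cotwist`,
`sliceL_cotwist`).

On CD put Δ(cd) = Δ(c)Δ(d), where Δ(d)(1 ⊗ y) is P applied after the T₁ of D. Then `smashT₁` is a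
composite of the T₁ of C, P and the T₁ of D. Likewise `smashT₂` is a composite of the T₂ of C
conjugated by R and the T₂ of D conjugated by T. Both are therefore bijective.

Multiplicativity needs Δ(dd') = Δ(d)Δ(d'), which is the condition on P(m ⊗ ι), and Δ(d)Δ(c) = ∑ Δ(d₁
▷ c)Δ(d₂). The latter is obtained from the condition on (ι ⊗ Δ)P by cancelling T, using P = T ∘ R
(`leg12_twist_leg13_mapP`, `leg12_twist_leg13_coproductD`).

Coassociativity says that `smashT₂` on legs 1, 2 commutes with `smashT₁` on legs 2, 3. After
conjugation with T on the middle leg, the D-part of `smashT₂` and the C-part of `smashT₁` act on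
disjoint factors. What remains is coassociativity of C and of D.

For the antipode, applying T to the first leg of Δ(cd)(1 ⊗ y) exposes a factor S_C(q₁)q₂. It
collapses to a counit, (ι ⊗ ε)T removes the coaction, and S_D(d₁)d₂ remains. Bijectivity is clear
from S_# = R(S_D ⊗ S_C)T. -/

noncomputable section

/-! ### Slice maps, cancellation in tensor products, and actions through a leg. -/

section Slices

variable {V W W' X X' Y Y' B B' : Type*} [AddCommGroup X'] [Module ℂ X'] [AddCommGroup V] [Module ℂ V] [AddCommGroup W] [Module ℂ W]
  [AddCommGroup W'] [Module ℂ W'] [AddCommGroup X] [Module ℂ X] [AddCommGroup Y] [Module ℂ Y]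
  [AddCommGroup Y'] [Module ℂ Y'] [AddCommGroup B] [Module ℂ B] [AddCommGroup B'] [Module ℂ B']

/-- `ε ⊗ ι`. -/
def sliceL (W : Type*) [AddCommGroup W] [Module ℂ W] (ε : V →ₗ[ℂ] ℂ) : V ⊗[ℂ] W →ₗ[ℂ] W :=
  (TensorProduct.lid ℂ W).toLinearMap ∘ₗ ε.rTensor W

/-- `ι ⊗ ε`. -/
def sliceR (W : Type*) [AddCommGroup W] [Module ℂ W] (ε : V →ₗ[ℂ] ℂ) : W ⊗[ℂ] V →ₗ[ℂ] W :=
  (TensorProduct.rid ℂ W).toLinearMap ∘ₗ ε.lTensor W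

@[simp] theorem sliceL_tmul (ε : V →ₗ[ℂ] ℂ) (v : V) (w : W) :
    sliceL W ε (v ⊗ₜ w) = ε v • w := by simp [sliceL]

@[simp] theorem sliceR_tmul (ε : V →ₗ[ℂ] ℂ) (v : V) (w : W) :
    sliceR W ε (w ⊗ₜ v) = ε v • w := by simp [sliceR]

/-- A jointly injective family of maps stays jointly injective after tensoring. -/
theorem lTensor_jointly_injective {ι : Sort*} (f : ι → W →ₗ[ℂ] W')
    (hf : ∀ w, (∀ i, f i w = 0) → w = 0) {y y' : X ⊗[ℂ] W}
    (h : ∀ i, (f i).lTensor X y = (f i).lTensor X y') : y = y' := by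
  classical
  -- Coordinates with respect to a basis of `X` reduce the claim to single elements of `W`.
  let B := Module.Basis.ofVectorSpace ℂ X
  have hE : ∀ (f : W →ₗ[ℂ] W') (z : X ⊗[ℂ] W) i,
      TensorProduct.equivFinsuppOfBasisLeft (N := W') B (f.lTensor X z) i =
        f (TensorProduct.equivFinsuppOfBasisLeft (N := W) B z i) := by
    intro f z i
    induction z with
    | zero => simp
    | tmul a b => simp
    | add p q hp hq => simp only [map_add, Finsupp.add_apply, hp, hq]
  apply (TensorProduct.equivFinsuppOfBasisLeft (N := W) B).injective
  ext i
  rw [← sub_eq_zero]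
  refine hf _ fun b => ?_
  have := congrArg (fun z => TensorProduct.equivFinsuppOfBasisLeft (N := W') B z i) (h b)
  simp only [hE] at this
  simp [this]

theorem comm_rTensor (f : W →ₗ[ℂ] W') (z : W ⊗[ℂ] X) :
    TensorProduct.comm ℂ W' X (f.rTensor X z) = f.lTensor X (TensorProduct.comm ℂ W X z) := by
  induction z with
  | zero => simp
  | tmul a b => simp
  | add p q hp hq => simp only [map_add, hp, hq]

theorem comm_lTensor (f : W →ₗ[ℂ] W') (z : X ⊗[ℂ] W) :
    TensorProduct.comm ℂ X W' (f.lTensor X z) = f.rTensor X (TensorProduct.comm ℂ X W z) := by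
  induction z with
  | zero => simp
  | tmul a b => simp
  | add p q hp hq => simp only [map_add, hp, hq]

theorem rTensor_jointly_injective {ι : Sort*} (f : ι → W →ₗ[ℂ] W')
    (hf : ∀ w, (∀ i, f i w = 0) → w = 0) {y y' : W ⊗[ℂ] X}
    (h : ∀ i, (f i).rTensor X y = (f i).rTensor X y') : y = y' := by
  apply (TensorProduct.comm ℂ W X).injective
  refine lTensor_jointly_injective f hf fun i => ?_
  rw [← comm_rTensor, ← comm_rTensor, h]

theorem lTensor_rTensor_comm (f : W →ₗ[ℂ] W') (g : X →ₗ[ℂ] Y) (z : X ⊗[ℂ] W) :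
    f.lTensor Y (g.rTensor W z) = g.rTensor W' (f.lTensor X z) := by
  simp only [← LinearMap.comp_apply, LinearMap.lTensor_comp_rTensor,
    LinearMap.rTensor_comp_lTensor]

/-- Given `G(b ⊗ y) = ∑ b' ⊗ y'` and an action `ρ` of `B` on `X`
(or a bilinear map), the map
`x ⊗ y ↦ ∑ b' x ⊗ y'`. -/
def legAct (ρ : B →ₗ[ℂ] X →ₗ[ℂ] X') (G : B' ⊗[ℂ] Y →ₗ[ℂ] B ⊗[ℂ] Y') :
    B' →ₗ[ℂ] X ⊗[ℂ] Y →ₗ[ℂ] X' ⊗[ℂ] Y' where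
  toFun b := TensorProduct.lift (LinearMap.lcomp ℂ _ (G ∘ₗ TensorProduct.mk ℂ B' Y b) ∘ₗ
    LinearMap.rTensorHom Y' ∘ₗ ρ.flip)
  map_add' a b := by ext; simp
  map_smul' r b := by ext; simp

@[simp] theorem legAct_tmul (ρ : B →ₗ[ℂ] X →ₗ[ℂ] X') (G : B' ⊗[ℂ] Y →ₗ[ℂ] B ⊗[ℂ] Y') (b : B')
    (x : X) (y : Y) : legAct ρ G b (x ⊗ₜ y) = (ρ.flip x).rTensor Y' (G (b ⊗ₜ y)) := by
  simp [legAct]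

end Slices

/-! ### Multiplier Hopf algebras in terms of their canonical maps. -/

/-- The relations satisfied by the maps `T₁(a ⊗ b) = Δ(a)(1 ⊗ b)` and `T₂(a ⊗ b) = (a ⊗ 1)Δ(b)` of
a multiplier Hopf algebra. -/
structure CanonicalMaps {V : Type*} [AddCommGroup V] [Module ℂ V] (μ : V →ₗ[ℂ] V →ₗ[ℂ] V)
    (T₁ T₂ : V ⊗[ℂ] V ≃ₗ[ℂ] V ⊗[ℂ] V) : Prop where
  assoc : ∀ a b c, μ (μ a b) c = μ a (μ b c)
  nondegenerate_left : ∀ a, (∀ b, μ a b = 0) → a = 0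
  nondegenerate_right : ∀ b, (∀ a, μ a b = 0) → b = 0
  -- Both sides are (a ⊗ 1)Δ(b)(1 ⊗ c).
  mul_T₁ : ∀ a b c, (μ a).rTensor V (T₁ (b ⊗ₜ c)) = (μ.flip c).lTensor V (T₂ (a ⊗ₜ b))
  -- The operator `legAct μ T₁ a` is left multiplication by Δ(a), so this is Δ(ab) = Δ(a)Δ(b).
  T₁_mul : ∀ a b c, T₁ (μ a b ⊗ₜ c) = legAct μ T₁.toLinearMap a (T₁ (b ⊗ₜ c))
  coassoc : ∀ a b c, leg12 V T₂.toLinearMap (a ⊗ₜ[ℂ] T₁ (b ⊗ₜ[ℂ] c)) =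
    leg23 V T₁.toLinearMap (TensorProduct.assoc ℂ V V V (T₂ (a ⊗ₜ[ℂ] b) ⊗ₜ[ℂ] c))

/-! ### Multiplicativity of the counit, and an antipode built from T₁ and T₃. -/

section Abstract

variable {V : Type*} [AddCommGroup V] [Module ℂ V] {μ : V →ₗ[ℂ] V →ₗ[ℂ] V}

section Mul

variable (hassoc : ∀ a b c, μ (μ a b) c = μ a (μ b c))
include hassoc

theorem mul_comp_of_assoc (a b : V) : μ a ∘ₗ μ b = μ (μ a b) := by
  ext c; simp [hassoc]

theorem flip_comp_of_assoc (a b : V) : μ.flip b ∘ₗ μ.flip a = μ.flip (μ a b) := by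
  ext c; simp [hassoc]

theorem mul_flip_comm_of_assoc (a b : V) : μ.flip b ∘ₗ μ a = μ a ∘ₗ μ.flip b := by
  ext c; simp [hassoc]

theorem legAct_rTensor {Y Y' : Type*} [AddCommGroup Y] [Module ℂ Y] [AddCommGroup Y'] [Module ℂ Y']
    (G : V ⊗[ℂ] Y →ₗ[ℂ] V ⊗[ℂ] Y') (a c : V) (z : V ⊗[ℂ] Y) :
    legAct μ G a ((μ.flip c).rTensor Y z) = (μ.flip c).rTensor Y' (legAct μ G a z) := by
  induction z with
  | zero => simp
  | tmul x y =>
    rw [legAct_tmul, ← LinearMap.rTensor_comp_apply, flip_comp_of_assoc hassoc]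
    simp
  | add p q hp hq => simp only [map_add, hp, hq]

end Mul

theorem legAct_lTensor {Y : Type*} [AddCommGroup Y] [Module ℂ Y]
    (G : V ⊗[ℂ] Y →ₗ[ℂ] V ⊗[ℂ] Y) (f : Y →ₗ[ℂ] Y)
    (hf : ∀ a y, G (a ⊗ₜ f y) = f.lTensor V (G (a ⊗ₜ y))) (a : V) (z : V ⊗[ℂ] Y) :
    legAct μ G a (f.lTensor V z) = f.lTensor V (legAct μ G a z) := by
  induction z with
  | zero => simp
  | tmul x y => simp [hf, lTensor_rTensor_comm]
  | add p q hp hq => simp only [map_add, hp, hq]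

/-- The data needed to construct an antipode with values in the algebra. -/
structure AntipodeData (μ : V →ₗ[ℂ] V →ₗ[ℂ] V) (T₁ T₃ : V ⊗[ℂ] V ≃ₗ[ℂ] V ⊗[ℂ] V)
    (ε : V →ₗ[ℂ] ℂ) : Prop where
  assoc : ∀ a b c, μ (μ a b) c = μ a (μ b c)
  nondegenerate_left : ∀ a, (∀ b, μ a b = 0) → a = 0
  nondegenerate_right : ∀ b, (∀ a, μ a b = 0) → b = 0
  T₁_mul : ∀ a b c, T₁ (μ a b ⊗ₜ c) = legAct μ T₁.toLinearMap a (T₁ (b ⊗ₜ c))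
  T₃_eq : ∀ a b c, (μ.flip c).lTensor V (T₃ (a ⊗ₜ b)) = (μ.flip b).rTensor V (T₁ (a ⊗ₜ c))
  counit : ∀ a b, sliceL V ε (T₁ (a ⊗ₜ b)) = μ a b

/-- Multiplicativity of T₁ gives (ε ⊗ ι)(Δ(a)z) = a (ε ⊗ ι)(z). Taking z = r ⊗ y yields (ε ⊗ ι)(w(r
⊗ 1)) = ε(r)(ε ⊗ ι)(w) for w = T₁(a ⊗ y), hence for every w. -/
theorem counit_mul_of {T₁ : V ⊗[ℂ] V ≃ₗ[ℂ] V ⊗[ℂ] V} {ε : V →ₗ[ℂ] ℂ}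
    (hassoc : ∀ a b c, μ (μ a b) c = μ a (μ b c))
    (hmul : ∀ a b c, T₁ (μ a b ⊗ₜ c) = legAct μ T₁.toLinearMap a (T₁ (b ⊗ₜ c)))
    (hε : ∀ a b, sliceL V ε (T₁ (a ⊗ₜ b)) = μ a b) (a b : V) : ε (μ a b) = ε a * ε b := by
  have h1 : ∀ a z, sliceL V ε (legAct μ T₁.toLinearMap a z) = μ a (sliceL V ε z) := by
    intro a z
    obtain ⟨w, rfl⟩ := T₁.surjective z
    induction w with
    | zero => simp
    | tmul x y => rw [← hmul, hε, hε, hassoc]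
    | add p q hp hq => simp only [map_add, hp, hq]
  have h2 : ∀ r w, sliceL V ε ((μ.flip r).rTensor V w) = ε r • sliceL V ε w := by
    intro r w
    obtain ⟨w, rfl⟩ := T₁.surjective w
    induction w with
    | zero => simp
    | tmul x y =>
      have := h1 x (r ⊗ₜ y)
      simpa [hε] using this
    | add p q hp hq => simp only [map_add, smul_add, hp, hq]
  by_cases ha : a = 0
  · simp [ha]
  have := h2 b (a ⊗ₜ a)
  simp only [LinearMap.rTensor_tmul, LinearMap.flip_apply, sliceL_tmul, smul_smul] at this
  rw [smul_left_injective ℂ ha this, mul_comm]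

/-- Here `S a b` plays the role of S(a)b, with S(a) possibly not an element of V. The identity
expresses S(ar) = S(r)S(a). It is proved like multiplicativity of ε, starting from m(S ⊗ ι)(Δ(a)z) =
ε(a) m(S ⊗ ι)(z). -/
theorem antipode_mul_of {T₁ : V ⊗[ℂ] V ≃ₗ[ℂ] V ⊗[ℂ] V} {ε : V →ₗ[ℂ] ℂ}
    (hassoc : ∀ a b c, μ (μ a b) c = μ a (μ b c))
    (hmul : ∀ a b c, T₁ (μ a b ⊗ₜ c) = legAct μ T₁.toLinearMap a (T₁ (b ⊗ₜ c)))
    (hε : ∀ a b, sliceL V ε (T₁ (a ⊗ₜ b)) = μ a b) (S : V →ₗ[ℂ] V →ₗ[ℂ] V)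
    (hS : ∀ a b, TensorProduct.lift S (T₁ (a ⊗ₜ b)) = ε a • b) (r : V) (w : V ⊗[ℂ] V) :
    TensorProduct.lift S ((μ.flip r).rTensor V w) = S r (TensorProduct.lift S w) := by
  have h1 : ∀ a z, TensorProduct.lift S (legAct μ T₁.toLinearMap a z) =
      ε a • TensorProduct.lift S z := by
    intro a z
    obtain ⟨w, rfl⟩ := T₁.surjective z
    induction w with
    | zero => simp
    | tmul x y => rw [← hmul, hS, hS, smul_smul, counit_mul_of hassoc hmul hε]
    | add p q hp hq => simp only [map_add, smul_add, hp, hq]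
  obtain ⟨w, rfl⟩ := T₁.surjective w
  induction w with
  | zero => simp
  | tmul x y =>
    have := h1 x (r ⊗ₜ y)
    simpa [hS] using this
  | add p q hp hq => simp only [map_add, hp, hq]

namespace AntipodeData

variable {T₁ T₃ : V ⊗[ℂ] V ≃ₗ[ℂ] V ⊗[ℂ] V} {ε : V →ₗ[ℂ] ℂ} (A : AntipodeData μ T₁ T₃ ε)
include A

theorem T₁_right (a b c : V) : T₁ (a ⊗ₜ μ b c) = (μ.flip c).lTensor V (T₁ (a ⊗ₜ b)) := by
  refine rTensor_jointly_injective μ.flip A.nondegenerate_left fun x => ?_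
  rw [← lTensor_rTensor_comm, ← A.T₃_eq, ← A.T₃_eq, ← LinearMap.lTensor_comp_apply,
    flip_comp_of_assoc A.assoc]

theorem legAct_lTensor (a c : V) (z : V ⊗[ℂ] V) :
    legAct μ T₁.toLinearMap a ((μ.flip c).lTensor V z) =
      (μ.flip c).lTensor V (legAct μ T₁.toLinearMap a z) :=
  _root_.legAct_lTensor _ _ (fun a y => A.T₁_right a y c) a z

theorem T₃_mul (a b c : V) :
    T₃ (μ a b ⊗ₜ c) = legAct μ T₁.toLinearMap a (T₃ (b ⊗ₜ c)) := by
  refine lTensor_jointly_injective μ.flip A.nondegenerate_left fun x => ?_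
  rw [A.T₃_eq, A.T₁_mul, ← legAct_rTensor A.assoc, ← A.T₃_eq, A.legAct_lTensor]

/-- The data of the opposite coproduct. -/
theorem flip (hε : ∀ a b, sliceR V ε (T₃ (a ⊗ₜ b)) = μ a b) :
    AntipodeData μ (T₃.trans (TensorProduct.comm ℂ V V)) (T₁.trans (TensorProduct.comm ℂ V V))
      ε where
  assoc := A.assoc
  nondegenerate_left := A.nondegenerate_left
  nondegenerate_right := A.nondegenerate_right
  T₁_mul a b c := by
    have h : ∀ z, legAct μ (T₃.trans (TensorProduct.comm ℂ V V)).toLinearMap a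
        (TensorProduct.comm ℂ V V z) =
        TensorProduct.comm ℂ V V (legAct μ T₁.toLinearMap a z) := by
      intro z
      induction z with
      | zero => simp
      | tmul x y => simp [← comm_lTensor, A.T₃_eq]
      | add p q hp hq => simp only [map_add, hp, hq]
    simp [h, A.T₃_mul]
  T₃_eq a b c := by simp [← comm_rTensor, ← comm_lTensor, A.T₃_eq]
  counit a b := by
    rw [← hε]
    simp only [LinearEquiv.trans_apply]
    generalize T₃ (a ⊗ₜ b) = z
    induction z with
    | zero => simp
    | tmul x y => simp
    | add p q hp hq => simp only [map_add, hp, hq]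

theorem exists_counit_eq_one [Nontrivial V] : ∃ u, ε u = 1 := by
  have : ε ≠ 0 := by
    rintro rfl
    obtain ⟨v, hv⟩ := exists_ne (0 : V)
    refine hv (A.nondegenerate_left v fun b => ?_)
    rw [← A.counit]
    simp [sliceL]
  obtain ⟨v, hv⟩ : ∃ v, ε v ≠ 0 := by
    by_contra! h
    exact this (LinearMap.ext h)
  exact ⟨(ε v)⁻¹ • v, by simp [hv]⟩

/-- The formula S(a)b = (ε ⊗ ι)T₁⁻¹(a ⊗ b) only defines a map from V to End V. Its values come from
elements of V because m(S ⊗ ι)T₃(p ⊗ q), which does lie in V, multiplies like ε(p)S(q). The same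
relation gives surjectivity, since v = m(S ⊗ ι)T₁(u ⊗ v) when ε(u) = 1 and T₁(u ⊗ v) is in the range
of T₃. -/
theorem exists_antipode : ∃ S : V →ₗ[ℂ] V, Function.Surjective S ∧
    (∀ a b, S (μ a b) = μ (S b) (S a)) ∧
    (∀ a b, TensorProduct.lift (μ ∘ₗ S) (T₁ (a ⊗ₜ b)) = ε a • b) ∧
    (∀ a b, TensorProduct.lift (μ ∘ₗ S) (T₃ (a ⊗ₜ b)) = ε a • S b) := by
  rcases subsingleton_or_nontrivial V with hV | hV
  · exact ⟨0, fun v => ⟨0, Subsingleton.elim _ _⟩, fun _ _ => Subsingleton.elim _ _,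
      fun _ _ => Subsingleton.elim _ _, fun _ _ => Subsingleton.elim _ _⟩
  obtain ⟨u, hu⟩ := A.exists_counit_eq_one
  let S₀ : V →ₗ[ℂ] V →ₗ[ℂ] V := TensorProduct.curry (sliceL V ε ∘ₗ T₁.symm.toLinearMap)
  have hS₀ : ∀ z, TensorProduct.lift S₀ z = sliceL V ε (T₁.symm z) := by
    intro z
    have : TensorProduct.lift S₀ = sliceL V ε ∘ₗ T₁.symm.toLinearMap :=
      TensorProduct.ext' fun _ _ => by simp [S₀]
    simp [this]
  have hS₀T : ∀ a b, TensorProduct.lift S₀ (T₁ (a ⊗ₜ b)) = ε a • b := by simp [hS₀]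
  have hright : ∀ c z, TensorProduct.lift S₀ ((μ.flip c).lTensor V z) =
      μ (TensorProduct.lift S₀ z) c := by
    intro c z
    obtain ⟨w, rfl⟩ := T₁.surjective z
    induction w with
    | zero => simp
    | tmul x y => rw [← A.T₁_right, hS₀T, hS₀T]; simp
    | add p q hp hq => simp only [map_add, LinearMap.add_apply, hp, hq]
  have hT₃ : ∀ p q c, μ (TensorProduct.lift S₀ (T₃ (p ⊗ₜ q))) c = ε p • S₀ q c := by
    intro p q c
    rw [← hright, A.T₃_eq, antipode_mul_of A.assoc A.T₁_mul A.counit S₀ hS₀T, hS₀T, map_smul]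
  -- With ε(u) = 1, the element m(S₀ ⊗ ι)T₃(u ⊗ x) represents the operator `S₀ x`.
  let S : V →ₗ[ℂ] V := TensorProduct.lift S₀ ∘ₗ T₃.toLinearMap ∘ₗ TensorProduct.mk ℂ V V u
  have hS : μ ∘ₗ S = S₀ := by
    ext x c
    simp [S, hT₃, hu]
  have h3 : ∀ a b, TensorProduct.lift (μ ∘ₗ S) (T₃ (a ⊗ₜ b)) = ε a • S b := by
    intro a b
    rw [← sub_eq_zero]
    refine A.nondegenerate_left _ fun c => ?_
    rw [hS, map_sub, LinearMap.sub_apply, hT₃, ← hS]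
    simp
  have h1 : ∀ a b, TensorProduct.lift (μ ∘ₗ S) (T₁ (a ⊗ₜ b)) = ε a • b := by
    rw [hS]; exact hS₀T
  refine ⟨S, fun v => ?_, fun a b => ?_, h1, h3⟩
  · obtain ⟨w, hw⟩ := T₃.surjective (T₁ (u ⊗ₜ v))
    have h4 : TensorProduct.lift (μ ∘ₗ S) (T₃ w) = v := by rw [hw, h1, hu, one_smul]
    have h5 : ∀ w, TensorProduct.lift (μ ∘ₗ S) (T₃ w) = S (sliceL V ε w) := by
      intro w
      induction w with
      | zero => simp
      | tmul x y => simp [h3]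
      | add p q hp hq => simp only [map_add, hp, hq]
    exact ⟨_, by rw [← h5, h4]⟩
  · rw [← sub_eq_zero]
    refine A.nondegenerate_left _ fun c => ?_
    have := antipode_mul_of A.assoc A.T₁_mul A.counit (μ ∘ₗ S) h1 b (a ⊗ₜ c)
    simp only [LinearMap.rTensor_tmul, LinearMap.flip_apply, TensorProduct.lift.tmul,
      LinearMap.comp_apply] at this
    rw [map_sub, LinearMap.sub_apply, this, A.assoc, sub_self]

/-- The antipode S' of the opposite coproduct is a left inverse of S. Checked on the range of T₁,
one has S'(S(a)b) = S'(b)a. Anti-multiplicativity turns this into S'(b)S'(S(a)) = S'(b)a, and S' is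
onto. -/
theorem bijective_antipode (hε : ∀ a b, sliceR V ε (T₃ (a ⊗ₜ b)) = μ a b) :
    ∃ S : V ≃ₗ[ℂ] V, (∀ a b, S (μ a b) = μ (S b) (S a)) ∧
    (∀ a b, TensorProduct.lift (μ ∘ₗ S.toLinearMap) (T₁ (a ⊗ₜ b)) = ε a • b) ∧
    (∀ a b, TensorProduct.lift (μ ∘ₗ S.toLinearMap) (T₃ (a ⊗ₜ b)) = ε a • S b) := by
  obtain ⟨S, hS, hmul, h1, h3⟩ := A.exists_antipode
  obtain ⟨S', hS', hmul', h1', h3'⟩ := (A.flip hε).exists_antipode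
  have hinj : ∀ x, S' (S x) = x := by
    intro x
    have h4 : ∀ z : V ⊗[ℂ] V, S' (TensorProduct.lift (μ ∘ₗ S) z) =
        TensorProduct.lift (μ ∘ₗ S') (TensorProduct.comm ℂ V V z) := by
      intro z
      obtain ⟨w, rfl⟩ := T₁.surjective z
      induction w with
      | zero => simp
      | tmul a b =>
        have := h3' a b
        simp only [LinearEquiv.trans_apply] at this
        rw [h1, this, map_smul]
      | add p q hp hq => simp only [map_add, hp, hq]
    rw [← sub_eq_zero]
    refine A.nondegenerate_right _ fun y => ?_
    obtain ⟨y, rfl⟩ := hS' y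
    have := h4 (x ⊗ₜ y)
    simp only [TensorProduct.lift.tmul, LinearMap.comp_apply, hmul',
      TensorProduct.comm_tmul] at this
    rw [map_sub, this, sub_self]
  exact ⟨LinearEquiv.ofBijective S ⟨(Function.LeftInverse.injective hinj), hS⟩, hmul, h1, h3⟩

end AntipodeData

end Abstract

/-! ### Leg-numbered maps on elementary tensors. -/

section Legs

variable {X Y Z W Y' Z' Y'' Z'' : Type*}
  [AddCommGroup X] [Module ℂ X] [AddCommGroup Y] [Module ℂ Y] [AddCommGroup Z] [Module ℂ Z]
  [AddCommGroup W] [Module ℂ W] [AddCommGroup Y'] [Module ℂ Y'] [AddCommGroup Z'] [Module ℂ Z']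

theorem leg12_tmul (f : X ⊗[ℂ] Y →ₗ[ℂ] Y' ⊗[ℂ] Z') (x : X) (y : Y) (w : W) :
    leg12 W f (x ⊗ₜ (y ⊗ₜ w)) = TensorProduct.assoc ℂ Y' Z' W (f (x ⊗ₜ y) ⊗ₜ w) := by
  simp [leg12]

theorem leg13_tmul (f : X ⊗[ℂ] Y →ₗ[ℂ] Y' ⊗[ℂ] Z') (x : X) (y : Y) (w : W) :
    leg13 W f (x ⊗ₜ (w ⊗ₜ y)) = TensorProduct.leftComm ℂ W Y' Z' (w ⊗ₜ f (x ⊗ₜ y)) := by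
  simp [leg13]

theorem leg23_tmul (f : X ⊗[ℂ] Y →ₗ[ℂ] Y' ⊗[ℂ] Z') (z : X ⊗[ℂ] Y) (w : W) :
    leg23 W f (w ⊗ₜ z) = w ⊗ₜ f z := by
  simp [leg23]

end Legs

/-! ### Multipliers of V and of V ⊗ V. -/

section Multipliers

variable {V : Type*} [AddCommGroup V] [Module ℂ V] {ν : V →ₗ[ℂ] V →ₗ[ℂ] V}

/-- Non-degeneracy lets a(xb) = (ax)b recover right multiplication from left multiplication. All
later identities of multipliers are thus checked on the left component only. -/
theorem multiplier_ext (hν : ∀ a, (∀ b, ν a b = 0) → a = 0) {x y : PreMult V}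
    (hx : x ∈ multiplierAlgebra ν) (hy : y ∈ multiplierAlgebra ν) (h : x.1 = y.1) : x = y := by
  refine Prod.ext h (MulOpposite.unop_injective (LinearMap.ext fun a => ?_))
  rw [← sub_eq_zero]
  refine hν _ fun b => ?_
  rw [map_sub, LinearMap.sub_apply, ← hx a b, ← hy a b, h, sub_self]

theorem embed_mem (hassoc : ∀ a b c, ν (ν a b) c = ν a (ν b c)) (v : V) :
    embed ν v ∈ multiplierAlgebra ν := by
  intro a b
  simp [embed, hassoc]

theorem tensorMul_tmul_right (z : V ⊗[ℂ] V) (p q : V) : tensorMul ν z (p ⊗ₜ q) =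
    (ν.flip q).lTensor V ((ν.flip p).rTensor V z) := by
  induction z with
  | zero => simp
  | tmul a b => simp
  | add p q hp hq => simp only [map_add, LinearMap.add_apply, hp, hq]

theorem tensorMul_tmul_left (z : V ⊗[ℂ] V) (p q : V) : tensorMul ν (p ⊗ₜ q) z =
    (ν q).lTensor V ((ν p).rTensor V z) := by
  induction z with
  | zero => simp
  | tmul a b => simp
  | add p q hp hq => simp only [map_add, hp, hq]

theorem tensorMul_assoc (hassoc : ∀ a b c, ν (ν a b) c = ν a (ν b c)) (x y z : V ⊗[ℂ] V) :
    tensorMul ν (tensorMul ν x y) z = tensorMul ν x (tensorMul ν y z) := by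
  induction x with
  | zero => simp
  | add p q hp hq => simp only [map_add, LinearMap.add_apply, hp, hq]
  | tmul a b =>
  induction y with
  | zero => simp
  | add p q hp hq => simp only [map_add, LinearMap.add_apply, hp, hq]
  | tmul a' b' =>
  induction z with
  | zero => simp
  | add p q hp hq => simp only [map_add, hp, hq]
  | tmul a'' b'' => simp [hassoc]

theorem tensorMul_nondegenerate_left (hν : ∀ a, (∀ b, ν a b = 0) → a = 0) (x : V ⊗[ℂ] V)
    (h : ∀ y, tensorMul ν x y = 0) : x = 0 := by
  refine rTensor_jointly_injective ν.flip hν fun p => ?_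
  refine lTensor_jointly_injective ν.flip hν fun q => ?_
  rw [← tensorMul_tmul_right, h]
  simp

theorem tensorMul_nondegenerate_right (hν : ∀ b, (∀ a, ν a b = 0) → b = 0) (x : V ⊗[ℂ] V)
    (h : ∀ y, tensorMul ν y x = 0) : x = 0 := by
  refine rTensor_jointly_injective ν hν fun p => ?_
  refine lTensor_jointly_injective ν hν fun q => ?_
  rw [← tensorMul_tmul_left, h]
  simp

theorem inFirst_mem {x : PreMult V} (hx : x ∈ multiplierAlgebra ν) :
    inFirst V x ∈ multiplierAlgebra (tensorMul ν) := by
  intro a b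
  induction a with
  | zero => simp
  | add p q hp hq => simp only [map_add, LinearMap.add_apply, hp, hq]
  | tmul a a' =>
  induction b with
  | zero => simp
  | add p q hp hq => simp only [map_add, hp, hq]
  | tmul b b' => simp [inFirst, hx a b]

theorem inSecond_mem {x : PreMult V} (hx : x ∈ multiplierAlgebra ν) :
    inSecond V x ∈ multiplierAlgebra (tensorMul ν) := by
  intro a b
  induction a with
  | zero => simp
  | add p q hp hq => simp only [map_add, LinearMap.add_apply, hp, hq]
  | tmul a a' =>
  induction b with
  | zero => simp
  | add p q hp hq => simp only [map_add, hp, hq]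
  | tmul b b' => simp [inSecond, hx a' b']

end Multipliers

/-! ### Counit and inverse formulas from T₁ and T₂. -/

namespace CanonicalMaps

variable {V : Type*} [AddCommGroup V] [Module ℂ V] {μ : V →ₗ[ℂ] V →ₗ[ℂ] V}
  {T₁ T₂ : V ⊗[ℂ] V ≃ₗ[ℂ] V ⊗[ℂ] V} (M : CanonicalMaps μ T₁ T₂)
include M

theorem T₁_right (a b c : V) : T₁ (a ⊗ₜ μ b c) = (μ.flip c).lTensor V (T₁ (a ⊗ₜ b)) := by
  refine rTensor_jointly_injective μ M.nondegenerate_right fun x => ?_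
  rw [← lTensor_rTensor_comm, M.mul_T₁, M.mul_T₁, ← LinearMap.lTensor_comp_apply,
    flip_comp_of_assoc M.assoc]

/-- For z = T₁(b ⊗ c) coassociativity supplies a T₁ that cancels T₁⁻¹, leaving T₂(a ⊗ b)(1 ⊗ c) = (a
⊗ 1)z. -/
theorem lTensor_lift_symm_leg12 (a : V) (z : V ⊗[ℂ] V) :
    (TensorProduct.lift μ ∘ₗ T₁.symm.toLinearMap).lTensor V (leg12 V T₂.toLinearMap (a ⊗ₜ z)) =
      (μ a).rTensor V z := by
  obtain ⟨w, rfl⟩ := T₁.surjective z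
  induction w with
  | zero => simp
  | tmul b c =>
    rw [M.coassoc, M.mul_T₁]
    generalize T₂ (a ⊗ₜ b) = y
    induction y with
    | zero => simp
    | tmul x y => simp [leg23]
    | add p q hp hq => simp only [map_add, TensorProduct.add_tmul, hp, hq]
  | add p q hp hq => simp only [map_add, TensorProduct.tmul_add, hp, hq]

/-- This equality of elementary tensors forces m T₁⁻¹(y ⊗ c) to be a scalar multiple of c, with the
scalar depending on y alone. That scalar is the counit. -/
theorem tmul_lift_symm (x y c : V) :
    x ⊗ₜ[ℂ] TensorProduct.lift μ (T₁.symm (y ⊗ₜ c)) =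
      TensorProduct.lift μ (T₂.symm (x ⊗ₜ y)) ⊗ₜ[ℂ] c := by
  have h : ∀ w : V ⊗[ℂ] V, (TensorProduct.lift μ ∘ₗ T₁.symm.toLinearMap).lTensor V
      (TensorProduct.assoc ℂ V V V (w ⊗ₜ c)) = TensorProduct.lift μ (T₂.symm w) ⊗ₜ[ℂ] c := by
    intro w
    obtain ⟨w, rfl⟩ := T₂.surjective w
    induction w with
    | zero => simp
    | tmul a b =>
      have := M.lTensor_lift_symm_leg12 a (b ⊗ₜ c)
      rw [leg12_tmul] at this
      simpa using this
    | add p q hp hq => simp only [map_add, TensorProduct.add_tmul, hp, hq]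
  simpa using h (x ⊗ₜ y)

theorem exists_counit : ∃ ε : V →ₗ[ℂ] ℂ, (∀ a b, sliceL V ε (T₁ (a ⊗ₜ b)) = μ a b) ∧
    (∀ a b, sliceR V ε (T₂ (a ⊗ₜ b)) = μ a b) := by
  rcases subsingleton_or_nontrivial V with hV | hV
  · exact ⟨0, fun _ _ => Subsingleton.elim _ _, fun _ _ => Subsingleton.elim _ _⟩
  obtain ⟨x₀, hx₀⟩ := exists_ne (0 : V)
  obtain ⟨ω, hω⟩ : ∃ ω : V →ₗ[ℂ] ℂ, ω x₀ = 1 := by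
    by_contra! h
    refine hx₀ ((Module.forall_dual_apply_eq_zero_iff ℂ x₀).1 fun f => ?_)
    by_contra hf
    exact h ((f x₀)⁻¹ • f) (by simp [hf])
  -- The vector m T₂⁻¹(x₀ ⊗ y) is a multiple of x₀, and ω(x₀) = 1 reads off the factor.
  let ε : V →ₗ[ℂ] ℂ := ω ∘ₗ TensorProduct.lift μ ∘ₗ T₂.symm.toLinearMap ∘ₗ
    TensorProduct.mk ℂ V V x₀
  have h1 : ∀ y c, TensorProduct.lift μ (T₁.symm (y ⊗ₜ c)) = ε y • c := by
    intro y c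
    have := congrArg (sliceL V ω) (M.tmul_lift_symm x₀ y c)
    simpa [hω, ε] using this
  have h2 : ∀ x y, TensorProduct.lift μ (T₂.symm (x ⊗ₜ y)) = ε y • x := by
    intro x y
    have := congrArg (sliceR V ω) (M.tmul_lift_symm x y x₀)
    simpa [hω, h1] using this.symm
  refine ⟨ε, fun a b => ?_, fun a b => ?_⟩
  · have : ∀ z, sliceL V ε z = TensorProduct.lift μ (T₁.symm z) := by
      intro z
      induction z with
      | zero => simp
      | tmul a b => simp [h1]
      | add p q hp hq => simp only [map_add, hp, hq]
    simp [this]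
  · have : ∀ z, sliceR V ε z = TensorProduct.lift μ (T₂.symm z) := by
      intro z
      induction z with
      | zero => simp
      | tmul a b => simp [h2]
      | add p q hp hq => simp only [map_add, hp, hq]
    simp [this]

variable {ε : V →ₗ[ℂ] ℂ} (hε : ∀ a b, sliceL V ε (T₁ (a ⊗ₜ b)) = μ a b)
include hε

/-- A functional with the T₁ counit property is unique because T₁ is onto, so it agrees with the
two-sided one from `exists_counit`. -/
theorem counit_right (a b : V) : sliceR V ε (T₂ (a ⊗ₜ b)) = μ a b := by
  obtain ⟨ε', h1, h2⟩ := M.exists_counit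
  have key : ∀ x, sliceL V ε x = sliceL V ε' x := by
    intro x
    obtain ⟨y, rfl⟩ := T₁.surjective x
    induction y with
    | zero => simp
    | tmul a b => rw [hε, h1]
    | add p q hp hq => simp only [map_add, hp, hq]
  have : ε = ε' := by
    ext a
    by_cases ha : a = 0
    · simp [ha]
    have := key (a ⊗ₜ a)
    simp only [sliceL_tmul] at this
    exact smul_left_injective ℂ ha this
  rw [this, h2]

theorem counit_mul (a b : V) : ε (μ a b) = ε a * ε b :=
  counit_mul_of M.assoc M.T₁_mul hε a b

omit M in
theorem lift_symm (z : V ⊗[ℂ] V) : TensorProduct.lift μ (T₁.symm z) = sliceL V ε z := by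
  obtain ⟨w, rfl⟩ := T₁.surjective z
  induction w with
  | zero => simp
  | tmul a b => simp [hε]
  | add p q hp hq => simp only [map_add, hp, hq]

section Antipode

variable {S : V →ₗ[ℂ] V} (hS : ∀ a b, TensorProduct.lift (μ ∘ₗ S) (T₁ (a ⊗ₜ b)) = ε a • b)
include hS

theorem antipode_mul (a b : V) : S (μ a b) = μ (S b) (S a) := by
  rw [← sub_eq_zero]
  refine M.nondegenerate_left _ fun c => ?_
  have := antipode_mul_of M.assoc M.T₁_mul hε (μ ∘ₗ S) hS b (a ⊗ₜ c)
  simp only [LinearMap.rTensor_tmul, LinearMap.flip_apply, TensorProduct.lift.tmul,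
    LinearMap.comp_apply] at this
  rw [map_sub, LinearMap.sub_apply, this, M.assoc, sub_self]

/-- Covered form of T₁⁻¹(a ⊗ b) = ∑ a₁ ⊗ S(a₂)b. -/
theorem mul_T₁_symm (c : V) (z : V ⊗[ℂ] V) : (μ c).rTensor V (T₁.symm z) =
    (TensorProduct.lift (μ ∘ₗ S)).lTensor V (leg12 V T₂.toLinearMap (c ⊗ₜ z)) := by
  obtain ⟨w, rfl⟩ := T₁.surjective z
  induction w with
  | zero => simp
  | tmul p q =>
    rw [M.coassoc]
    have : ∀ y : V ⊗[ℂ] V, (TensorProduct.lift (μ ∘ₗ S)).lTensor V (leg23 V T₁.toLinearMap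
        (TensorProduct.assoc ℂ V V V (y ⊗ₜ q))) = sliceR V ε y ⊗ₜ q := by
      intro y
      induction y with
      | zero => simp
      | tmul a b => simp [leg23, hS, TensorProduct.smul_tmul]
      | add p q hp hq => simp only [map_add, TensorProduct.add_tmul, hp, hq]
    rw [this, M.counit_right hε]
    simp
  | add p q hp hq => simp only [map_add, TensorProduct.tmul_add, hp, hq]

/-- Multiplying out the formula for T₁⁻¹ and using m T₁⁻¹ = ε ⊗ ι converts the left antipode law
into the right one. -/
theorem antipode_right (a b : V) :
    TensorProduct.lift μ (S.lTensor V (T₂ (a ⊗ₜ b))) = ε b • a := by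
  rw [← sub_eq_zero]
  refine M.nondegenerate_left _ fun c => ?_
  have h1 := congrArg (TensorProduct.lift μ) (M.mul_T₁_symm hε hS a (b ⊗ₜ c))
  have h2 : ∀ y : V ⊗[ℂ] V, TensorProduct.lift μ ((μ a).rTensor V y) =
      μ a (TensorProduct.lift μ y) := by
    intro y
    induction y with
    | zero => simp
    | tmul a b => simp [M.assoc]
    | add p q hp hq => simp only [map_add, hp, hq]
  have h3 : ∀ y : V ⊗[ℂ] V, TensorProduct.lift μ ((TensorProduct.lift (μ ∘ₗ S)).lTensor V
      (TensorProduct.assoc ℂ V V V (y ⊗ₜ c))) =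
      μ (TensorProduct.lift μ (S.lTensor V y)) c := by
    intro y
    induction y with
    | zero => simp
    | tmul a b => simp [M.assoc]
    | add p q hp hq => simp only [map_add, TensorProduct.add_tmul, LinearMap.add_apply, hp, hq]
  rw [h2, lift_symm hε, leg12_tmul, LinearEquiv.coe_coe, h3] at h1
  rw [map_sub, LinearMap.sub_apply, ← h1]
  simp

/-- Covered form of T₂⁻¹(c ⊗ a) = ∑ cS(a₁) ⊗ a₂. -/
theorem mul_rTensor_T₁ (c a y : V) : (μ c).rTensor V (S.rTensor V (T₁ (a ⊗ₜ y))) =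
    (μ.flip y).lTensor V (T₂.symm (c ⊗ₜ a)) := by
  have h1 : ∀ z : V ⊗[ℂ] V, (TensorProduct.lift μ ∘ₗ S.lTensor V).rTensor V
      ((TensorProduct.assoc ℂ V V V).symm (leg23 V T₁.toLinearMap
        (TensorProduct.assoc ℂ V V V (z ⊗ₜ y)))) = (μ.flip y).lTensor V (T₂.symm z) := by
    intro z
    obtain ⟨w, rfl⟩ := T₂.surjective z
    induction w with
    | zero => simp
    | tmul p q =>
      rw [← M.coassoc]
      have h2 : ∀ w : V ⊗[ℂ] V, (TensorProduct.lift μ ∘ₗ S.lTensor V).rTensor V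
          ((TensorProduct.assoc ℂ V V V).symm (leg12 V T₂.toLinearMap (p ⊗ₜ w))) =
          p ⊗ₜ sliceL V ε w := by
        intro w
        induction w with
        | zero => simp
        | tmul a b => simp [leg12, M.antipode_right hε hS, TensorProduct.smul_tmul]
        | add p q hp hq => simp only [map_add, TensorProduct.tmul_add, hp, hq]
      rw [h2, hε]
      simp
    | add p q hp hq => simp only [map_add, TensorProduct.add_tmul, hp, hq]
  have := h1 (c ⊗ₜ a)
  rw [← this, TensorProduct.assoc_tmul, leg23_tmul, LinearEquiv.coe_coe]
  generalize T₁ (a ⊗ₜ y) = z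
  induction z with
  | zero => simp
  | tmul a b => simp
  | add p q hp hq => simp only [map_add, TensorProduct.tmul_add, hp, hq]

end Antipode

end CanonicalMaps

section Components

variable {V : Type*} [AddCommGroup V] [Module ℂ V] (ν : V →ₗ[ℂ] V →ₗ[ℂ] V)

theorem embed_fst (v : V) : (embed ν v).1 = ν v := rfl

theorem inFirst_fst (W : Type*) [AddCommGroup W] [Module ℂ W] (x : PreMult V) :
    (inFirst W x).1 = x.1.rTensor W := rfl

theorem inSecond_fst (W : Type*) [AddCommGroup W] [Module ℂ W] (x : PreMult V) :
    (inSecond W x).1 = x.1.lTensor W := rfl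

end Components

/-! ### Reconstruction of a regular multiplier Hopf algebra. -/

namespace CanonicalMaps

variable {V : Type*} [AddCommGroup V] [Module ℂ V] {μ : V →ₗ[ℂ] V →ₗ[ℂ] V}
  {T₁ T₂ : V ⊗[ℂ] V ≃ₗ[ℂ] V ⊗[ℂ] V}

/-- The map `x ⊗ y ↦ (1 ⊗ y) T(x ⊗ a)`. -/
def legActRight (μ : V →ₗ[ℂ] V →ₗ[ℂ] V) (T : V ⊗[ℂ] V →ₗ[ℂ] V ⊗[ℂ] V) :
    V →ₗ[ℂ] V ⊗[ℂ] V →ₗ[ℂ] V ⊗[ℂ] V where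
  toFun a := TensorProduct.lift (LinearMap.lcomp ℂ _ (T ∘ₗ (TensorProduct.mk ℂ V V).flip a) ∘ₗ
    LinearMap.lTensorHom V ∘ₗ μ).flip
  map_add' a b := by ext; simp
  map_smul' r b := by ext; simp

@[simp] theorem legActRight_tmul (T : V ⊗[ℂ] V →ₗ[ℂ] V ⊗[ℂ] V) (a x y : V) :
    legActRight μ T a (x ⊗ₜ y) = (μ y).lTensor V (T (x ⊗ₜ a)) := by
  simp [legActRight]

variable (M : CanonicalMaps μ T₁ T₂)
include M

theorem rTensor_mul_flip (a b : V) (z : V ⊗[ℂ] V) : (μ a).rTensor V ((μ.flip b).rTensor V z) =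
    (μ.flip b).rTensor V ((μ a).rTensor V z) := by
  rw [← LinearMap.rTensor_comp_apply, ← LinearMap.rTensor_comp_apply,
    mul_flip_comm_of_assoc M.assoc]

theorem lTensor_mul_flip (a b : V) (z : V ⊗[ℂ] V) : (μ a).lTensor V ((μ.flip b).lTensor V z) =
    (μ.flip b).lTensor V ((μ a).lTensor V z) := by
  rw [← LinearMap.lTensor_comp_apply, ← LinearMap.lTensor_comp_apply,
    mul_flip_comm_of_assoc M.assoc]

/-- T₁ encodes left multiplication by Δ(a) and T₂ right multiplication. The relation `mul_T₁` is
what makes the pair a multiplier. -/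
theorem coproduct_mem (a : V) :
    ((legAct μ T₁.toLinearMap a, MulOpposite.op (legActRight μ T₂.toLinearMap a)) :
      PreMult (V ⊗[ℂ] V)) ∈ multiplierAlgebra (tensorMul μ) := by
  intro u v
  induction u with
  | zero => simp
  | add p q hp hq => simp only [map_add, LinearMap.add_apply, hp, hq]
  | tmul p q =>
  induction v with
  | zero => simp
  | add p q hp hq => simp only [map_add, hp, hq]
  | tmul x y =>
    rw [tensorMul_tmul_right, tensorMul_tmul_left]
    simp only [legAct_tmul, MulOpposite.unop_op, legActRight_tmul, LinearEquiv.coe_coe]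
    rw [M.rTensor_mul_flip, M.mul_T₁]
    simp only [lTensor_rTensor_comm]
    rw [M.lTensor_mul_flip]

/-- A bijective antipode transfers bijectivity from T₂⁻¹ and T₁⁻¹ to the canonical maps of the
opposite coproduct, so nothing has to be checked about T₃ and T₄ beforehand. -/
theorem exists_regularMultiplierHopfAlgebra {ε : V →ₗ[ℂ] ℂ}
    (hε : ∀ a b, sliceL V ε (T₁ (a ⊗ₜ b)) = μ a b) {S : V →ₗ[ℂ] V} (hSb : Function.Bijective S)
    (hS : ∀ a b, TensorProduct.lift (μ ∘ₗ S) (T₁ (a ⊗ₜ b)) = ε a • b) :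
    ∃ H : RegularMultiplierHopfAlgebra μ, H.T₁ = T₁ ∧ H.T₂ = T₂ ∧
      (∀ a, (H.Δ a : PreMult (V ⊗[ℂ] V)).1 = legAct μ T₁.toLinearMap a) ∧
      H.IsCounit ε ∧ H.IsAntipode ε S := by
  let e : V ≃ₗ[ℂ] V := LinearEquiv.ofBijective S hSb
  have he : ∀ v, e v = S v := fun v => rfl
  let Δ : V →ₗ[ℂ] multiplierAlgebra (tensorMul μ) :=
    { toFun := fun a => ⟨_, M.coproduct_mem a⟩
      map_add' := fun a b => by ext <;> simp
      map_smul' := fun r a => by ext <;> simp }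
  have hΔ : ∀ a, (Δ a : PreMult (V ⊗[ℂ] V)).1 = legAct μ T₁.toLinearMap a := fun a => rfl
  -- In Sweedler notation, a ⊗ b ↦ S(b) ⊗ a ↦ ∑ S(b)S(a₁) ⊗ a₂ = ∑ S(a₁b) ⊗ a₂ ↦ ∑ a₁b ⊗ a₂.
  let T₃ : V ⊗[ℂ] V ≃ₗ[ℂ] V ⊗[ℂ] V := (TensorProduct.comm ℂ V V).trans
    ((TensorProduct.congr e (LinearEquiv.refl ℂ V)).trans
      (T₂.symm.trans (TensorProduct.congr e.symm (LinearEquiv.refl ℂ V))))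
  -- In Sweedler notation, a ⊗ b ↦ b ⊗ S(a) ↦ ∑ b₁ ⊗ S(b₂)S(a) = ∑ b₁ ⊗ S(ab₂) ↦ ∑ b₁ ⊗ ab₂.
  let T₄ : V ⊗[ℂ] V ≃ₗ[ℂ] V ⊗[ℂ] V := (TensorProduct.comm ℂ V V).trans
    ((TensorProduct.congr (LinearEquiv.refl ℂ V) e).trans
      (T₁.symm.trans (TensorProduct.congr (LinearEquiv.refl ℂ V) e.symm)))
  have hl : ∀ z : V ⊗[ℂ] V, S.lTensor V (TensorProduct.congr (LinearEquiv.refl ℂ V) e.symm z) =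
      z := by
    intro z
    induction z with
    | zero => simp
    | tmul a b => simp [← he]
    | add p q hp hq => simp only [map_add, hp, hq]
  have hr : ∀ z : V ⊗[ℂ] V, S.rTensor V (TensorProduct.congr e.symm (LinearEquiv.refl ℂ V) z) =
      z := by
    intro z
    induction z with
    | zero => simp
    | tmul a b => simp [← he]
    | add p q hp hq => simp only [map_add, hp, hq]
  have hSmul := M.antipode_mul hε hS
  have hT₃ : ∀ a b c, (μ.flip c).lTensor V (T₃ (a ⊗ₜ b)) =
      (μ.flip b).rTensor V (T₁ (a ⊗ₜ c)) := by
    intro a b c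
    refine rTensor_jointly_injective (fun _ : Unit => S)
      (fun w hw => hSb.1 (by simpa using hw ())) fun _ => ?_
    have h1 : S.rTensor V (T₃ (a ⊗ₜ b)) = T₂.symm (S b ⊗ₜ a) := by
      simp [T₃, hr, he]
    have h2 : S ∘ₗ μ.flip b = μ (S b) ∘ₗ S := by
      ext; simp [hSmul]
    rw [← lTensor_rTensor_comm, h1, ← LinearMap.rTensor_comp_apply, h2,
      LinearMap.rTensor_comp_apply, M.mul_rTensor_T₁ hε hS]
  have hT₄ : ∀ a b c, (μ.flip a).lTensor V (T₄ (c ⊗ₜ b)) =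
      (μ c).lTensor V (T₁ (b ⊗ₜ a)) := by
    intro a b c
    refine rTensor_jointly_injective μ M.nondegenerate_right fun x => ?_
    rw [← lTensor_rTensor_comm, ← lTensor_rTensor_comm, M.mul_T₁, M.lTensor_mul_flip]
    congr 1
    refine lTensor_jointly_injective (fun _ : Unit => S)
      (fun w hw => hSb.1 (by simpa using hw ())) fun _ => ?_
    have h1 : S.lTensor V (T₄ (c ⊗ₜ b)) = T₁.symm (b ⊗ₜ S c) := by
      simp [T₄, hl, he]
    have h2 : S ∘ₗ μ c = μ.flip (S c) ∘ₗ S := by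
      ext; simp [hSmul]
    rw [lTensor_rTensor_comm, h1, M.mul_T₁_symm hε hS, leg12_tmul, ← LinearMap.lTensor_comp_apply,
      h2, LinearEquiv.coe_coe]
    generalize T₂ (x ⊗ₜ b) = z
    induction z with
    | zero => simp
    | tmul a b => simp
    | add p q hp hq => simp only [map_add, TensorProduct.add_tmul, hp, hq]
  have hnd := tensorMul_nondegenerate_left M.nondegenerate_left
  have hass := tensorMul_assoc M.assoc
  have hemb : ∀ z, embed (tensorMul μ) z ∈ multiplierAlgebra (tensorMul μ) := embed_mem hass
  let H : RegularMultiplierHopfAlgebra μ :=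
    { assoc := M.assoc
      nondegenerate_left := M.nondegenerate_left
      nondegenerate_right := M.nondegenerate_right
      Δ := Δ
      Δ_mul := fun a b => by
        refine Subtype.ext (multiplier_ext hnd (Δ _).2 (Δ a * Δ b).2 ?_)
        refine TensorProduct.ext' fun x y => ?_
        simp only [MulMemClass.coe_mul, Prod.fst_mul, hΔ, Module.End.mul_apply, legAct_tmul,
          LinearEquiv.coe_coe]
        rw [legAct_rTensor M.assoc, M.T₁_mul]
      T₁ := T₁
      T₂ := T₂
      T₃ := T₃
      T₄ := T₄
      T₁_spec := fun a b => by
        refine multiplier_ext hnd (hemb _)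
          (mul_mem (Δ a).2 (inSecond_mem (embed_mem M.assoc b))) ?_
        refine TensorProduct.ext' fun x y => ?_
        simp only [Prod.fst_mul, hΔ, Module.End.mul_apply, embed_fst, inSecond_fst,
          LinearMap.lTensor_tmul, legAct_tmul, LinearEquiv.coe_coe]
        rw [tensorMul_tmul_right, lTensor_rTensor_comm, M.T₁_right]
      T₂_spec := fun a b => by
        refine multiplier_ext hnd (hemb _)
          (mul_mem (inFirst_mem (embed_mem M.assoc a)) (Δ b).2) ?_
        refine TensorProduct.ext' fun x y => ?_
        simp only [Prod.fst_mul, hΔ, Module.End.mul_apply, embed_fst, inFirst_fst,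
          legAct_tmul, LinearEquiv.coe_coe]
        rw [tensorMul_tmul_right, M.rTensor_mul_flip, M.mul_T₁, lTensor_rTensor_comm]
      T₃_spec := fun a b => by
        refine multiplier_ext hnd (hemb _)
          (mul_mem (Δ a).2 (inFirst_mem (embed_mem M.assoc b))) ?_
        refine TensorProduct.ext' fun x y => ?_
        simp only [Prod.fst_mul, hΔ, Module.End.mul_apply, embed_fst, inFirst_fst,
          LinearMap.rTensor_tmul, legAct_tmul, LinearEquiv.coe_coe]
        rw [tensorMul_tmul_right, lTensor_rTensor_comm, hT₃, ← LinearMap.rTensor_comp_apply,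
          flip_comp_of_assoc M.assoc]
      T₄_spec := fun a b => by
        refine multiplier_ext hnd (hemb _)
          (mul_mem (inSecond_mem (embed_mem M.assoc a)) (Δ b).2) ?_
        refine TensorProduct.ext' fun x y => ?_
        simp only [Prod.fst_mul, hΔ, Module.End.mul_apply, embed_fst, inSecond_fst,
          legAct_tmul, LinearEquiv.coe_coe]
        rw [tensorMul_tmul_right, lTensor_rTensor_comm, hT₄, lTensor_rTensor_comm]
      coassoc := M.coassoc }
  refine ⟨H, rfl, rfl, hΔ, ⟨M.counit_mul hε, hε, M.counit_right hε⟩,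
    ⟨hSb, hSmul, fun a b => ?_, M.antipode_right hε hS⟩⟩
  rw [← hS]
  change _ = TensorProduct.lift (μ ∘ₗ S) (H.T₁ (a ⊗ₜ b))
  generalize H.T₁ (a ⊗ₜ b) = z
  induction z with
  | zero => simp
  | tmul a b => simp
  | add p q hp hq => simp only [map_add, hp, hq]

end CanonicalMaps

/-! ### Counit and antipode of a given regular multiplier Hopf algebra. -/

namespace RegularMultiplierHopfAlgebra

variable {V : Type*} [AddCommGroup V] [Module ℂ V] {μ : V →ₗ[ℂ] V →ₗ[ℂ] V}
  (H : RegularMultiplierHopfAlgebra μ)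

theorem coproduct_mul (a : V) (u v : V ⊗[ℂ] V) :
    tensorMul μ ((H.Δ a : PreMult (V ⊗[ℂ] V)).1 u) v =
      (H.Δ a : PreMult (V ⊗[ℂ] V)).1 (tensorMul μ u v) := by
  rw [← sub_eq_zero]
  refine tensorMul_nondegenerate_right H.nondegenerate_right _ fun w => ?_
  rw [map_sub, ← tensorMul_assoc H.assoc, (H.Δ a).2, (H.Δ a).2, tensorMul_assoc H.assoc, sub_self]

/-- From here on `legAct μ H.T₁ a` may be read as left multiplication by the multiplier Δ(a). -/
theorem coproduct_fst (a : V) :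
    (H.Δ a : PreMult (V ⊗[ℂ] V)).1 = legAct μ H.T₁.toLinearMap a := by
  refine TensorProduct.ext' fun x y => ?_
  rw [← sub_eq_zero]
  refine tensorMul_nondegenerate_left H.nondegenerate_left _ fun w => ?_
  induction w with
  | zero => simp
  | add p q hp hq => simp only [map_add, hp, hq, add_zero]
  | tmul p q =>
    rw [map_sub, LinearMap.sub_apply, H.coproduct_mul]
    have := congrArg (fun t : PreMult (V ⊗[ℂ] V) => t.1 (μ x p ⊗ₜ q)) (H.T₁_spec a y)
    simp only [embed_fst, inSecond_fst, Prod.fst_mul, Module.End.mul_apply,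
      LinearMap.lTensor_tmul] at this
    simp only [TensorProduct.map₂_apply_tmul, TensorProduct.map_tmul, legAct_tmul,
      LinearEquiv.coe_coe]
    rw [← this, tensorMul_tmul_right, tensorMul_tmul_right, ← LinearMap.rTensor_comp_apply,
      flip_comp_of_assoc H.assoc, sub_self]

theorem canonicalMaps : CanonicalMaps μ H.T₁ H.T₂ where
  assoc := H.assoc
  nondegenerate_left := H.nondegenerate_left
  nondegenerate_right := H.nondegenerate_right
  mul_T₁ a b c := by
    apply H.embed_injective
    refine multiplier_ext (tensorMul_nondegenerate_left H.nondegenerate_left)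
      (embed_mem (tensorMul_assoc H.assoc) _) (embed_mem (tensorMul_assoc H.assoc) _) ?_
    refine TensorProduct.ext' fun x y => ?_
    have h1 := congrArg (fun t : PreMult (V ⊗[ℂ] V) => t.1 (x ⊗ₜ y)) (H.T₁_spec b c)
    have h2 := congrArg (fun t : PreMult (V ⊗[ℂ] V) => t.1 (x ⊗ₜ μ c y)) (H.T₂_spec a b)
    simp only [embed_fst, inSecond_fst, inFirst_fst, Prod.fst_mul,
      Module.End.mul_apply, LinearMap.lTensor_tmul] at h1 h2
    simp only [embed_fst]
    rw [tensorMul_tmul_right] at h1 h2 ⊢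
    rw [tensorMul_tmul_right]
    have h3 : ∀ z : V ⊗[ℂ] V, (μ.flip x).rTensor V ((μ a).rTensor V z) =
        (μ a).rTensor V ((μ.flip x).rTensor V z) := by
      intro z
      rw [← LinearMap.rTensor_comp_apply, ← LinearMap.rTensor_comp_apply,
        mul_flip_comm_of_assoc H.assoc]
    rw [h3, lTensor_rTensor_comm, h1, ← h2, ← lTensor_rTensor_comm (μ.flip c),
      ← LinearMap.lTensor_comp_apply, flip_comp_of_assoc H.assoc]
  T₁_mul a b c := by
    apply H.embed_injective
    refine multiplier_ext (tensorMul_nondegenerate_left H.nondegenerate_left)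
      (embed_mem (tensorMul_assoc H.assoc) _) (embed_mem (tensorMul_assoc H.assoc) _) ?_
    refine LinearMap.ext fun u => ?_
    have h1 := congrArg (fun t : PreMult (V ⊗[ℂ] V) => t.1 u) (H.T₁_spec (μ a b) c)
    have h2 := congrArg (fun t : PreMult (V ⊗[ℂ] V) => t.1 u) (H.T₁_spec b c)
    simp only [embed_fst, inSecond_fst, Prod.fst_mul,
      Module.End.mul_apply, H.Δ_mul, MulMemClass.coe_mul] at h1 h2
    simp only [embed_fst]
    rw [h1, ← h2, ← H.coproduct_fst, H.coproduct_mul]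
  coassoc := H.coassoc

theorem exists_isCounit : ∃ ε, H.IsCounit ε := by
  obtain ⟨ε, h1, h2⟩ := H.canonicalMaps.exists_counit
  exact ⟨ε, H.canonicalMaps.counit_mul h1, h1, h2⟩

theorem isCounit_counit : H.IsCounit H.counit := Classical.epsilon_spec H.exists_isCounit

theorem sliceL_T₁ (a b : V) : sliceL V H.counit (H.T₁ (a ⊗ₜ b)) = μ a b :=
  H.isCounit_counit.left a b

theorem sliceR_T₂ (a b : V) : sliceR V H.counit (H.T₂ (a ⊗ₜ b)) = μ a b :=
  H.isCounit_counit.right a b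

theorem antipodeData : AntipodeData μ H.T₁ H.T₃ H.counit where
  assoc := H.assoc
  nondegenerate_left := H.nondegenerate_left
  nondegenerate_right := H.nondegenerate_right
  T₁_mul := H.canonicalMaps.T₁_mul
  T₃_eq a b c := H.T₃_mul_eq a b c
  counit := H.sliceL_T₁

theorem sliceR_T₁ (a c : V) : sliceR V H.counit (H.T₁ (a ⊗ₜ c)) = H.counit c • a := by
  rw [← sub_eq_zero]
  refine H.nondegenerate_right _ fun x => ?_
  have h1 : ∀ z : V ⊗[ℂ] V, sliceR V H.counit ((μ x).rTensor V z) =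
      μ x (sliceR V H.counit z) := by
    intro z
    induction z with
    | zero => simp
    | tmul a b => simp
    | add p q hp hq => simp only [map_add, hp, hq]
  have h2 : ∀ z : V ⊗[ℂ] V, sliceR V H.counit ((μ.flip c).lTensor V z) =
      H.counit c • (sliceR V H.counit z) := by
    intro z
    induction z with
    | zero => simp
    | tmul a b => simp [H.isCounit_counit.map_mul, smul_smul, mul_comm]
    | add p q hp hq => simp only [map_add, smul_add, hp, hq]
  rw [map_sub, ← h1, H.canonicalMaps.mul_T₁, h2, H.sliceR_T₂]
  simp

theorem sliceL_T₂ (a b : V) : sliceL V H.counit (H.T₂ (a ⊗ₜ b)) = H.counit a • b := by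
  rw [← sub_eq_zero]
  refine H.nondegenerate_left _ fun x => ?_
  have h1 : ∀ z : V ⊗[ℂ] V, sliceL V H.counit ((μ a).rTensor V z) =
      H.counit a • (sliceL V H.counit z) := by
    intro z
    induction z with
    | zero => simp
    | tmul a b => simp [H.isCounit_counit.map_mul, smul_smul]
    | add p q hp hq => simp only [map_add, smul_add, hp, hq]
  have h2 : ∀ z : V ⊗[ℂ] V, sliceL V H.counit ((μ.flip x).lTensor V z) =
      μ (sliceL V H.counit z) x := by
    intro z
    induction z with
    | zero => simp
    | tmul a b => simp
    | add p q hp hq => simp only [map_add, LinearMap.add_apply, hp, hq]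
  rw [map_sub, LinearMap.sub_apply, ← h2, ← H.canonicalMaps.mul_T₁, h1, H.sliceL_T₁]
  simp

theorem exists_counit_eq_one [Nontrivial V] : ∃ u, H.counit u = 1 :=
  H.antipodeData.exists_counit_eq_one

theorem sliceR_T₃ (a b : V) : sliceR V H.counit (H.T₃ (a ⊗ₜ b)) = μ a b := by
  rcases subsingleton_or_nontrivial V with hV | hV
  · exact Subsingleton.elim _ _
  obtain ⟨u, hu⟩ := H.exists_counit_eq_one
  have h1 : ∀ z : V ⊗[ℂ] V, sliceR V H.counit ((μ.flip b).rTensor V z) =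
      μ (sliceR V H.counit z) b := by
    intro z
    induction z with
    | zero => simp
    | tmul a b => simp
    | add p q hp hq => simp only [map_add, LinearMap.add_apply, hp, hq]
  have h2 : ∀ z : V ⊗[ℂ] V, sliceR V H.counit ((μ.flip u).lTensor V z) =
      sliceR V H.counit z := by
    intro z
    induction z with
    | zero => simp
    | tmul a b => simp [H.isCounit_counit.map_mul, hu]
    | add p q hp hq => simp only [map_add, hp, hq]
  rw [← h2, H.T₃_mul_eq, h1, H.sliceR_T₁, hu, one_smul]

theorem exists_isAntipode : ∃ S, H.IsAntipode H.counit S := by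
  obtain ⟨S, h1, h2, h3⟩ := H.antipodeData.bijective_antipode H.sliceR_T₃
  refine ⟨S.toLinearMap, S.bijective, h1, fun a b => ?_,
    H.canonicalMaps.antipode_right H.sliceL_T₁ h2⟩
  rw [← h2]
  generalize H.T₁ (a ⊗ₜ b) = z
  induction z with
  | zero => simp
  | tmul a b => simp
  | add p q hp hq => simp only [map_add, hp, hq]

theorem isAntipode_antipode : H.IsAntipode H.counit H.antipode :=
  Classical.epsilon_spec H.exists_isAntipode

theorem lift_antipode_T₁ (a b : V) :
    TensorProduct.lift (μ ∘ₗ H.antipode) (H.T₁ (a ⊗ₜ b)) = H.counit a • b := by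
  rw [← H.isAntipode_antipode.left]
  generalize H.T₁ (a ⊗ₜ b) = z
  induction z with
  | zero => simp
  | tmul a b => simp
  | add p q hp hq => simp only [map_add, hp, hq]

end RegularMultiplierHopfAlgebra

/-! ### Pentagon-type identities. -/

section Legs

variable {X Y Z W X' Y' Z' W' : Type*}
  [AddCommGroup X] [Module ℂ X] [AddCommGroup Y] [Module ℂ Y] [AddCommGroup Z] [Module ℂ Z]
  [AddCommGroup W] [Module ℂ W] [AddCommGroup X'] [Module ℂ X'] [AddCommGroup Y'] [Module ℂ Y']
  [AddCommGroup Z'] [Module ℂ Z'] [AddCommGroup W'] [Module ℂ W']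

theorem ext_threefold_right {f g : X ⊗[ℂ] (Y ⊗[ℂ] Z) →ₗ[ℂ] W}
    (h : ∀ x y z, f (x ⊗ₜ (y ⊗ₜ z)) = g (x ⊗ₜ (y ⊗ₜ z))) : f = g := by
  refine TensorProduct.ext' fun x t => ?_
  induction t with
  | zero => simp
  | tmul y z => exact h x y z
  | add p q hp hq => simp only [TensorProduct.tmul_add, map_add, hp, hq]

theorem rTensor_assoc_tmul (f : X →ₗ[ℂ] X') (s : X ⊗[ℂ] Y) (z : Z) :
    f.rTensor (Y ⊗[ℂ] Z) (TensorProduct.assoc ℂ X Y Z (s ⊗ₜ z)) =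
      TensorProduct.assoc ℂ X' Y Z (f.rTensor Y s ⊗ₜ z) := by
  induction s with
  | zero => simp
  | tmul a b => simp
  | add p q hp hq => simp only [map_add, TensorProduct.add_tmul, hp, hq]

theorem lTensor_assoc_tmul (f : Y →ₗ[ℂ] Y') (s : X ⊗[ℂ] Y) (z : Z) :
    (f.rTensor Z).lTensor X (TensorProduct.assoc ℂ X Y Z (s ⊗ₜ z)) =
      TensorProduct.assoc ℂ X Y' Z (f.lTensor X s ⊗ₜ z) := by
  induction s with
  | zero => simp
  | tmul a b => simp
  | add p q hp hq => simp only [map_add, TensorProduct.add_tmul, hp, hq]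

theorem leg23_rTensor (f : X →ₗ[ℂ] X') (g : Y ⊗[ℂ] Z →ₗ[ℂ] Y' ⊗[ℂ] Z') (t : X ⊗[ℂ] (Y ⊗[ℂ] Z)) :
    f.rTensor _ (leg23 X g t) = leg23 X' g (f.rTensor _ t) :=
  (lTensor_rTensor_comm g f t).symm

end Legs

namespace RegularMultiplierHopfAlgebra

variable {V : Type*} [AddCommGroup V] [Module ℂ V] {μ : V →ₗ[ℂ] V →ₗ[ℂ] V}
  (H : RegularMultiplierHopfAlgebra μ)

/-- `(a ⊗ 1 ⊗ 1)(ι ⊗ Δ)Δ(b)(1 ⊗ z)` -/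
theorem rTensor_leg12_leg13 (a b : V) (z : V ⊗[ℂ] V) :
    (μ a).rTensor _ (leg12 V H.T₁.toLinearMap (leg13 V H.T₁.toLinearMap (b ⊗ₜ z))) =
      ((legAct μ H.T₁.toLinearMap).flip z).lTensor V (H.T₂ (a ⊗ₜ b)) := by
  induction z with
  | zero => simp
  | add p q hp hq => simp only [map_add, TensorProduct.tmul_add, hp, hq, LinearMap.lTensor_add,
      LinearMap.add_apply]
  | tmul y c =>
    have h1 : ∀ w : V ⊗[ℂ] V, (μ a).rTensor _ (leg12 V H.T₁.toLinearMap
        (TensorProduct.leftComm ℂ V V V (y ⊗ₜ w))) = ((μ.flip y).rTensor V).lTensor V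
          (leg12 V H.T₂.toLinearMap (a ⊗ₜ w)) := by
      intro w
      induction w with
      | zero => simp
      | tmul r s =>
        rw [TensorProduct.leftComm_tmul, leg12_tmul, leg12_tmul, rTensor_assoc_tmul,
          LinearEquiv.coe_coe, H.canonicalMaps.mul_T₁, lTensor_assoc_tmul, LinearEquiv.coe_coe]
      | add p q hp hq => simp only [map_add, TensorProduct.tmul_add, hp, hq]
    rw [leg13_tmul, h1, LinearEquiv.coe_coe, H.coassoc]
    generalize H.T₂ (a ⊗ₜ b) = w
    induction w with
    | zero => simp
    | tmul r s => simp [leg23]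
    | add p q hp hq => simp only [map_add, TensorProduct.add_tmul, hp, hq]

/-- A form of `(ι ⊗ Δ)(Δ(b)(1 ⊗ y))`, where `T(y ⊗ c)` transforms under `Δ`. -/
theorem leg23_leg12_of_mul (T : V ⊗[ℂ] V →ₗ[ℂ] V ⊗[ℂ] V)
    (hT : ∀ a b c, T (μ a b ⊗ₜ c) = legAct μ H.T₁.toLinearMap a (T (b ⊗ₜ c))) :
    leg23 V T ∘ₗ leg12 V H.T₁.toLinearMap = leg12 V H.T₁.toLinearMap ∘ₗ
      leg13 V H.T₁.toLinearMap ∘ₗ leg23 V T := by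
  refine ext_threefold_right fun b y c => ?_
  refine rTensor_jointly_injective μ H.nondegenerate_right fun a => ?_
  simp only [LinearMap.comp_apply]
  rw [leg23_tmul, H.rTensor_leg12_leg13, leg23_rTensor, leg12_tmul, rTensor_assoc_tmul,
    LinearEquiv.coe_coe, H.canonicalMaps.mul_T₁]
  generalize H.T₂ (a ⊗ₜ b) = w
  induction w with
  | zero => simp
  | tmul r s => simp [leg23, hT]
  | add p q hp hq => simp only [map_add, TensorProduct.add_tmul, hp, hq]

theorem pentagon : leg23 V H.T₁.toLinearMap ∘ₗ leg12 V H.T₁.toLinearMap =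
    leg12 V H.T₁.toLinearMap ∘ₗ leg13 V H.T₁.toLinearMap ∘ₗ leg23 V H.T₁.toLinearMap :=
  H.leg23_leg12_of_mul _ H.canonicalMaps.T₁_mul

theorem leg23_T₃_leg12 : leg23 V H.T₃.toLinearMap ∘ₗ leg12 V H.T₁.toLinearMap =
    leg12 V H.T₁.toLinearMap ∘ₗ leg13 V H.T₁.toLinearMap ∘ₗ leg23 V H.T₃.toLinearMap :=
  H.leg23_leg12_of_mul _ H.antipodeData.T₃_mul

theorem mul_T₃ (x a b : V) : (μ x).rTensor V (H.T₃ (a ⊗ₜ b)) =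
    (μ.flip b).rTensor V (H.T₂ (x ⊗ₜ a)) := by
  refine lTensor_jointly_injective μ.flip H.nondegenerate_left fun c => ?_
  rw [lTensor_rTensor_comm, H.T₃_mul_eq, H.canonicalMaps.rTensor_mul_flip,
    H.canonicalMaps.mul_T₁, lTensor_rTensor_comm]

/-- Both sides send a ⊗ b ⊗ c to ∑ a₁b ⊗ a₂ ⊗ a₃c. -/
theorem leg12_T₃_leg13 : leg12 V H.T₃.toLinearMap ∘ₗ leg13 V H.T₁.toLinearMap =
    leg23 V H.T₁.toLinearMap ∘ₗ leg12 V H.T₃.toLinearMap := by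
  refine ext_threefold_right fun a b c => ?_
  refine rTensor_jointly_injective μ H.nondegenerate_right fun x => ?_
  simp only [LinearMap.comp_apply]
  rw [leg13_tmul, leg23_rTensor, leg12_tmul, rTensor_assoc_tmul, LinearEquiv.coe_coe,
    LinearEquiv.coe_coe, H.mul_T₃, ← rTensor_assoc_tmul, ← leg23_rTensor, ← H.coassoc]
  generalize H.T₁ (a ⊗ₜ c) = w
  induction w with
  | zero => simp
  | tmul r s =>
    rw [TensorProduct.leftComm_tmul, leg12_tmul, leg12_tmul, rTensor_assoc_tmul,
      rTensor_assoc_tmul, LinearEquiv.coe_coe, LinearEquiv.coe_coe, H.mul_T₃]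
  | add p q hp hq => simp only [map_add, TensorProduct.tmul_add, hp, hq]

/-- The antipode of the opposite coproduct. -/
theorem exists_antipode_flip : ∃ S : V →ₗ[ℂ] V, Function.Surjective S ∧
    (∀ a b, S (μ a b) = μ (S b) (S a)) ∧
    (∀ a b, TensorProduct.lift (μ ∘ₗ S) (TensorProduct.comm ℂ V V (H.T₃ (a ⊗ₜ b))) =
      H.counit a • b) ∧
    (∀ a b, TensorProduct.lift (μ ∘ₗ S) (TensorProduct.comm ℂ V V (H.T₁ (a ⊗ₜ b))) =
      H.counit a • S b) := by
  simpa using (H.antipodeData.flip H.sliceR_T₃).exists_antipode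

end RegularMultiplierHopfAlgebra

/-! ### Calculus of leg-numbered maps. -/

section Legs

variable {X Y Z W X' Y' Z' W' V : Type*}
  [AddCommGroup X] [Module ℂ X] [AddCommGroup Y] [Module ℂ Y] [AddCommGroup Z] [Module ℂ Z]
  [AddCommGroup W] [Module ℂ W] [AddCommGroup X'] [Module ℂ X'] [AddCommGroup Y'] [Module ℂ Y']
  [AddCommGroup Z'] [Module ℂ Z'] [AddCommGroup W'] [Module ℂ W'] [AddCommGroup V] [Module ℂ V]

@[elab_as_elim]
theorem tensor_induction_three {p : X ⊗[ℂ] (Y ⊗[ℂ] Z) → Prop} (t : X ⊗[ℂ] (Y ⊗[ℂ] Z))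
    (zero : p 0) (tmul : ∀ x y z, p (x ⊗ₜ (y ⊗ₜ z))) (add : ∀ s t, p s → p t → p (s + t)) : p t := by
  induction t with
  | zero => exact zero
  | add s t hs ht => exact add _ _ hs ht
  | tmul x t =>
  induction t with
  | zero => simpa
  | add s t hs ht => rw [TensorProduct.tmul_add]; exact add _ _ hs ht
  | tmul y z => exact tmul x y z

theorem leg12_pre_fst (f : X ⊗[ℂ] Y →ₗ[ℂ] X' ⊗[ℂ] Y') (g : Z →ₗ[ℂ] X) (t) :
    leg12 W f (g.rTensor _ t) = leg12 W (f ∘ₗ g.rTensor Y) t := by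
  induction t using tensor_induction_three with
  | zero => simp
  | add p q hp hq => simp only [map_add, hp, hq]
  | tmul x y z =>
  simp only [LinearMap.rTensor_tmul, LinearMap.comp_apply, leg12_tmul]

theorem leg12_pre_snd (f : X ⊗[ℂ] Y →ₗ[ℂ] X' ⊗[ℂ] Y') (g : Z →ₗ[ℂ] Y) (t) :
    leg12 W f ((g.rTensor W).lTensor X t) = leg12 W (f ∘ₗ g.lTensor X) t := by
  induction t using tensor_induction_three with
  | zero => simp
  | add p q hp hq => simp only [map_add, hp, hq]
  | tmul x y z =>
  simp only [LinearMap.rTensor_tmul, LinearMap.lTensor_tmul, LinearMap.comp_apply, leg12_tmul]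

theorem leg12_third (f : X ⊗[ℂ] Y →ₗ[ℂ] X' ⊗[ℂ] Y') (g : W →ₗ[ℂ] W') (t) :
    leg12 W' f ((g.lTensor Y).lTensor X t) = (g.lTensor Y').lTensor X' (leg12 W f t) := by
  induction t using tensor_induction_three with
  | zero => simp
  | add p q hp hq => simp only [map_add, hp, hq]
  | tmul x y z =>
  simp only [LinearMap.lTensor_tmul, leg12_tmul]
  generalize f _ = s
  induction s with
  | zero => simp
  | tmul a b => simp
  | add p q hp hq => simp only [map_add, TensorProduct.add_tmul, hp, hq]

theorem leg12_post_fst (f : X ⊗[ℂ] Y →ₗ[ℂ] X' ⊗[ℂ] Y') (g : X' →ₗ[ℂ] Z) (t) :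
    leg12 W (g.rTensor Y' ∘ₗ f) t = g.rTensor _ (leg12 W f t) := by
  induction t using tensor_induction_three with
  | zero => simp
  | add p q hp hq => simp only [map_add, hp, hq]
  | tmul x y z =>
  simp only [LinearMap.comp_apply, leg12_tmul]
  generalize f _ = s
  induction s with
  | zero => simp
  | tmul a b => simp
  | add p q hp hq => simp only [map_add, TensorProduct.add_tmul, hp, hq]

theorem leg12_post_snd (f : X ⊗[ℂ] Y →ₗ[ℂ] X' ⊗[ℂ] Y') (g : Y' →ₗ[ℂ] Z) (t) :
    leg12 W (g.lTensor X' ∘ₗ f) t = (g.rTensor W).lTensor X' (leg12 W f t) := by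
  induction t using tensor_induction_three with
  | zero => simp
  | add p q hp hq => simp only [map_add, hp, hq]
  | tmul x y z =>
  simp only [LinearMap.comp_apply, leg12_tmul]
  generalize f _ = s
  induction s with
  | zero => simp
  | tmul a b => simp
  | add p q hp hq => simp only [map_add, TensorProduct.add_tmul, hp, hq]

theorem leg13_pre_third (f : X ⊗[ℂ] Y →ₗ[ℂ] X' ⊗[ℂ] Y') (g : Z →ₗ[ℂ] Y) (t) :
    leg13 W f ((g.lTensor W).lTensor X t) = leg13 W (f ∘ₗ g.lTensor X) t := by
  induction t using tensor_induction_three with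
  | zero => simp
  | add p q hp hq => simp only [map_add, hp, hq]
  | tmul x y z =>
  simp only [LinearMap.lTensor_tmul, LinearMap.comp_apply, leg13_tmul]

theorem leg13_second (f : X ⊗[ℂ] Y →ₗ[ℂ] X' ⊗[ℂ] Y') (g : W →ₗ[ℂ] W') (t) :
    leg13 W' f ((g.rTensor Y).lTensor X t) = (g.rTensor Y').lTensor X' (leg13 W f t) := by
  induction t using tensor_induction_three with
  | zero => simp
  | add p q hp hq => simp only [map_add, hp, hq]
  | tmul x y z =>
  simp only [LinearMap.rTensor_tmul, LinearMap.lTensor_tmul, leg13_tmul]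
  generalize f _ = s
  induction s with
  | zero => simp
  | tmul a b => simp
  | add p q hp hq => simp only [map_add, TensorProduct.tmul_add, hp, hq]

theorem leg13_post_fst (f : X ⊗[ℂ] Y →ₗ[ℂ] X' ⊗[ℂ] Y') (g : X' →ₗ[ℂ] Z) (t) :
    leg13 W (g.rTensor Y' ∘ₗ f) t = g.rTensor _ (leg13 W f t) := by
  induction t using tensor_induction_three with
  | zero => simp
  | add p q hp hq => simp only [map_add, hp, hq]
  | tmul x y z =>
  simp only [LinearMap.comp_apply, leg13_tmul]
  generalize f _ = s
  induction s with
  | zero => simp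
  | tmul a b => simp
  | add p q hp hq => simp only [map_add, TensorProduct.tmul_add, hp, hq]

theorem leg13_post_third (f : X ⊗[ℂ] Y →ₗ[ℂ] X' ⊗[ℂ] Y') (g : Y' →ₗ[ℂ] Z) (t) :
    leg13 W (g.lTensor X' ∘ₗ f) t = (g.lTensor W).lTensor X' (leg13 W f t) := by
  induction t using tensor_induction_three with
  | zero => simp
  | add p q hp hq => simp only [map_add, hp, hq]
  | tmul x y z =>
  simp only [LinearMap.comp_apply, leg13_tmul]
  generalize f _ = s
  induction s with
  | zero => simp
  | tmul a b => simp
  | add p q hp hq => simp only [map_add, TensorProduct.tmul_add, hp, hq]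

theorem leg12_comp (f : X ⊗[ℂ] Y →ₗ[ℂ] X' ⊗[ℂ] Y') (g : X' ⊗[ℂ] Y' →ₗ[ℂ] Z ⊗[ℂ] Z') (t) :
    leg12 W (g ∘ₗ f) t = leg12 W g (leg12 W f t) := by
  simp [leg12, LinearMap.rTensor_comp]

theorem leg13_comp (f : X ⊗[ℂ] Y →ₗ[ℂ] X' ⊗[ℂ] Y') (g : X' ⊗[ℂ] Y' →ₗ[ℂ] Z ⊗[ℂ] Z') (t) :
    leg13 W (g ∘ₗ f) t = leg13 W g (leg13 W f t) := by
  simp only [leg13, LinearMap.lTensor_comp, LinearMap.comp_apply, LinearEquiv.coe_coe]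
  congr 2
  generalize f.lTensor W _ = s
  induction s with
  | zero => simp
  | add p q hp hq => simp only [map_add, ← hp, ← hq]
  | tmul w s =>
  induction s with
  | zero => simp
  | tmul a b => simp
  | add p q hp hq => simp only [map_add, TensorProduct.tmul_add, ← hp, ← hq]

theorem leg23_comp (f : X ⊗[ℂ] Y →ₗ[ℂ] X' ⊗[ℂ] Y') (g : X' ⊗[ℂ] Y' →ₗ[ℂ] Z ⊗[ℂ] Z') (t) :
    leg23 W (g ∘ₗ f) t = leg23 W g (leg23 W f t) := by
  simp [leg23, LinearMap.lTensor_comp]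

theorem leg12_bijective {f : X ⊗[ℂ] Y →ₗ[ℂ] X' ⊗[ℂ] Y'} (hf : Function.Bijective f) :
    Function.Bijective (leg12 W f) :=
  (TensorProduct.assoc ℂ X' Y' W).bijective.comp
    (((LinearEquiv.ofBijective f hf).rTensor W).bijective.comp
      (TensorProduct.assoc ℂ X Y W).symm.bijective)

theorem leg13_bijective {f : X ⊗[ℂ] Y →ₗ[ℂ] X' ⊗[ℂ] Y'} (hf : Function.Bijective f) :
    Function.Bijective (leg13 W f) :=
  (TensorProduct.leftComm ℂ W X' Y').bijective.comp
    (((LinearEquiv.ofBijective f hf).lTensor W).bijective.comp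
      (TensorProduct.leftComm ℂ X W Y).bijective)

theorem leg23_bijective {f : X ⊗[ℂ] Y →ₗ[ℂ] X' ⊗[ℂ] Y'} (hf : Function.Bijective f) :
    Function.Bijective (leg23 W f) :=
  ((LinearEquiv.ofBijective f hf).lTensor W).bijective

end Legs

/-! ### The twist map R: identities and bijectivity. -/

namespace LeftModuleAlgebra

variable {C D : Type*} [NonUnitalRing C] [Module ℂ C] [IsScalarTower ℂ C C] [SMulCommClass ℂ C C]
  [NonUnitalRing D] [Module ℂ D] [IsScalarTower ℂ D D] [SMulCommClass ℂ D D]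
  {HD : RegularMultiplierHopfAlgebra (LinearMap.mul ℂ D)} (α : LeftModuleAlgebra HD C)

theorem act_induction {p : C → Prop} (zero : p 0) (add : ∀ x y, p x → p y → p (x + y))
    (act : ∀ e c, p (α.act e c)) (c : C) : p c := by
  obtain ⟨t, rfl⟩ := α.lift_act_surjective c
  induction t with
  | zero => simpa
  | tmul e c => simpa using act e c
  | add p q hp hq => rw [map_add]; exact add _ _ hp hq

/-- The map `d ⊗ c ↦ ∑ d₁ ⊗ (d₂ ▷ c)`. -/
def coprodAct : D ⊗[ℂ] C →ₗ[ℂ] D ⊗[ℂ] C :=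
  (TensorProduct.comm ℂ C D).toLinearMap ∘ₗ α.twistOp

/-- Acting on a fixed c carries T₃ to R, and the next lemma does the same for T₁ and `coprodAct`.
Since the elements e ▷ c span C, identities between canonical maps of D descend to R and
`coprodAct`. -/
theorem twist_comp_act (c : C) : α.twist ∘ₗ (α.act.flip c).lTensor D =
    (α.act.flip c).rTensor D ∘ₗ HD.T₃.toLinearMap :=
  TensorProduct.ext' fun d e => by
    simp only [LinearMap.comp_apply, LinearMap.lTensor_tmul, LinearMap.flip_apply, twist_tmul_act]
    rfl

theorem coprodAct_comp_act (c : C) : α.coprodAct ∘ₗ (α.act.flip c).lTensor D =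
    (α.act.flip c).lTensor D ∘ₗ HD.T₁.toLinearMap :=
  TensorProduct.ext' fun d e => by
    simp only [LinearMap.comp_apply, LinearMap.lTensor_tmul, LinearMap.flip_apply, coprodAct,
      twistOp_tmul_act]
    exact (TensorProduct.comm ℂ D C).symm_apply_apply _

/-- Both sides send d ⊗ c ⊗ y to ∑ (d₁ ▷ c) ⊗ d₂ ⊗ d₃y. -/
theorem leg12_twist_leg13_T₁ (t : D ⊗[ℂ] (C ⊗[ℂ] D)) :
    leg12 D α.twist (leg13 C HD.T₁.toLinearMap t) =
      leg23 C HD.T₁.toLinearMap (leg12 D α.twist t) := by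
  induction t with
  | zero => simp
  | add p q hp hq => simp only [map_add, hp, hq]
  | tmul d t =>
  induction t with
  | zero => simp
  | add p q hp hq => simp only [map_add, TensorProduct.tmul_add, hp, hq]
  | tmul c y =>
  induction c using α.act_induction with
  | zero => simp
  | add p q hp hq => simp only [map_add, TensorProduct.add_tmul, TensorProduct.tmul_add, hp, hq]
  | act e c =>
  have h : d ⊗ₜ[ℂ] (α.act e c ⊗ₜ[ℂ] y) =
    ((α.act.flip c).rTensor D).lTensor D (d ⊗ₜ[ℂ] (e ⊗ₜ[ℂ] y)) := by simp
  have h1 := LinearMap.congr_fun HD.leg12_T₃_leg13 (d ⊗ₜ[ℂ] (e ⊗ₜ[ℂ] y))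
  simp only [LinearMap.comp_apply] at h1
  rw [h, leg13_second, leg12_pre_snd, leg12_pre_snd, twist_comp_act, leg12_post_fst,
    leg12_post_fst, h1, leg23_rTensor]

/-- Both sides send d ⊗ c ⊗ y to ∑ (d₁ ▷ c) ⊗ d₂ ⊗ (d₃ ▷ y). -/
theorem leg12_twist_leg13_coprodAct (t : D ⊗[ℂ] (C ⊗[ℂ] C)) :
    leg12 C α.twist (leg13 C α.coprodAct t) =
      leg23 C α.coprodAct (leg12 C α.twist t) := by
  induction t with
  | zero => simp
  | add p q hp hq => simp only [map_add, hp, hq]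
  | tmul d t =>
  induction t with
  | zero => simp
  | add p q hp hq => simp only [map_add, TensorProduct.tmul_add, hp, hq]
  | tmul c y =>
  induction y using α.act_induction with
  | zero => simp
  | add p q hp hq => simp only [map_add, TensorProduct.tmul_add, hp, hq]
  | act e y =>
  have h : d ⊗ₜ[ℂ] (c ⊗ₜ[ℂ] α.act e y) =
    ((α.act.flip y).lTensor C).lTensor D (d ⊗ₜ[ℂ] (c ⊗ₜ[ℂ] e)) := by simp
  have h1 : ∀ t : C ⊗[ℂ] (D ⊗[ℂ] D), leg23 C α.coprodAct (((α.act.flip y).lTensor D).lTensor C t) =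
      ((α.act.flip y).lTensor D).lTensor C (leg23 C HD.T₁.toLinearMap t) := by
    intro t
    simp only [leg23, ← LinearMap.lTensor_comp_apply, coprodAct_comp_act]
  rw [h, leg13_pre_third, coprodAct_comp_act, leg13_post_third, leg12_third, leg12_third, h1,
    leg12_twist_leg13_T₁]

/-- Both sides send d ⊗ d' ⊗ c to ∑ d₁ ⊗ (d₂d'₁ ▷ c) ⊗ d₃d'₂. -/
theorem leg23_twist_leg12_T₁ (t : D ⊗[ℂ] (D ⊗[ℂ] C)) :
    leg23 D α.twist (leg12 C HD.T₁.toLinearMap t) = leg12 D α.coprodAct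
      (leg13 C HD.T₁.toLinearMap (leg23 D α.twist t)) := by
  induction t with
  | zero => simp
  | add p q hp hq => simp only [map_add, hp, hq]
  | tmul d t =>
  induction t with
  | zero => simp
  | add p q hp hq => simp only [map_add, TensorProduct.tmul_add, hp, hq]
  | tmul d' c =>
  induction c using α.act_induction with
  | zero => simp
  | add p q hp hq => simp only [map_add, TensorProduct.tmul_add, hp, hq]
  | act e c =>
  have h : d ⊗ₜ[ℂ] (d' ⊗ₜ[ℂ] α.act e c) =
    ((α.act.flip c).lTensor D).lTensor D (d ⊗ₜ[ℂ] (d' ⊗ₜ[ℂ] e)) := by simp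
  have h1 : ∀ t : D ⊗[ℂ] (D ⊗[ℂ] D), leg23 D α.twist (((α.act.flip c).lTensor D).lTensor D t) =
      ((α.act.flip c).rTensor D).lTensor D (leg23 D HD.T₃.toLinearMap t) := by
    intro t
    simp only [leg23, ← LinearMap.lTensor_comp_apply, twist_comp_act]
  have h2 := LinearMap.congr_fun HD.leg23_T₃_leg12 (d ⊗ₜ[ℂ] (d' ⊗ₜ[ℂ] e))
  simp only [LinearMap.comp_apply] at h2
  rw [h, leg12_third, h1, h1, leg13_second, leg12_pre_snd, coprodAct_comp_act, leg12_post_snd, h2]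

theorem lTensor_mul_twist (d e : D) (c : C) : ((LinearMap.mul ℂ D).flip e).lTensor C
    (α.twist (d ⊗ₜ c)) = (α.act.flip c).rTensor D (HD.T₁ (d ⊗ₜ e)) := by
  have := α.lTensor_twist_aux d e (α.actSection c)
  rw [lift_act_section] at this
  refine (Eq.trans ?_ this).trans ?_
  · simp [twist]
  · generalize HD.T₁ (d ⊗ₜ e) = z
    induction z with
    | zero => simp
    | tmul a b => simp
    | add p q hp hq => simp only [map_add, TensorProduct.add_tmul, hp, hq]

theorem rTensor_mul_coprodAct (x d : D) (c : C) : (LinearMap.mul ℂ D x).rTensor C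
    (α.coprodAct (d ⊗ₜ c)) = (α.act.flip c).lTensor D (HD.T₂ (x ⊗ₜ d)) := by
  induction c using α.act_induction with
  | zero => simp
  | add p q hp hq => simp only [map_add, TensorProduct.tmul_add, hp, hq, LinearMap.lTensor_add,
      LinearMap.add_apply]
  | act e c =>
  have h := LinearMap.congr_fun (α.coprodAct_comp_act c) (d ⊗ₜ e)
  simp only [LinearMap.comp_apply, LinearMap.lTensor_tmul, LinearMap.flip_apply,
    LinearEquiv.coe_coe] at h
  have h2 : α.act.flip (α.act e c) = α.act.flip c ∘ₗ (LinearMap.mul ℂ D).flip e := by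
    ext; simp [α.mul_act]
  rw [h, ← lTensor_rTensor_comm, HD.canonicalMaps.mul_T₁, h2, LinearMap.lTensor_comp_apply]

theorem act_mul_eq (d : D) (c c' : C) : α.act d (c * c') =
    LinearMap.mul' ℂ C ((α.act.flip c').lTensor C (α.twist (d ⊗ₜ c))) := by
  induction c' using α.act_induction with
  | zero => simp
  | add p q hp hq => simp only [map_add, mul_add, hp, hq, LinearMap.lTensor_add,
      LinearMap.add_apply]
  | act e c' =>
  have h2 : α.act.flip (α.act e c') = α.act.flip c' ∘ₗ (LinearMap.mul ℂ D).flip e := by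
    ext; simp [α.mul_act]
  rw [h2, LinearMap.lTensor_comp_apply, lTensor_mul_twist, α.act_mul]
  generalize HD.T₁ (d ⊗ₜ e) = z
  induction z with
  | zero => simp
  | tmul a b => simp
  | add p q hp hq => simp only [map_add, hp, hq]

/-- The module algebra law in the second leg combined with coassociativity: ∑ d₁ ⊗ (d₂ ▷ cc') = ∑ d₁
⊗ (d₂ ▷ c)(d₃ ▷ c'). -/
theorem coprodAct_mul (t : D ⊗[ℂ] (C ⊗[ℂ] C)) : α.coprodAct ((LinearMap.mul' ℂ C).lTensor D t) =
    (LinearMap.mul' ℂ C).lTensor D (leg12 C α.coprodAct (leg13 C α.coprodAct t)) := by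
  induction t with
  | zero => simp
  | add p q hp hq => simp only [map_add, hp, hq]
  | tmul d t =>
  induction t with
  | zero => simp
  | add p q hp hq => simp only [map_add, TensorProduct.tmul_add, hp, hq]
  | tmul c y =>
  induction y using α.act_induction with
  | zero => simp
  | add p q hp hq => simp only [map_add, TensorProduct.tmul_add, hp, hq]
  | act f c₀ =>
  refine rTensor_jointly_injective (LinearMap.mul ℂ D) HD.nondegenerate_right fun x => ?_
  have h1 : ∀ z : D ⊗[ℂ] D, (α.act.flip (c * α.act f c₀)).lTensor D z =
      (LinearMap.mul' ℂ C ∘ₗ TensorProduct.map (α.act.flip c) (α.act.flip c₀)).lTensor D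
        (leg23 D HD.T₁.toLinearMap (TensorProduct.assoc ℂ D D D (z ⊗ₜ f))) := by
    intro z
    induction z with
    | zero => simp
    | tmul a b => simp [leg23, α.act_mul]
    | add p q hp hq => simp only [map_add, TensorProduct.add_tmul, hp, hq]
  have h2 := LinearMap.congr_fun (α.coprodAct_comp_act c₀) (d ⊗ₜ f)
  simp only [LinearMap.comp_apply, LinearMap.lTensor_tmul, LinearMap.flip_apply,
    LinearEquiv.coe_coe] at h2
  rw [LinearMap.lTensor_tmul, LinearMap.mul'_apply, rTensor_mul_coprodAct, h1, ← HD.coassoc,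
    leg13_tmul, h2, ← lTensor_rTensor_comm]
  generalize HD.T₁ (d ⊗ₜ f) = z
  induction z with
  | zero => simp
  | tmul r s =>
    rw [leg12_tmul, LinearMap.lTensor_tmul, TensorProduct.leftComm_tmul, leg12_tmul,
      rTensor_assoc_tmul, rTensor_mul_coprodAct, LinearEquiv.coe_coe]
    generalize HD.T₂ (x ⊗ₜ r) = z
    induction z with
    | zero => simp
    | tmul r s => simp
    | add p q hp hq => simp only [map_add, TensorProduct.add_tmul, hp, hq]
  | add p q hp hq => simp only [map_add, TensorProduct.tmul_add, hp, hq]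

theorem twist_surjective : Function.Surjective α.twist := by
  rw [← LinearMap.range_eq_top, eq_top_iff]
  rintro z -
  induction z with
  | zero => exact zero_mem _
  | add p q hp hq => exact add_mem hp hq
  | tmul c d =>
  induction c using α.act_induction with
  | zero => simp
  | add p q hp hq => rw [TensorProduct.add_tmul]; exact add_mem hp hq
  | act e c =>
  refine ⟨(α.act.flip c).lTensor D (HD.T₃.symm (e ⊗ₜ d)), ?_⟩
  rw [← LinearMap.comp_apply, twist_comp_act]
  simp

/-- Let S be the antipode of the opposite coproduct, so that ∑ S(d₂)d₁ = ε(d). Letting the second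
leg of ∑ (d₁ ▷ c) ⊗ d₂ ⊗ d₃y act through S on the first recovers c ⊗ dy from R(d ⊗ c). -/
theorem twist_injective : Function.Injective α.twist := by
  obtain ⟨S, -, -, hS, -⟩ := HD.exists_antipode_flip
  let n : C ⊗[ℂ] D →ₗ[ℂ] C := TensorProduct.lift (α.act ∘ₗ S).flip
  have hn : ∀ r c, n (α.twist (r ⊗ₜ c)) = HD.counit r • c := by
    intro r c
    induction c using α.act_induction with
    | zero => simp
    | add p q hp hq => simp only [map_add, TensorProduct.tmul_add, hp, hq, smul_add]
    | act e c =>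
    have h := LinearMap.congr_fun (α.twist_comp_act c) (r ⊗ₜ e)
    simp only [LinearMap.comp_apply, LinearMap.lTensor_tmul, LinearMap.flip_apply,
      LinearEquiv.coe_coe] at h
    have h1 := congrArg (α.act.flip c) (hS r e)
    rw [h, ← LinearMap.smul_apply, ← map_smul, ← LinearMap.flip_apply, ← h1]
    generalize HD.T₃ (r ⊗ₜ e) = z
    induction z with
    | zero => simp
    | tmul a b => simp [n, α.mul_act]
    | add p q hp hq => simp only [map_add, hp, hq]
  have key : ∀ (y : D) (t : D ⊗[ℂ] C), n.rTensor D ((TensorProduct.assoc ℂ C D D).symm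
      (leg23 C HD.T₁.toLinearMap (TensorProduct.assoc ℂ C D D (α.twist t ⊗ₜ y)))) =
      TensorProduct.comm ℂ D C (((LinearMap.mul ℂ D).flip y).rTensor C t) := by
    intro y t
    induction t with
    | zero => simp
    | add p q hp hq => simp only [map_add, TensorProduct.add_tmul, hp, hq]
    | tmul d c =>
    rw [← leg12_tmul, ← leg12_twist_leg13_T₁, leg13_tmul, LinearMap.rTensor_tmul,
      TensorProduct.comm_tmul, LinearMap.flip_apply, ← HD.sliceL_T₁, LinearEquiv.coe_coe]
    generalize HD.T₁ (d ⊗ₜ y) = z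
    induction z with
    | zero => simp
    | tmul a b => simp [leg12, hn, TensorProduct.smul_tmul]
    | add p q hp hq => simp only [map_add, TensorProduct.tmul_add, hp, hq]
  rw [injective_iff_map_eq_zero]
  intro t ht
  refine rTensor_jointly_injective (LinearMap.mul ℂ D).flip HD.nondegenerate_left fun y => ?_
  apply (TensorProduct.comm ℂ D C).injective
  rw [← key, ht]
  simp

theorem twist_bijective : Function.Bijective α.twist := ⟨α.twist_injective, α.twist_surjective⟩

end LeftModuleAlgebra

/-- The product equals (ε ⊗ ι)T₁, a composite of two surjections when V ≠ 0. -/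
theorem RegularMultiplierHopfAlgebra.lift_mul_surjective {V : Type*} [AddCommGroup V] [Module ℂ V]
    {μ : V →ₗ[ℂ] V →ₗ[ℂ] V} (H : RegularMultiplierHopfAlgebra μ) :
    Function.Surjective (TensorProduct.lift μ) := by
  intro a
  rcases subsingleton_or_nontrivial V with hV | hV
  · exact ⟨0, Subsingleton.elim _ _⟩
  obtain ⟨e, he⟩ := H.exists_counit_eq_one
  refine ⟨H.T₁.symm (e ⊗ₜ a), ?_⟩
  have h : ∀ t, TensorProduct.lift μ t = sliceL V H.counit (H.T₁ t) := by
    intro t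
    induction t with
    | zero => simp
    | tmul a b => simp [H.sliceL_T₁]
    | add p q hp hq => simp only [map_add, hp, hq]
  simp [h, he]

/-! ### The smash product algebra: associativity and non-degeneracy. -/

namespace LeftModuleAlgebra

variable {C D : Type*} [NonUnitalRing C] [Module ℂ C] [IsScalarTower ℂ C C] [SMulCommClass ℂ C C]
  [NonUnitalRing D] [Module ℂ D] [IsScalarTower ℂ D D] [SMulCommClass ℂ D D]
  {HD : RegularMultiplierHopfAlgebra (LinearMap.mul ℂ D)} (α : LeftModuleAlgebra HD C)
  (HC : RegularMultiplierHopfAlgebra (LinearMap.mul ℂ C))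

/-- Left multiplication by `d ∈ D` on the smash product, `c ⊗ e ↦ ∑ (d₁ ▷ c) ⊗ d₂ e`. -/
def lmulD : D →ₗ[ℂ] C ⊗[ℂ] D →ₗ[ℂ] C ⊗[ℂ] D :=
  TensorProduct.curry ((LinearMap.mul' ℂ D).lTensor C ∘ₗ leg12 D α.twist)

theorem lmulD_tmul_eq_twist (d : D) (c : C) (e : D) : α.lmulD d (c ⊗ₜ e) =
    ((LinearMap.mul ℂ D).flip e).lTensor C (α.twist (d ⊗ₜ c)) := by
  simp only [lmulD, TensorProduct.curry_apply, LinearMap.comp_apply, leg12_tmul]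
  generalize α.twist _ = s
  induction s with
  | zero => simp
  | tmul a b => simp
  | add p q hp hq => simp only [map_add, TensorProduct.add_tmul, hp, hq]

theorem lmulD_tmul (d : D) (c : C) (e : D) : α.lmulD d (c ⊗ₜ e) =
    (α.act.flip c).rTensor D (HD.T₁ (d ⊗ₜ e)) := by
  rw [lmulD_tmul_eq_twist, lTensor_mul_twist]

theorem smashMul_tmul (c : C) (d : D) (y : C ⊗[ℂ] D) :
    α.smashMul (c ⊗ₜ d) y = (LinearMap.mul ℂ C c).rTensor D (α.lmulD d y) := by
  induction y with
  | zero => simp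
  | add p q hp hq => simp only [map_add, hp, hq]
  | tmul c' e =>
  rw [lmulD_tmul_eq_twist]
  simp only [smashMul, TensorProduct.curry_apply, LinearMap.comp_apply, middle,
    LinearEquiv.coe_coe, TensorProduct.assoc_tmul, LinearMap.lTensor_tmul,
    TensorProduct.assoc_symm_tmul, LinearMap.rTensor_tmul]
  generalize α.twist _ = s
  induction s with
  | zero => simp
  | tmul a b => simp
  | add p q hp hq => simp only [map_add, TensorProduct.add_tmul, TensorProduct.tmul_add, hp, hq]

theorem inclC_fst (c : C) : (α.inclC c).1 = (LinearMap.mul ℂ C c).rTensor D := rfl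

theorem inclD_fst (d : D) : (α.inclD d).1 = α.lmulD d := rfl

theorem lmulD_mul (d d' : D) (y : C ⊗[ℂ] D) : α.lmulD (d * d') y = α.lmulD d (α.lmulD d' y) := by
  induction y with
  | zero => simp
  | add p q hp hq => simp only [map_add, hp, hq]
  | tmul c e =>
  have h := HD.canonicalMaps.T₁_mul d d' e
  rw [LinearMap.mul_apply'] at h
  rw [lmulD_tmul, lmulD_tmul, h]
  generalize HD.T₁ (d' ⊗ₜ e) = s
  induction s with
  | zero => simp
  | add p q hp hq => simp only [map_add, hp, hq]
  | tmul p q =>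
  rw [legAct_tmul, LinearMap.rTensor_tmul, lmulD_tmul, ← LinearMap.rTensor_comp_apply]
  congr 2
  ext x
  simp [α.mul_act]

/-- In CD the tensor R(d ⊗ c) is the product dc, and (dc)y = d(cy) is the module algebra law
together with coassociativity of D. -/
theorem smashMul_twist (d : D) (c : C) (y : C ⊗[ℂ] D) :
    α.smashMul (α.twist (d ⊗ₜ c)) y = α.lmulD d ((LinearMap.mul ℂ C c).rTensor D y) := by
  induction y with
  | zero => simp
  | add p q hp hq => simp only [map_add, hp, hq]
  | tmul c' e =>
  let F : C ⊗[ℂ] (D ⊗[ℂ] D) →ₗ[ℂ] C ⊗[ℂ] D :=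
    (LinearMap.mul' ℂ C ∘ₗ (α.act.flip c').lTensor C).rTensor D ∘ₗ
      (TensorProduct.assoc ℂ C D D).symm.toLinearMap
  have h1 : ∀ s : C ⊗[ℂ] D, α.smashMul s (c' ⊗ₜ e) =
      F (leg23 C HD.T₁.toLinearMap (TensorProduct.assoc ℂ C D D (s ⊗ₜ e))) := by
    intro s
    induction s with
    | zero => simp
    | add p q hp hq => simp only [map_add, LinearMap.add_apply, TensorProduct.add_tmul, hp, hq]
    | tmul x r =>
    rw [smashMul_tmul, lmulD_tmul, TensorProduct.assoc_tmul, leg23_tmul, LinearEquiv.coe_coe]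
    generalize HD.T₁ (r ⊗ₜ e) = s
    induction s with
    | zero => simp
    | tmul a b => simp [F]
    | add p q hp hq => simp only [map_add, TensorProduct.tmul_add, hp, hq]
  rw [h1, ← leg12_tmul, ← leg12_twist_leg13_T₁, leg13_tmul, LinearMap.rTensor_tmul, lmulD_tmul,
    LinearEquiv.coe_coe]
  generalize HD.T₁ (d ⊗ₜ e) = s
  induction s with
  | zero => simp
  | tmul a b => simp [F, leg12, act_mul_eq]
  | add p q hp hq => simp only [map_add, TensorProduct.tmul_add, hp, hq]

theorem smashMul_mulC (c : C) (a y : C ⊗[ℂ] D) :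
    α.smashMul ((LinearMap.mul ℂ C c).rTensor D a) y =
      (LinearMap.mul ℂ C c).rTensor D (α.smashMul a y) := by
  induction a with
  | zero => simp
  | add p q hp hq => simp only [map_add, LinearMap.add_apply, hp, hq]
  | tmul c' d =>
  rw [LinearMap.rTensor_tmul, smashMul_tmul, smashMul_tmul, ← LinearMap.rTensor_comp_apply,
    mul_comp_of_assoc (fun a b c => mul_assoc a b c)]

theorem smashMul_lmulD (d : D) (a y : C ⊗[ℂ] D) :
    α.smashMul (α.lmulD d a) y = α.lmulD d (α.smashMul a y) := by
  induction a with
  | zero => simp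
  | add p q hp hq => simp only [map_add, LinearMap.add_apply, hp, hq]
  | tmul c e =>
  rw [lmulD_tmul_eq_twist, smashMul_tmul, ← smashMul_twist]
  generalize α.twist (d ⊗ₜ c) = s
  induction s with
  | zero => simp
  | tmul a b => simp [smashMul_tmul, lmulD_mul]
  | add p q hp hq => simp only [map_add, LinearMap.add_apply, hp, hq]

theorem smashMul_assoc (a b y : C ⊗[ℂ] D) :
    α.smashMul (α.smashMul a b) y = α.smashMul a (α.smashMul b y) := by
  induction a with
  | zero => simp
  | add p q hp hq => simp only [map_add, LinearMap.add_apply, hp, hq]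
  | tmul c d => rw [smashMul_tmul, smashMul_tmul, smashMul_mulC, smashMul_lmulD]

include HC in
-- Writing a = R(t) puts D on the left: (dc)(c'e) = R(d ⊗ cc')(1 ⊗ e). Non-degeneracy of D,
-- injectivity of R and non-degeneracy of C then cancel in turn.
theorem smashMul_nondegenerate_left (a : C ⊗[ℂ] D) (h : ∀ y, α.smashMul a y = 0) : a = 0 := by
  obtain ⟨t, rfl⟩ := α.twist_surjective a
  suffices t = 0 by rw [this, map_zero]
  refine lTensor_jointly_injective (LinearMap.mul ℂ C).flip HC.nondegenerate_left fun c' => ?_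
  apply α.twist_injective
  refine lTensor_jointly_injective (LinearMap.mul ℂ D).flip HD.nondegenerate_left fun e => ?_
  rw [map_zero, map_zero, map_zero, ← h (c' ⊗ₜ e)]
  clear h
  induction t with
  | zero => simp
  | add p q hp hq => simp only [map_add, LinearMap.add_apply, hp, hq]
  | tmul d c =>
  rw [smashMul_twist, LinearMap.rTensor_tmul, lmulD_tmul_eq_twist]
  simp

include HC in
theorem lmulD_twist (d : D) (t : D ⊗[ℂ] C) : α.lmulD d (α.twist t) =
    α.twist ((LinearMap.mul ℂ D d).rTensor C t) := by
  induction t with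
  | zero => simp
  | add p q hp hq => simp only [map_add, hp, hq]
  | tmul d' c =>
  rw [← sub_eq_zero]
  refine α.smashMul_nondegenerate_left HC _ fun y => ?_
  rw [map_sub, LinearMap.sub_apply, smashMul_lmulD, LinearMap.rTensor_tmul, smashMul_twist,
    smashMul_twist, LinearMap.mul_apply', lmulD_mul, sub_self]

include HC in
-- With b = R(t) one has (cd)b = cR((d ⊗ 1)t), so the same cancellations work from the other side.
theorem smashMul_nondegenerate_right (b : C ⊗[ℂ] D) (h : ∀ y, α.smashMul y b = 0) : b = 0 := by
  obtain ⟨t, rfl⟩ := α.twist_surjective b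
  suffices t = 0 by rw [this, map_zero]
  refine rTensor_jointly_injective (LinearMap.mul ℂ D) HD.nondegenerate_right fun d => ?_
  apply α.twist_injective
  refine rTensor_jointly_injective (LinearMap.mul ℂ C) HC.nondegenerate_right fun c => ?_
  rw [← α.lmulD_twist HC, ← smashMul_tmul, h]
  simp

include HC in
-- CD is spanned by products dy because D² spans D and R is onto. This allows a second leg y to be
-- replaced by d'y, which covers Δ(d) by d'.
theorem lift_lmulD_surjective :
    Function.Surjective (TensorProduct.lift α.lmulD) := by
  rw [← LinearMap.range_eq_top, eq_top_iff]
  rintro z -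
  obtain ⟨t, rfl⟩ := α.twist_surjective z
  induction t with
  | zero => simp
  | add p q hp hq => rw [map_add]; exact add_mem hp hq
  | tmul d c =>
  obtain ⟨s, rfl⟩ := HD.lift_mul_surjective d
  induction s with
  | zero => simp
  | add p q hp hq => rw [map_add, TensorProduct.add_tmul, map_add]; exact add_mem hp hq
  | tmul d d' =>
  refine ⟨d ⊗ₜ α.twist (d' ⊗ₜ c), ?_⟩
  rw [TensorProduct.lift.tmul, α.lmulD_twist HC]
  simp

theorem smashMul_inclC (c : C) (a b : C ⊗[ℂ] D) :
    α.smashMul ((α.inclC c).2.unop a) b = α.smashMul a ((LinearMap.mul ℂ C c).rTensor D b) := by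
  induction a with
  | zero => simp
  | add p q hp hq => simp only [map_add, LinearMap.add_apply, hp, hq]
  | tmul c' d =>
  have h : (α.inclC c).2.unop (c' ⊗ₜ d) =
      (LinearMap.mul ℂ C c').rTensor D (α.twist (d ⊗ₜ c)) := by
    simp only [inclC, MulOpposite.unop_op, LinearMap.comp_apply, LinearEquiv.coe_coe,
      LinearMap.flip_apply, TensorProduct.mk_apply, TensorProduct.assoc_tmul,
      LinearMap.lTensor_tmul]
    generalize α.twist (d ⊗ₜ c) = s
    induction s with
    | zero => simp
    | tmul a b => simp
    | add p q hp hq => simp only [map_add, TensorProduct.tmul_add, hp, hq]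
  rw [h, smashMul_mulC, smashMul_twist, smashMul_tmul]

theorem inclC_mem (c : C) : α.inclC c ∈ multiplierAlgebra α.smashMul := fun a b =>
  (α.smashMul_inclC c a b).symm

theorem inclD_mem (d : D) : α.inclD d ∈ multiplierAlgebra α.smashMul := by
  intro a b
  rw [inclD_fst]
  induction a with
  | zero => simp
  | add p q hp hq => simp only [map_add, LinearMap.add_apply, hp, hq]
  | tmul c' d' => simp [inclD, smashMul_tmul, lmulD_mul]

end LeftModuleAlgebra

section Slices

variable {V W W' X : Type*} [AddCommGroup V] [Module ℂ V] [AddCommGroup W] [Module ℂ W]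
  [AddCommGroup W'] [Module ℂ W'] [AddCommGroup X] [Module ℂ X]

theorem sliceR_rTensor (ε : V →ₗ[ℂ] ℂ) (f : W →ₗ[ℂ] W') (z : W ⊗[ℂ] V) :
    sliceR W' ε (f.rTensor V z) = f (sliceR W ε z) := by
  induction z with
  | zero => simp
  | tmul a b => simp
  | add p q hp hq => simp only [map_add, hp, hq]

theorem sliceL_lTensor (ε : V →ₗ[ℂ] ℂ) (f : W →ₗ[ℂ] W') (z : V ⊗[ℂ] W) :
    sliceL W' ε (f.lTensor V z) = f (sliceL W ε z) := by
  induction z with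
  | zero => simp
  | tmul a b => simp
  | add p q hp hq => simp only [map_add, hp, hq]

theorem sliceR_lTensor_of {ε : V →ₗ[ℂ] ℂ} {f : V →ₗ[ℂ] V} {r : ℂ} (h : ∀ v, ε (f v) = r * ε v)
    (z : W ⊗[ℂ] V) : sliceR W ε (f.lTensor W z) = r • sliceR W ε z := by
  induction z with
  | zero => simp
  | tmul a b => simp [h, mul_smul]
  | add p q hp hq => simp only [map_add, smul_add, hp, hq]

theorem sliceL_rTensor_of {ε : V →ₗ[ℂ] ℂ} {f : V →ₗ[ℂ] V} {r : ℂ} (h : ∀ v, ε (f v) = r * ε v)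
    (z : V ⊗[ℂ] W) : sliceL W ε (f.rTensor W z) = r • sliceL W ε z := by
  induction z with
  | zero => simp
  | tmul a b => simp [h, mul_smul]
  | add p q hp hq => simp only [map_add, smul_add, hp, hq]

end Slices

/-- The elements (a ⊗ 1)Δ(b) span V ⊗ V, so being killed by every Δ(p) on the left means being
killed by all of V ⊗ V. -/
theorem RegularMultiplierHopfAlgebra.legAct_T₁_jointly_injective {V : Type*} [AddCommGroup V]
    [Module ℂ V] {μ : V →ₗ[ℂ] V →ₗ[ℂ] V} (H : RegularMultiplierHopfAlgebra μ) (z : V ⊗[ℂ] V)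
    (h : ∀ p, legAct μ H.T₁.toLinearMap p z = 0) : z = 0 := by
  refine tensorMul_nondegenerate_right H.nondegenerate_right _ fun w => ?_
  obtain ⟨w, rfl⟩ := H.T₂.surjective w
  induction w with
  | zero => simp
  | add p q hp hq => simp only [map_add, LinearMap.add_apply, hp, hq, add_zero]
  | tmul a b =>
  have h1 := congrArg (fun t : PreMult (V ⊗[ℂ] V) => t.1 z) (H.T₂_spec a b)
  simp only [embed_fst, inFirst_fst, Prod.fst_mul, Module.End.mul_apply, H.coproduct_fst, h,
    map_zero] at h1
  exact h1

/-! ### The cotwist map T: counit rules and bijectivity. -/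

namespace RightComoduleCoalgebra

variable {C D : Type*} [NonUnitalRing C] [Module ℂ C] [IsScalarTower ℂ C C] [SMulCommClass ℂ C C]
  [NonUnitalRing D] [Module ℂ D] [IsScalarTower ℂ D D] [SMulCommClass ℂ D D]
  {HC : RegularMultiplierHopfAlgebra (LinearMap.mul ℂ C)}
  {HD : RegularMultiplierHopfAlgebra (LinearMap.mul ℂ D)} (β : RightComoduleCoalgebra HC HD)

/-- The map `d ⊗ c ↦ Γ(d)(1 ⊗ c)`. -/
def coactMul : D ⊗[ℂ] C →ₗ[ℂ] D ⊗[ℂ] C :=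
  cotwistOp β.Γ ∘ₗ (TensorProduct.comm ℂ D C).toLinearMap

theorem cotwist_tmul (c : C) (d : D) : cotwist β.Γ (c ⊗ₜ d) = (β.Γ d).1.1 c := by
  simp [cotwist]

theorem coactMul_tmul (c : C) (d : D) : β.coactMul (d ⊗ₜ c) = (β.Γ d).1.2 c := by
  simp [cotwistOp, coactMul]

theorem mul_coactMul (c c' : C) (d : D) :
    (LinearMap.mul ℂ C c).lTensor D (β.coactMul (d ⊗ₜ c')) =
      ((LinearMap.mul ℂ C).flip c').lTensor D (cotwist β.Γ (c ⊗ₜ d)) := by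
  rw [coactMul_tmul, cotwist_tmul]
  exact (β.Γ d).2 c c'

omit [IsScalarTower ℂ D D] [SMulCommClass ℂ D D] in
theorem lTensor_mul_mul (a b : C) (z : D ⊗[ℂ] C) :
    (LinearMap.mul ℂ C a).lTensor D ((LinearMap.mul ℂ C b).lTensor D z) =
      (LinearMap.mul ℂ C (a * b)).lTensor D z := by
  rw [← LinearMap.lTensor_comp_apply, mul_comp_of_assoc (fun a b c => mul_assoc a b c)]
  rfl

omit [IsScalarTower ℂ D D] [SMulCommClass ℂ D D] in
theorem lTensor_mul_mul_flip (a b : C) (z : D ⊗[ℂ] C) :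
    (LinearMap.mul ℂ C a).lTensor D (((LinearMap.mul ℂ C).flip b).lTensor D z) =
      ((LinearMap.mul ℂ C).flip b).lTensor D ((LinearMap.mul ℂ C a).lTensor D z) := by
  rw [← LinearMap.lTensor_comp_apply, ← LinearMap.lTensor_comp_apply,
    mul_flip_comm_of_assoc (fun a b c => mul_assoc a b c)]

omit [IsScalarTower ℂ D D] [SMulCommClass ℂ D D] in
theorem lTensor_flip_flip (a b : C) (z : D ⊗[ℂ] C) :
    ((LinearMap.mul ℂ C).flip b).lTensor D (((LinearMap.mul ℂ C).flip a).lTensor D z) =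
      ((LinearMap.mul ℂ C).flip (a * b)).lTensor D z := by
  rw [← LinearMap.lTensor_comp_apply, flip_comp_of_assoc (fun a b c => mul_assoc a b c)]
  rfl

/-- T is left C-linear because (1 ⊗ c)Γ(d), once covered on the right, is expressed through Γ(d)(1 ⊗
e). -/
theorem cotwist_mul (c c' : C) (d : D) : cotwist β.Γ ((c * c') ⊗ₜ d) =
    (LinearMap.mul ℂ C c).lTensor D (cotwist β.Γ (c' ⊗ₜ d)) := by
  refine lTensor_jointly_injective (LinearMap.mul ℂ C).flip HC.nondegenerate_left fun e => ?_
  rw [← mul_coactMul, ← lTensor_mul_mul, mul_coactMul, lTensor_mul_mul_flip]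

theorem coactMul_mul (c c' : C) (d : D) : β.coactMul (d ⊗ₜ (c * c')) =
    ((LinearMap.mul ℂ C).flip c').lTensor D (β.coactMul (d ⊗ₜ c)) := by
  refine lTensor_jointly_injective (LinearMap.mul ℂ C) HC.nondegenerate_right fun e => ?_
  rw [mul_coactMul, lTensor_mul_mul_flip, mul_coactMul, lTensor_flip_flip]

omit [IsScalarTower ℂ D D] [SMulCommClass ℂ D D] in
theorem sliceR_mul (c : C) (z : D ⊗[ℂ] C) : sliceR D HC.counit
    ((LinearMap.mul ℂ C c).lTensor D z) = HC.counit c • sliceR D HC.counit z :=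
  sliceR_lTensor_of (fun v => HC.isCounit_counit.map_mul c v) z

omit [IsScalarTower ℂ D D] [SMulCommClass ℂ D D] in
theorem sliceR_mul_flip (c : C) (z : D ⊗[ℂ] C) : sliceR D HC.counit
    (((LinearMap.mul ℂ C).flip c).lTensor D z) = HC.counit c • sliceR D HC.counit z :=
  sliceR_lTensor_of (fun v => (HC.isCounit_counit.map_mul v c).trans (mul_comm _ _)) z

include β in
theorem subsingleton_of_subsingleton [Subsingleton C] : Subsingleton D := by
  refine ⟨fun d d' => β.injective (Subtype.ext (Prod.ext ?_ ?_))⟩ <;>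
  · ext c
    rw [Subsingleton.elim c 0, map_zero, map_zero]

/-- Let E(d) = (ι ⊗ ε)Γ(d). Applying ε to the last leg of coassociativity gives Γ(E(d)) = Γ(d), and
injectivity of Γ yields E(d) = d. -/
theorem sliceR_cotwist (c : C) (d : D) :
    sliceR D HC.counit (cotwist β.Γ (c ⊗ₜ d)) = HC.counit c • d := by
  rcases subsingleton_or_nontrivial C with hC | hC
  · have := β.subsingleton_of_subsingleton
    exact Subsingleton.elim _ _
  obtain ⟨e, he⟩ := HC.exists_counit_eq_one
  have h1 : ∀ c d, sliceR D HC.counit (cotwist β.Γ (c ⊗ₜ d)) =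
      HC.counit c • sliceR D HC.counit (β.coactMul (d ⊗ₜ e)) := by
    intro c d
    rw [← sliceR_mul, mul_coactMul, sliceR_mul_flip, he, one_smul]
  rw [h1]
  congr 1
  set E : D →ₗ[ℂ] D := sliceR D HC.counit ∘ₗ β.coactMul ∘ₗ (TensorProduct.mk ℂ D C).flip e
  have hE : ∀ d, sliceR D HC.counit (β.coactMul (d ⊗ₜ e)) = E d := fun d => rfl
  simp only [hE] at h1 ⊢
  have h2 : ∀ (s : C ⊗[ℂ] C), (sliceR C HC.counit).lTensor D (leg12 C (cotwist β.Γ)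
      (leg23 C (cotwist β.Γ) (TensorProduct.assoc ℂ C C D (s ⊗ₜ d)))) =
      cotwist β.Γ (sliceR C HC.counit s ⊗ₜ E d) := by
    intro s
    induction s with
    | zero => simp
    | add p q hp hq => simp only [map_add, TensorProduct.add_tmul, hp, hq]
    | tmul x y =>
    rw [TensorProduct.assoc_tmul, leg23_tmul, sliceR_tmul, TensorProduct.smul_tmul, ← h1]
    generalize cotwist β.Γ (y ⊗ₜ d) = z
    induction z with
    | zero => simp
    | add p q hp hq => simp only [map_add, TensorProduct.tmul_add, hp, hq]
    | tmul r z =>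
    rw [leg12_tmul, sliceR_tmul, TensorProduct.tmul_smul, map_smul]
    generalize cotwist β.Γ (x ⊗ₜ r) = z
    induction z with
    | zero => simp
    | add p q hp hq => simp only [map_add, TensorProduct.add_tmul, smul_add, hp, hq]
    | tmul p q => simp
  have h3 : ∀ p q, cotwist β.Γ ((p * q) ⊗ₜ E d) = cotwist β.Γ ((p * q) ⊗ₜ d) := by
    intro p q
    have h := congrArg ((sliceR C HC.counit).lTensor D) (β.coassoc p q d)
    rw [h2, HC.sliceR_T₂, ← LinearMap.lTensor_comp_apply] at h
    rw [← LinearMap.mul_apply' (R := ℂ) p q, h, LinearMap.mul_apply', cotwist_mul]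
    congr 2
    ext x
    exact HC.sliceR_T₂ p x
  have h4 : ∀ c, cotwist β.Γ (c ⊗ₜ E d) = cotwist β.Γ (c ⊗ₜ d) := by
    intro c
    obtain ⟨s, rfl⟩ := HC.lift_mul_surjective c
    induction s with
    | zero => simp
    | add p q hp hq => simp only [map_add, TensorProduct.add_tmul, hp, hq]
    | tmul p q => simpa using h3 p q
  refine β.injective (Subtype.ext (Prod.ext ?_ ?_)) <;> ext c
  · simpa only [cotwist_tmul] using h4 c
  · rw [← coactMul_tmul, ← coactMul_tmul]
    refine lTensor_jointly_injective (LinearMap.mul ℂ C) HC.nondegenerate_right fun e => ?_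
    rw [mul_coactMul, mul_coactMul, h4]

theorem sliceR_coactMul (c : C) (d : D) :
    sliceR D HC.counit (β.coactMul (d ⊗ₜ c)) = HC.counit c • d := by
  rcases subsingleton_or_nontrivial C with hC | hC
  · have := β.subsingleton_of_subsingleton
    exact Subsingleton.elim _ _
  obtain ⟨e, he⟩ := HC.exists_counit_eq_one
  rw [← one_smul ℂ (sliceR D _ _), ← he, ← sliceR_mul, mul_coactMul, sliceR_mul_flip,
    sliceR_cotwist, he, one_smul]

/-- `(T ⊗ ι)(ι ⊗ Δ(a)(1 ⊗ b'))` -/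
theorem leg12_cotwist_leg13_T₁ (t : C ⊗[ℂ] (D ⊗[ℂ] C)) :
    leg12 C (cotwist β.Γ) (leg13 D HC.T₁.toLinearMap (leg23 C β.coactMul t)) =
      leg23 D HC.T₁.toLinearMap (leg12 C (cotwist β.Γ) t) := by
  induction t using tensor_induction_three with
  | zero => simp
  | add p q hp hq => simp only [map_add, hp, hq]
  | tmul a d b =>
  -- Covering the middle leg by p replaces Δ(a) by (p ⊗ 1)Δ(a), the form in which coassociativity of
  -- Γ is given.
  refine lTensor_jointly_injective (fun p => (LinearMap.mul ℂ C p).rTensor C) (fun z hz => ?_)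
    fun p => ?_
  · exact rTensor_jointly_injective (LinearMap.mul ℂ C) HC.nondegenerate_right
      (fun p => (hz p).trans (map_zero _).symm)
  have hT : ∀ p, (LinearMap.mul ℂ C p).lTensor D ∘ₗ cotwist β.Γ = cotwist β.Γ ∘ₗ
      (LinearMap.mul ℂ C p).rTensor D := by
    intro p
    refine TensorProduct.ext' fun c d => ?_
    simp [cotwist_mul]
  have h1 : ∀ z : D ⊗[ℂ] C, (LinearMap.mul ℂ C p).rTensor _ (leg13 D HC.T₁.toLinearMap
      (a ⊗ₜ z)) = ((LinearMap.lTensorHom D ∘ₗ LinearMap.mul ℂ C).flip z).lTensor C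
        (HC.T₂ (p ⊗ₜ a)) := by
    intro z
    induction z with
    | zero => simp
    | add p q hp hq => simp only [map_add, TensorProduct.tmul_add, hp, hq, LinearMap.lTensor_add,
        LinearMap.add_apply]
    | tmul r b =>
    rw [← leg13_post_fst, leg13_tmul, LinearMap.comp_apply, LinearEquiv.coe_coe,
      HC.canonicalMaps.mul_T₁]
    generalize HC.T₂ (p ⊗ₜ a) = s
    induction s with
    | zero => simp
    | tmul x y => simp
    | add p q hp hq => simp only [map_add, TensorProduct.tmul_add, hp, hq]
  have h2 : ∀ s : C ⊗[ℂ] C, leg12 C (cotwist β.Γ) (((LinearMap.lTensorHom D ∘ₗ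
      LinearMap.mul ℂ C).flip (β.coactMul (d ⊗ₜ b))).lTensor C s) =
      (((LinearMap.mul ℂ C).flip b).lTensor C).lTensor D (leg12 C (cotwist β.Γ)
        (leg23 C (cotwist β.Γ) (TensorProduct.assoc ℂ C C D (s ⊗ₜ d)))) := by
    intro s
    induction s with
    | zero => simp
    | add p q hp hq => simp only [map_add, TensorProduct.add_tmul, hp, hq]
    | tmul x y =>
    rw [LinearMap.lTensor_tmul, LinearMap.flip_apply, LinearMap.comp_apply,
      LinearMap.coe_lTensorHom, mul_coactMul, ← leg12_third, TensorProduct.assoc_tmul,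
      leg23_tmul, LinearMap.lTensor_tmul]
  rw [leg23_tmul, ← leg12_post_snd, hT, ← leg12_pre_fst, h1, h2, β.coassoc, leg12_tmul]
  generalize cotwist β.Γ (a ⊗ₜ d) = z
  induction z with
  | zero => simp
  | add p q hp hq => simp only [map_add, TensorProduct.add_tmul, hp, hq]
  | tmul r q => simp [leg23_tmul, HC.canonicalMaps.mul_T₁]

/-- In Sweedler notation both sides are ∑ d₀ ⊗ Δ(pd₁)s. Multiplication by Δ(p) on the left carries
coassociativity over to the version of Γ multiplied from the right. -/
theorem lTensor_legAct_leg12_coactMul (p : C) (d : D) (s : C ⊗[ℂ] C) :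
    (legAct (LinearMap.mul ℂ C) HC.T₁.toLinearMap p).lTensor D
      (leg12 C β.coactMul (leg13 C β.coactMul (d ⊗ₜ s))) =
    ((legAct (LinearMap.mul ℂ C) HC.T₁.toLinearMap).flip s).lTensor D
      (cotwist β.Γ (p ⊗ₜ d)) := by
  induction s with
  | zero => simp
  | add p q hp hq => simp only [map_add, TensorProduct.tmul_add, hp, hq, LinearMap.lTensor_add,
      LinearMap.add_apply]
  | tmul a b =>
  have h1 : ∀ z : D ⊗[ℂ] C, (legAct (LinearMap.mul ℂ C) HC.T₁.toLinearMap p).lTensor D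
      (leg12 C β.coactMul (TensorProduct.leftComm ℂ C D C (a ⊗ₜ z))) =
      (((LinearMap.mul ℂ C).flip a).rTensor C).lTensor D
        (leg12 C (cotwist β.Γ) (leg13 D HC.T₁.toLinearMap (p ⊗ₜ z))) := by
    intro z
    induction z with
    | zero => simp
    | add p q hp hq => simp only [map_add, TensorProduct.tmul_add, hp, hq]
    | tmul r y =>
    rw [TensorProduct.leftComm_tmul, leg12_tmul, leg13_tmul, LinearEquiv.coe_coe]
    have h2 : ∀ z : D ⊗[ℂ] C, (legAct (LinearMap.mul ℂ C) HC.T₁.toLinearMap p).lTensor D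
        (TensorProduct.assoc ℂ D C C (z ⊗ₜ y)) = ((TensorProduct.assoc ℂ D C C).toLinearMap ∘ₗ
          ((LinearMap.lTensorHom D ∘ₗ LinearMap.mul ℂ C).flip z).rTensor C) (HC.T₁ (p ⊗ₜ y)) := by
      intro z
      induction z with
      | zero => simp
      | add p q hp hq => simp only [map_add, TensorProduct.add_tmul, hp, hq, LinearMap.rTensor_add,
          LinearMap.comp_add, LinearMap.add_apply]
      | tmul r x =>
      rw [TensorProduct.assoc_tmul, LinearMap.lTensor_tmul, legAct_tmul, LinearEquiv.coe_coe]
      generalize HC.T₁ (p ⊗ₜ y) = s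
      induction s with
      | zero => simp
      | add p q hp hq => simp only [map_add, TensorProduct.tmul_add, hp, hq]
      | tmul u v => simp
    rw [h2]
    generalize HC.T₁ (p ⊗ₜ y) = s
    induction s with
    | zero => simp
    | add p q hp hq => simp only [map_add, TensorProduct.tmul_add, hp, hq]
    | tmul u v =>
    rw [TensorProduct.leftComm_tmul, leg12_tmul, lTensor_assoc_tmul, ← mul_coactMul]
    simp
  rw [leg13_tmul, h1, ← leg23_tmul, leg12_cotwist_leg13_T₁, leg12_tmul]
  generalize cotwist β.Γ (p ⊗ₜ d) = z
  induction z with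
  | zero => simp
  | add p q hp hq => simp only [map_add, TensorProduct.add_tmul, hp, hq]
  | tmul r q => simp [leg23_tmul]

/-- `(Γ ⊗ ι)Γ = (ι ⊗ Δ)Γ`, multiplied from the right with `1 ⊗ Δ(a)(1 ⊗ b)`. -/
theorem leg23_T₁_leg12_coactMul (t : D ⊗[ℂ] (C ⊗[ℂ] C)) :
    leg23 D HC.T₁.toLinearMap (leg12 C β.coactMul t) =
      leg12 C β.coactMul (leg13 C β.coactMul (leg23 D HC.T₁.toLinearMap t)) := by
  induction t using tensor_induction_three with
  | zero => simp
  | add p q hp hq => simp only [map_add, hp, hq]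
  | tmul d a b =>
  refine lTensor_jointly_injective (legAct (LinearMap.mul ℂ C) HC.T₁.toLinearMap)
    HC.legAct_T₁_jointly_injective fun p => ?_
  rw [leg23_tmul, lTensor_legAct_leg12_coactMul, leg12_tmul]
  have h1 : ∀ z : D ⊗[ℂ] C, (legAct (LinearMap.mul ℂ C) HC.T₁.toLinearMap p).lTensor D
      (leg23 D HC.T₁.toLinearMap (TensorProduct.assoc ℂ D C C (z ⊗ₜ b))) =
      leg23 D HC.T₁.toLinearMap (TensorProduct.assoc ℂ D C C
        ((LinearMap.mul ℂ C p).lTensor D z ⊗ₜ b)) := by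
    intro z
    induction z with
    | zero => simp
    | add p q hp hq => simp only [map_add, TensorProduct.add_tmul, hp, hq]
    | tmul r x =>
    have := HC.canonicalMaps.T₁_mul p x b
    simp [leg23_tmul, ← this]
  rw [h1, mul_coactMul]
  generalize cotwist β.Γ (p ⊗ₜ d) = z
  induction z with
  | zero => simp
  | add p q hp hq => simp only [map_add, TensorProduct.add_tmul, hp, hq]
  | tmul r q =>
    have := HC.canonicalMaps.T₁_mul q a b
    rw [LinearMap.mul_apply'] at this
    simp [leg23_tmul, this]

/-- `∑ d₀₀ ⊗ d₀₁ S(c d₁) = d ⊗ S(c)` -/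
theorem coactMul_antipode_cotwist (c : C) (d : D) :
    β.coactMul (HC.antipode.lTensor D (cotwist β.Γ (c ⊗ₜ d))) = d ⊗ₜ HC.antipode c := by
  let n : C ⊗[ℂ] C →ₗ[ℂ] C := LinearMap.mul' ℂ C ∘ₗ HC.antipode.lTensor C
  have hn : ∀ p q, n (HC.T₂ (p ⊗ₜ q)) = HC.counit q • p := by
    intro p q
    exact HC.isAntipode_antipode.right p q
  have h1 : ∀ s : C ⊗[ℂ] C, n.lTensor D (leg12 C (cotwist β.Γ) (leg23 C (cotwist β.Γ)
      (TensorProduct.assoc ℂ C C D (s ⊗ₜ d)))) = d ⊗ₜ n s := by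
    intro s
    obtain ⟨s, rfl⟩ := HC.T₂.surjective s
    induction s with
    | zero => simp
    | add p q hp hq => simp only [map_add, TensorProduct.add_tmul, TensorProduct.tmul_add, hp, hq]
    | tmul p q =>
    rw [β.coassoc, hn, TensorProduct.tmul_smul, TensorProduct.smul_tmul', ← β.sliceR_cotwist q d]
    generalize cotwist β.Γ (q ⊗ₜ d) = z
    induction z with
    | zero => simp
    | add p q hp hq => simp only [map_add, TensorProduct.add_tmul, hp, hq]
    | tmul r q => simp [hn, TensorProduct.smul_tmul']
  refine lTensor_jointly_injective (LinearMap.mul ℂ C) HC.nondegenerate_right fun x => ?_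
  refine Eq.trans ?_ (h1 (x ⊗ₜ c))
  rw [TensorProduct.assoc_tmul, leg23_tmul]
  generalize cotwist β.Γ (c ⊗ₜ d) = z
  induction z with
  | zero => simp
  | add p q hp hq => simp only [map_add, TensorProduct.tmul_add, hp, hq]
  | tmul r q =>
  rw [LinearMap.lTensor_tmul, mul_coactMul, leg12_tmul]
  generalize cotwist β.Γ (x ⊗ₜ r) = z
  induction z with
  | zero => simp
  | add p q hp hq => simp only [map_add, TensorProduct.add_tmul, hp, hq]
  | tmul r q => simp [n]

/-- By `coactMul_antipode_cotwist`, T followed by ι ⊗ S and by multiplication into Γ is the flip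
followed by ι ⊗ S, which is injective. -/
theorem cotwist_injective : Function.Injective (cotwist β.Γ) := by
  have hS := HC.isAntipode_antipode.bijective
  have h : β.coactMul ∘ₗ HC.antipode.lTensor D ∘ₗ cotwist β.Γ =
      HC.antipode.lTensor D ∘ₗ (TensorProduct.comm ℂ C D).toLinearMap :=
    TensorProduct.ext' fun c d => by simp [coactMul_antipode_cotwist]
  have h1 : Function.Injective (HC.antipode.lTensor D ∘ₗ (TensorProduct.comm ℂ C D).toLinearMap) :=
    (((LinearEquiv.ofBijective _ hS).lTensor D).injective).comp (TensorProduct.comm ℂ C D).injective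
  rw [← h] at h1
  simp only [LinearMap.coe_comp] at h1
  exact h1.of_comp.of_comp

/-- With S the antipode of the opposite coproduct of C, the element d ⊗ S(r) is the image of ∑
S(d₁r) ⊗ d₀, because the two coaction legs meet as ∑ S(q₂)q₁ = ε(q). Since S is onto, these elements
span D ⊗ C. -/
theorem cotwist_surjective : Function.Surjective (cotwist β.Γ) := by
  obtain ⟨S, hS, -, -, hn⟩ := HC.exists_antipode_flip
  set n := TensorProduct.lift (LinearMap.mul ℂ C ∘ₗ S) ∘ₗ (TensorProduct.comm ℂ C C).toLinearMap
  replace hn : ∀ a b, n (HC.T₁ (a ⊗ₜ b)) = HC.counit a • S b := hn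
  have h1 : ∀ (d : D) (s : C ⊗[ℂ] C), n.lTensor D (leg12 C β.coactMul (leg13 C β.coactMul
      (d ⊗ₜ s))) = d ⊗ₜ n s := by
    intro d s
    obtain ⟨s, rfl⟩ := HC.T₁.surjective s
    induction s with
    | zero => simp
    | add p q hp hq => simp only [map_add, TensorProduct.tmul_add, hp, hq]
    | tmul a b =>
    have := β.leg23_T₁_leg12_coactMul (d ⊗ₜ (a ⊗ₜ b))
    rw [leg23_tmul, LinearEquiv.coe_coe] at this
    rw [← this, hn, TensorProduct.tmul_smul, TensorProduct.smul_tmul', ← β.sliceR_coactMul a d,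
      leg12_tmul]
    generalize β.coactMul (d ⊗ₜ a) = z
    induction z with
    | zero => simp
    | add p q hp hq => simp only [map_add, TensorProduct.add_tmul, hp, hq]
    | tmul r q => simp [leg23_tmul, hn, TensorProduct.smul_tmul']
  have h2 : ∀ r d, cotwist β.Γ (TensorProduct.comm ℂ D C (S.lTensor D (β.coactMul (d ⊗ₜ r)))) =
      d ⊗ₜ S r := by
    intro r d
    refine lTensor_jointly_injective (LinearMap.mul ℂ C).flip HC.nondegenerate_left fun a => ?_
    refine Eq.trans ?_ (h1 d (a ⊗ₜ r))
    rw [leg13_tmul]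
    generalize β.coactMul (d ⊗ₜ r) = z
    induction z with
    | zero => simp
    | add p q hp hq => simp only [map_add, TensorProduct.tmul_add, hp, hq]
    | tmul r q =>
    rw [LinearMap.lTensor_tmul, TensorProduct.comm_tmul, ← mul_coactMul,
      TensorProduct.leftComm_tmul, leg12_tmul]
    generalize β.coactMul (r ⊗ₜ a) = z
    induction z with
    | zero => simp
    | add p q hp hq => simp only [map_add, TensorProduct.add_tmul, hp, hq]
    | tmul r q => simp [n]
  rw [← LinearMap.range_eq_top, eq_top_iff]
  rintro z -
  induction z with
  | zero => simp
  | add p q hp hq => exact add_mem hp hq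
  | tmul d c =>
  obtain ⟨r, rfl⟩ := hS c
  exact ⟨_, h2 r d⟩

theorem cotwist_bijective : Function.Bijective (cotwist β.Γ) :=
  ⟨β.cotwist_injective, β.cotwist_surjective⟩

/-- Compatibility of Γ with Δ_D forces the rule. Slicing the first leg by ε and cancelling T shows ∑
F(d₁) ⊗ d₂b = c ⊗ db for F(d) = (ε ⊗ ι)T(c ⊗ d). Hence F = ε(·)c, since T₁ of D is onto. -/
theorem sliceL_cotwist (c : C) (d : D) :
    sliceL C HD.counit (cotwist β.Γ (c ⊗ₜ d)) = HD.counit d • c := by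
  rcases subsingleton_or_nontrivial D with hD | hD
  · rw [Subsingleton.elim d 0]; simp
  obtain ⟨e, he⟩ := HD.exists_counit_eq_one
  let F : D →ₗ[ℂ] C := sliceL C HD.counit ∘ₗ cotwist β.Γ ∘ₗ TensorProduct.mk ℂ C D c
  have h1 : ∀ d b, F.rTensor D (HD.T₁ (d ⊗ₜ b)) = c ⊗ₜ (d * b) := by
    intro d b
    obtain ⟨w, hw, hw'⟩ := β.comul_left c d e
    -- The choice ε(e) = 1 makes the slice of (e ⊗ 1)Δ(r) equal to r, so both sides have the same
    -- image under T.
    have h2 : sliceL _ HD.counit w = c ⊗ₜ d := by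
      apply β.cotwist_injective
      have h3 := congrArg (sliceL _ HD.counit) hw'
      rw [leg23, sliceL_lTensor] at h3
      rw [h3]
      generalize cotwist β.Γ (c ⊗ₜ d) = z
      induction z with
      | zero => simp
      | add p q hp hq => simp only [map_add, hp, hq]
      | tmul r q =>
      have h4 := HD.sliceL_T₂ e r
      rw [he, one_smul] at h4
      conv_rhs => rw [← h4]
      simp only [LinearMap.rTensor_tmul, LinearMap.comp_apply, TensorProduct.mk_apply,
        LinearEquiv.coe_coe]
      generalize HD.T₂ (e ⊗ₜ r) = z
      induction z with
      | zero => simp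
      | add p q hp hq => simp only [map_add, TensorProduct.add_tmul, hp, hq]
      | tmul r q => simp [TensorProduct.smul_tmul']
    have h5 := congrArg (sliceL _ HD.counit) (hw b)
    rw [sliceL_lTensor, h2, sliceL_rTensor_of (r := 1)
      (fun v => by rw [← he]; exact HD.isCounit_counit.map_mul e v), one_smul] at h5
    refine Eq.trans ?_ h5.symm
    generalize HD.T₁ (d ⊗ₜ b) = z
    induction z with
    | zero => simp
    | add p q hp hq => simp only [map_add, TensorProduct.tmul_add, hp, hq]
    | tmul r q =>
    rw [leg12_tmul, LinearMap.rTensor_tmul]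
    change sliceL C HD.counit (cotwist β.Γ (c ⊗ₜ r)) ⊗ₜ q = _
    generalize cotwist β.Γ (c ⊗ₜ r) = z
    induction z with
    | zero => simp
    | add p q hp hq => simp only [map_add, TensorProduct.add_tmul, hp, hq]
    | tmul r q => simp [TensorProduct.smul_tmul']
  have h6 : ∀ z : D ⊗[ℂ] D, F.rTensor D z = c ⊗ₜ sliceL D HD.counit z := by
    intro z
    obtain ⟨z, rfl⟩ := HD.T₁.surjective z
    induction z with
    | zero => simp
    | add p q hp hq => simp only [map_add, TensorProduct.tmul_add, hp, hq]
    | tmul r q => rw [h1, HD.sliceL_T₁, LinearMap.mul_apply']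
  have h7 : F d = HD.counit d • c := by
    simpa [he] using congrArg (sliceR C HD.counit) (h6 (d ⊗ₜ e))
  exact h7

end RightComoduleCoalgebra

/-! ### The map P and its compatibility with R and the coproduct of C. -/

section Compatibility

variable {C D : Type*} [NonUnitalRing C] [Module ℂ C] [IsScalarTower ℂ C C] [SMulCommClass ℂ C C]
  [NonUnitalRing D] [Module ℂ D] [IsScalarTower ℂ D D] [SMulCommClass ℂ D D]
  {HC : RegularMultiplierHopfAlgebra (LinearMap.mul ℂ C)}
  {HD : RegularMultiplierHopfAlgebra (LinearMap.mul ℂ D)}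

theorem LeftModuleAlgebra.sliceR_twist (α : LeftModuleAlgebra HD C) (d : D) (c : C) :
    sliceR C HD.counit (α.twist (d ⊗ₜ c)) = α.act d c := by
  induction c using α.act_induction with
  | zero => simp
  | add p q hp hq => simp only [map_add, TensorProduct.tmul_add, hp, hq]
  | act e c =>
  have h := LinearMap.congr_fun (α.twist_comp_act c) (d ⊗ₜ e)
  simp only [LinearMap.comp_apply, LinearMap.lTensor_tmul, LinearMap.flip_apply,
    LinearEquiv.coe_coe] at h
  rw [h, sliceR_rTensor, HD.sliceR_T₃]
  simp [α.mul_act]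

variable (α : LeftModuleAlgebra HD C) (β : RightComoduleCoalgebra HC HD)

theorem mapP_eq : mapP α β = β.coactMul ∘ₗ α.coprodAct := by
  refine LinearMap.ext fun z => ?_
  simp only [mapP, RightComoduleCoalgebra.coactMul, LeftModuleAlgebra.coprodAct,
    LinearMap.comp_apply, LinearEquiv.coe_coe]
  congr 1
  exact ((TensorProduct.comm ℂ C D).symm_apply_apply _).symm

/-- In Sweedler notation, P(d ⊗ cc') = ∑ P(d₁ ⊗ c)(1 ⊗ (d₂ ▷ c')). This rule moves a covering factor
of C through P. -/
theorem mapP_mul (t : D ⊗[ℂ] (C ⊗[ℂ] C)) : mapP α β ((LinearMap.mul' ℂ C).lTensor D t) =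
    (LinearMap.mul' ℂ C).lTensor D (leg12 C (mapP α β) (leg13 C α.coprodAct t)) := by
  rw [mapP_eq, LinearMap.comp_apply, α.coprodAct_mul, leg12_comp]
  generalize leg12 C α.coprodAct (leg13 C α.coprodAct t) = t
  induction t using tensor_induction_three with
  | zero => simp
  | add p q hp hq => simp only [map_add, hp, hq]
  | tmul d c c' =>
  rw [LinearMap.lTensor_tmul, LinearMap.mul'_apply, β.coactMul_mul, leg12_tmul]
  generalize β.coactMul (d ⊗ₜ c) = z
  induction z with
  | zero => simp
  | add p q hp hq => simp only [map_add, TensorProduct.add_tmul, hp, hq]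
  | tmul r q => simp

namespace Compatible

variable {α β} (h : Compatible α β)
include h

theorem mapP_bijective : Function.Bijective (mapP α β) := by
  rw [h.comm]
  exact β.cotwist_bijective.comp α.twist_bijective

theorem sliceL_mapP (d : D) (c : C) : sliceL C HD.counit (mapP α β (d ⊗ₜ c)) = α.act d c := by
  rw [h.comm, LinearMap.comp_apply, ← α.sliceR_twist]
  generalize α.twist (d ⊗ₜ c) = z
  induction z with
  | zero => simp
  | add p q hp hq => simp only [map_add, hp, hq]
  | tmul c d => simp [β.sliceL_cotwist]

/-- `P₁₂ P₁₃ (ι ⊗ Δ)(d ⊗ c)`, multiplied from the right with `1 ⊗ 1 ⊗ b`. -/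
theorem leg12_mapP_leg13_mapP (t : D ⊗[ℂ] (C ⊗[ℂ] C)) :
    leg12 C (mapP α β) (leg13 C (mapP α β) (leg23 D HC.T₁.toLinearMap t)) =
      leg23 D HC.T₁.toLinearMap (leg12 C (mapP α β) (leg13 C α.coprodAct t)) := by
  let E := LinearEquiv.ofBijective _ (leg12_bijective (W := C) h.mapP_bijective)
  have hE : ∀ t, E t = leg12 C (mapP α β) t := fun t => rfl
  -- Since P₁₂ is invertible, the element (P₁₃(d ⊗ Δ(c)))(1 ⊗ 1 ⊗ b) from the hypothesis can be
  -- defined for all arguments at once, linearly in d ⊗ c ⊗ b.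
  let W : D ⊗[ℂ] (C ⊗[ℂ] C) →ₗ[ℂ] D ⊗[ℂ] (C ⊗[ℂ] C) :=
    E.symm.toLinearMap ∘ₗ leg23 D HC.T₁.toLinearMap ∘ₗ leg12 C (mapP α β)
  -- N(d ⊗ b) is the map c ↦ P(d ⊗ c)(1 ⊗ b). On ∑ d₁ ⊗ (d₂ ▷ b) it becomes c ↦ P(d ⊗ cb), by
  -- `mapP_mul`.
  let N : D ⊗[ℂ] C →ₗ[ℂ] C →ₗ[ℂ] D ⊗[ℂ] C := (TensorProduct.curry ((LinearMap.mul' ℂ C).lTensor D ∘ₗ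
    leg12 C (mapP α β) ∘ₗ (TensorProduct.leftComm ℂ C D C).toLinearMap)).flip
  have hN : ∀ d c b, N (d ⊗ₜ b) c =
      ((LinearMap.mul ℂ C).flip b).lTensor D (mapP α β (d ⊗ₜ c)) := by
    intro d c b
    simp only [N, LinearMap.flip_apply, TensorProduct.curry_apply, LinearMap.comp_apply,
      LinearEquiv.coe_coe, TensorProduct.leftComm_tmul, leg12_tmul]
    generalize mapP α β (d ⊗ₜ c) = z
    induction z with
    | zero => simp
    | add p q hp hq => simp only [map_add, TensorProduct.add_tmul, hp, hq]
    | tmul r q => simp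
  have hN' : ∀ d c b, N (α.coprodAct (d ⊗ₜ b)) c = mapP α β (d ⊗ₜ (c * b)) := by
    intro d c b
    have := mapP_mul α β (d ⊗ₜ (c ⊗ₜ b))
    rw [LinearMap.lTensor_tmul, LinearMap.mul'_apply] at this
    rw [this, leg13_tmul]
    rfl
  have hW : ∀ (e c : C) (z : D ⊗[ℂ] C), (((LinearMap.mul ℂ C).flip e).rTensor C).lTensor D
      (W (TensorProduct.leftComm ℂ C D C (c ⊗ₜ z))) =
      TensorProduct.leftComm ℂ C D C ((N z).lTensor C (HC.T₃ (c ⊗ₜ e))) := by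
    intro e c z
    induction z with
    | zero => simp
    | add p q hp hq => simp only [map_add, TensorProduct.tmul_add, hp, hq, LinearMap.lTensor_add,
        LinearMap.add_apply]
    | tmul d b =>
    obtain ⟨w, hw, hw'⟩ := h.comul d c b
    have h1 : w = W (d ⊗ₜ (c ⊗ₜ b)) := by
      apply E.injective
      rw [hE, hw']
      simp only [W, LinearMap.comp_apply, LinearEquiv.coe_coe, LinearEquiv.apply_symm_apply,
        leg12_tmul]
      generalize mapP α β (d ⊗ₜ c) = z
      induction z with
      | zero => simp
      | add p q hp hq => simp only [map_add, TensorProduct.add_tmul, hp, hq]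
      | tmul r q => simp [leg23_tmul]
    rw [TensorProduct.leftComm_tmul, ← h1]
    refine (hw e).trans ?_
    generalize HC.T₃ (c ⊗ₜ e) = s
    induction s with
    | zero => simp
    | add p q hp hq => simp only [map_add, TensorProduct.tmul_add, hp, hq]
    | tmul u v =>
    rw [LinearMap.lTensor_tmul, hN, leg13_tmul]
    generalize mapP α β (d ⊗ₜ v) = z
    induction z with
    | zero => simp
    | add p q hp hq => simp only [map_add, TensorProduct.tmul_add, hp, hq]
    | tmul r q => simp
  induction t using tensor_induction_three with
  | zero => simp
  | add p q hp hq => simp only [map_add, hp, hq]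
  | tmul d c b =>
  rw [← hE]
  apply E.symm.injective
  rw [E.symm_apply_apply]
  refine lTensor_jointly_injective (fun p => ((LinearMap.mul ℂ C).flip p).rTensor C)
    (fun z hz => ?_) fun e => ?_
  · exact rTensor_jointly_injective (LinearMap.mul ℂ C).flip HC.nondegenerate_left
      (fun p => (hz p).trans (map_zero _).symm)
  have h1 := hW e c (α.coprodAct (d ⊗ₜ b))
  rw [← leg13_tmul] at h1
  refine Eq.trans ?_ h1.symm
  rw [← leg13_second, leg23_tmul, LinearMap.lTensor_tmul, LinearEquiv.coe_coe, ← HC.T₃_mul_eq]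
  generalize HC.T₃ (c ⊗ₜ e) = s
  induction s with
  | zero => simp
  | add p q hp hq => simp only [map_add, TensorProduct.tmul_add, hp, hq]
  | tmul u v => simp [leg13_tmul, hN']

/-- `R₁₂ P₁₃ (ι ⊗ Δ) = (Δ ⊗ ι)₁₃ P₂₃ R₁₂`, covered. -/
theorem leg12_twist_leg13_mapP (t : D ⊗[ℂ] (C ⊗[ℂ] C)) :
    leg12 C α.twist (leg13 C (mapP α β) (leg23 D HC.T₁.toLinearMap t)) =
      leg13 D HC.T₁.toLinearMap (leg23 C (mapP α β) (leg12 C α.twist t)) := by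
  -- After T₁₂ the left side contains T₁₂R₁₂ = P₁₂, which brings in the identity for P₁₂P₁₃(ι ⊗ Δ).
  -- Coassociativity of Γ handles the right side.
  apply (leg12_bijective (W := C) β.cotwist_bijective).injective
  rw [← leg12_comp, ← h.comm, h.leg12_mapP_leg13_mapP, h.comm, leg12_comp,
    α.leg12_twist_leg13_coprodAct, ← h.comm, mapP_eq, leg23_comp, β.leg12_cotwist_leg13_T₁]

end Compatible

end Compatibility

/-! ### Maps on a factor of a pair and a further factor. -/

section Legs

variable {X Y Y' : Type*} [AddCommGroup X] [Module ℂ X] [AddCommGroup Y] [Module ℂ Y]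
  [AddCommGroup Y'] [Module ℂ Y']

/-- `f` acting on the factors `X` and `Y` of `(X ⊗ W) ⊗ Y`. -/
def onFst (W : Type*) [AddCommGroup W] [Module ℂ W] (f : X ⊗[ℂ] Y →ₗ[ℂ] X ⊗[ℂ] Y') :
    (X ⊗[ℂ] W) ⊗[ℂ] Y →ₗ[ℂ] (X ⊗[ℂ] W) ⊗[ℂ] Y' :=
  (TensorProduct.assoc ℂ X W Y').symm.toLinearMap ∘ₗ leg13 W f
    ∘ₗ (TensorProduct.assoc ℂ X W Y).toLinearMap

/-- `f` acting on the factors `X` and `Y` of `(W ⊗ X) ⊗ Y`. -/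
def onSnd (W : Type*) [AddCommGroup W] [Module ℂ W] (f : X ⊗[ℂ] Y →ₗ[ℂ] X ⊗[ℂ] Y') :
    (W ⊗[ℂ] X) ⊗[ℂ] Y →ₗ[ℂ] (W ⊗[ℂ] X) ⊗[ℂ] Y' :=
  (TensorProduct.assoc ℂ W X Y').symm.toLinearMap ∘ₗ leg23 W f
    ∘ₗ (TensorProduct.assoc ℂ W X Y).toLinearMap

variable {W : Type*} [AddCommGroup W] [Module ℂ W]

theorem onFst_tmul (f : X ⊗[ℂ] Y →ₗ[ℂ] X ⊗[ℂ] Y') (x : X) (w : W) (y : Y) :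
    onFst W f ((x ⊗ₜ w) ⊗ₜ y) = ((TensorProduct.mk ℂ X W).flip w).rTensor Y' (f (x ⊗ₜ y)) := by
  simp only [onFst, LinearMap.comp_apply, LinearEquiv.coe_coe, TensorProduct.assoc_tmul, leg13_tmul]
  generalize f (x ⊗ₜ y) = z
  induction z with
  | zero => simp
  | add p q hp hq => simp only [map_add, TensorProduct.tmul_add, hp, hq]
  | tmul r q => simp

theorem onSnd_tmul (f : X ⊗[ℂ] Y →ₗ[ℂ] X ⊗[ℂ] Y') (x : X) (w : W) (y : Y) :
    onSnd W f ((w ⊗ₜ x) ⊗ₜ y) = (TensorProduct.mk ℂ W X w).rTensor Y' (f (x ⊗ₜ y)) := by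
  simp only [onSnd, LinearMap.comp_apply, LinearEquiv.coe_coe, TensorProduct.assoc_tmul, leg23_tmul]
  generalize f (x ⊗ₜ y) = z
  induction z with
  | zero => simp
  | add p q hp hq => simp only [map_add, TensorProduct.tmul_add, hp, hq]
  | tmul r q => simp

theorem onFst_bijective {f : X ⊗[ℂ] Y →ₗ[ℂ] X ⊗[ℂ] Y'} (hf : Function.Bijective f) :
    Function.Bijective (onFst W f) :=
  (TensorProduct.assoc ℂ X W Y').symm.bijective.comp
    ((leg13_bijective hf).comp (TensorProduct.assoc ℂ X W Y).bijective)

theorem onSnd_bijective {f : X ⊗[ℂ] Y →ₗ[ℂ] X ⊗[ℂ] Y'} (hf : Function.Bijective f) :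
    Function.Bijective (onSnd W f) :=
  (TensorProduct.assoc ℂ W X Y').symm.bijective.comp
    ((leg23_bijective hf).comp (TensorProduct.assoc ℂ W X Y).bijective)

end Legs

section Legs

variable {X Y Z W X' Y' : Type*} [AddCommGroup X] [Module ℂ X] [AddCommGroup Y] [Module ℂ Y]
  [AddCommGroup Z] [Module ℂ Z] [AddCommGroup W] [Module ℂ W] [AddCommGroup X'] [Module ℂ X']
  [AddCommGroup Y'] [Module ℂ Y']

/-- `x ⊗ y ⊗ z ↦ x ⊗ y ⊗ z ⊗ w` -/
def appendFactor (X Y Z W : Type*) [AddCommGroup X] [Module ℂ X] [AddCommGroup Y] [Module ℂ Y]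
    [AddCommGroup Z] [Module ℂ Z] [AddCommGroup W] [Module ℂ W] :
    W →ₗ[ℂ] X ⊗[ℂ] (Y ⊗[ℂ] Z) →ₗ[ℂ] X ⊗[ℂ] (Y ⊗[ℂ] (Z ⊗[ℂ] W)) :=
  LinearMap.lTensorHom X ∘ₗ LinearMap.lTensorHom Y ∘ₗ (TensorProduct.mk ℂ Z W).flip

@[simp] theorem appendFactor_tmul (x : X) (y : Y) (z : Z) (w : W) :
    appendFactor X Y Z W w (x ⊗ₜ (y ⊗ₜ z)) = x ⊗ₜ (y ⊗ₜ (z ⊗ₜ w)) := rfl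

theorem leg12_appendFactor (f : X ⊗[ℂ] Y →ₗ[ℂ] X' ⊗[ℂ] Y') (w : W) (t) :
    leg12 _ f (appendFactor X Y Z W w t) = appendFactor X' Y' Z W w (leg12 Z f t) :=
  leg12_third f _ t

theorem leg23_appendFactor (f : X ⊗[ℂ] Y →ₗ[ℂ] X' ⊗[ℂ] Y') (w : W) (t) :
    leg23 Z (leg12 W f) (appendFactor Z X Y W w t) = appendFactor Z X' Y' W w (leg23 Z f t) := by
  induction t using tensor_induction_three with
  | zero => simp
  | add p q hp hq => simp only [map_add, hp, hq]
  | tmul z x y =>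
  simp only [appendFactor_tmul, leg23_tmul, leg12_tmul]
  generalize f (x ⊗ₜ y) = s
  induction s with
  | zero => simp
  | add p q hp hq => simp only [map_add, TensorProduct.tmul_add, TensorProduct.add_tmul, hp, hq]
  | tmul r q => simp

theorem leg13_appendFactor (f : X ⊗[ℂ] Y →ₗ[ℂ] X' ⊗[ℂ] Y') (w : W) (t) :
    leg13 Z (leg12 W f) (appendFactor X Z Y W w t) = appendFactor X' Z Y' W w (leg13 Z f t) := by
  induction t using tensor_induction_three with
  | zero => simp
  | add p q hp hq => simp only [map_add, hp, hq]
  | tmul x z y =>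
  simp only [appendFactor_tmul, leg13_tmul, leg12_tmul]
  generalize f (x ⊗ₜ y) = s
  induction s with
  | zero => simp
  | add p q hp hq => simp only [map_add, TensorProduct.tmul_add, TensorProduct.add_tmul, hp, hq]
  | tmul r q => simp

end Legs

/-! ### The map T₁ of the smash product and its multiplicativity. -/

section Compatibility

variable {C D : Type*} [NonUnitalRing C] [Module ℂ C] [IsScalarTower ℂ C C] [SMulCommClass ℂ C C]
  [NonUnitalRing D] [Module ℂ D] [IsScalarTower ℂ D D] [SMulCommClass ℂ D D]
  {HC : RegularMultiplierHopfAlgebra (LinearMap.mul ℂ C)}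
  {HD : RegularMultiplierHopfAlgebra (LinearMap.mul ℂ D)}

section

variable (α : LeftModuleAlgebra HD C)

/-- `∑ d₁ ⊗ (d₂ ▷ c) ⊗ d₃ e` -/
def LeftModuleAlgebra.coprodActMul : D ⊗[ℂ] (C ⊗[ℂ] D) →ₗ[ℂ] D ⊗[ℂ] (C ⊗[ℂ] D) :=
  leg12 D α.coprodAct ∘ₗ leg13 C HD.T₁.toLinearMap

/-- Both sides are ∑ d₁ ⊗ d₂d'y. Once y is covered by d', the action in the second leg is just
multiplication in CD. -/
theorem LeftModuleAlgebra.coprodActMul_lmulD (d d' : D) (y : C ⊗[ℂ] D) :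
    α.coprodActMul (d ⊗ₜ α.lmulD d' y) = (α.lmulD.flip y).lTensor D (HD.T₁ (d ⊗ₜ d')) := by
  induction y with
  | zero => simp
  | add p q hp hq => simp only [map_add, TensorProduct.tmul_add, hp, hq, LinearMap.lTensor_add,
      LinearMap.add_apply]
  | tmul c e =>
  have h1 : HD.T₁.toLinearMap ∘ₗ ((LinearMap.mul ℂ D).flip e).lTensor D =
      ((LinearMap.mul ℂ D).flip e).lTensor D ∘ₗ HD.T₁.toLinearMap :=
    TensorProduct.ext' fun a b => by simpa using HD.canonicalMaps.T₁_right a b e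
  have h2 := α.leg23_twist_leg12_T₁ (d ⊗ₜ (d' ⊗ₜ c))
  rw [leg23_tmul, leg12_tmul] at h2
  rw [α.lmulD_tmul_eq_twist, ← LinearMap.lTensor_tmul, coprodActMul, LinearMap.comp_apply,
    leg13_pre_third, h1, leg13_post_third, leg12_third, ← h2, LinearEquiv.coe_coe]
  generalize HD.T₁ (d ⊗ₜ d') = z
  induction z with
  | zero => simp
  | add p q hp hq => simp only [map_add, TensorProduct.add_tmul, hp, hq]
  | tmul r q => simp [leg23_tmul, α.lmulD_tmul_eq_twist]

/-- `Δ(c)(1 ⊗ y)` for `c ∈ C` and `y` in the smash product. -/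
def coproductC (HC : RegularMultiplierHopfAlgebra (LinearMap.mul ℂ C)) (D : Type*)
    [AddCommGroup D] [Module ℂ D] : C ⊗[ℂ] (C ⊗[ℂ] D) →ₗ[ℂ] C ⊗[ℂ] (C ⊗[ℂ] D) :=
  leg12 D HC.T₁.toLinearMap

/-- Left multiplication by `c ∈ C` on the smash product. -/
def lmulC (C D : Type*) [NonUnitalRing C] [Module ℂ C] [IsScalarTower ℂ C C] [SMulCommClass ℂ C C]
    [AddCommGroup D] [Module ℂ D] : C →ₗ[ℂ] C ⊗[ℂ] D →ₗ[ℂ] C ⊗[ℂ] D :=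
  LinearMap.rTensorHom D ∘ₗ LinearMap.mul ℂ C

omit [IsScalarTower ℂ D D] [SMulCommClass ℂ D D] in
theorem lmulC_apply (c : C) : lmulC C D c = (LinearMap.mul ℂ C c).rTensor D := rfl

omit [IsScalarTower ℂ D D] [SMulCommClass ℂ D D] in
theorem mul_coproductC (c c' : C) (y : C ⊗[ℂ] D) :
    (LinearMap.mul ℂ C c').rTensor _ (coproductC HC D (c ⊗ₜ y)) =
      ((lmulC C D).flip y).lTensor C (HC.T₂ (c' ⊗ₜ c)) := by
  induction y with
  | zero => simp
  | add p q hp hq => simp only [map_add, TensorProduct.tmul_add, hp, hq, LinearMap.lTensor_add,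
      LinearMap.add_apply]
  | tmul a e =>
  rw [coproductC, leg12_tmul, rTensor_assoc_tmul, LinearEquiv.coe_coe, HC.canonicalMaps.mul_T₁]
  generalize HC.T₂ (c' ⊗ₜ c) = z
  induction z with
  | zero => simp
  | add p q hp hq => simp only [map_add, TensorProduct.add_tmul, hp, hq]
  | tmul r q => simp [lmulC_apply]

omit [IsScalarTower ℂ D D] [SMulCommClass ℂ D D] in
theorem coproductC_mul (c c' : C) (y : C ⊗[ℂ] D) : coproductC HC D ((c * c') ⊗ₜ y) =
    legAct (LinearMap.mul ℂ C) (coproductC HC D) c (coproductC HC D (c' ⊗ₜ y)) := by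
  induction y with
  | zero => simp
  | add p q hp hq => simp only [map_add, TensorProduct.tmul_add, hp, hq]
  | tmul a e =>
  have h := HC.canonicalMaps.T₁_mul c c' a
  rw [LinearMap.mul_apply'] at h
  simp only [coproductC, leg12_tmul, LinearEquiv.coe_coe, h]
  generalize HC.T₁ (c' ⊗ₜ a) = z
  induction z with
  | zero => simp
  | add p q hp hq => simp only [map_add, TensorProduct.add_tmul, hp, hq]
  | tmul r q => simp [leg12_tmul, rTensor_assoc_tmul]

end

variable (α : LeftModuleAlgebra HD C) (β : RightComoduleCoalgebra HC HD)

/-- `Δ(d)(1 ⊗ y)` for `d ∈ D` and `y` in the smash product. -/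
def coproductD : D ⊗[ℂ] (C ⊗[ℂ] D) →ₗ[ℂ] D ⊗[ℂ] (C ⊗[ℂ] D) :=
  leg12 D (mapP α β) ∘ₗ leg13 C HD.T₁.toLinearMap

/-- `a ⊗ y ↦ Δ(a)(1 ⊗ y)` for the smash product. -/
def smashT₁ : (C ⊗[ℂ] D) ⊗[ℂ] (C ⊗[ℂ] D) →ₗ[ℂ] (C ⊗[ℂ] D) ⊗[ℂ] (C ⊗[ℂ] D) :=
  onFst D (coproductC HC D) ∘ₗ onSnd C (coproductD α β)

theorem coproductD_eq : coproductD α β = leg12 D β.coactMul ∘ₗ α.coprodActMul := by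
  refine LinearMap.ext fun t => ?_
  simp only [coproductD, mapP_eq, LinearMap.comp_apply, LeftModuleAlgebra.coprodActMul, leg12_comp]

/-- `(c' ⊗ 1)Δ(c d)(1 ⊗ d')` -/
theorem smashT₁_cover (c c' : C) (d d' : D) (y : C ⊗[ℂ] D) :
    ((LinearMap.mul ℂ C c').rTensor D).rTensor _ (smashT₁ α β ((c ⊗ₜ d) ⊗ₜ α.lmulD d' y)) =
      (α.smashMul.flip y).lTensor _
        (middle C D (cotwist β.Γ) (HC.T₂ (c' ⊗ₜ c) ⊗ₜ HD.T₁ (d ⊗ₜ d'))) := by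
  have h1 : ∀ t : D ⊗[ℂ] (C ⊗[ℂ] D), ((LinearMap.mul ℂ C c').rTensor D).rTensor _
      (onFst D (coproductC HC D) ((TensorProduct.mk ℂ C D c).rTensor _ t)) =
      (TensorProduct.assoc ℂ C D (C ⊗[ℂ] D)).symm
        (((LinearMap.lTensorHom D ∘ₗ lmulC C D).flip t).lTensor C (HC.T₂ (c' ⊗ₜ c))) := by
    intro t
    induction t with
    | zero => simp
    | add p q hp hq => simp only [map_add, hp, hq, LinearMap.lTensor_add, LinearMap.add_apply]
    | tmul r y =>
    rw [LinearMap.rTensor_tmul, TensorProduct.mk_apply, onFst_tmul, ← LinearMap.rTensor_comp_apply]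
    have h2 : (LinearMap.mul ℂ C c').rTensor D ∘ₗ (TensorProduct.mk ℂ C D).flip r =
        (TensorProduct.mk ℂ C D).flip r ∘ₗ LinearMap.mul ℂ C c' := by ext; simp
    rw [h2, LinearMap.rTensor_comp_apply, mul_coproductC]
    generalize HC.T₂ (c' ⊗ₜ c) = z
    induction z with
    | zero => simp
    | add p q hp hq => simp only [map_add, hp, hq]
    | tmul r q => simp
  -- The factor v coming from Δ(c) meets Γ(p) from the left and turns Γ(p)(1 ⊗ z) into T(v ⊗ p)(1 ⊗
  -- z).
  have h3 : ∀ (v : C) (p : D) (z : C ⊗[ℂ] D), (lmulC C D v).lTensor D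
      (leg12 D β.coactMul (p ⊗ₜ z)) = ((lmulC C D).flip z).lTensor D (cotwist β.Γ (v ⊗ₜ p)) := by
    intro v p z
    induction z with
    | zero => simp
    | add p q hp hq => simp only [map_add, TensorProduct.tmul_add, hp, hq, LinearMap.lTensor_add,
        LinearMap.add_apply]
    | tmul a e =>
    rw [leg12_tmul, lmulC_apply, lTensor_assoc_tmul, β.mul_coactMul]
    generalize cotwist β.Γ (v ⊗ₜ p) = z
    induction z with
    | zero => simp
    | add p q hp hq => simp only [map_add, TensorProduct.add_tmul, hp, hq]
    | tmul r q => simp [lmulC_apply]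
  rw [smashT₁, LinearMap.comp_apply, onSnd_tmul, coproductD_eq, LinearMap.comp_apply,
    α.coprodActMul_lmulD, h1]
  generalize HD.T₁ (d ⊗ₜ d') = s
  generalize HC.T₂ (c' ⊗ₜ c) = z
  induction s with
  | zero => simp
  | add p q hp hq => simp only [map_add, TensorProduct.tmul_add, LinearMap.lTensor_add,
        LinearMap.add_apply, hp, hq]
  | tmul p q =>
  induction z with
  | zero => simp
  | add p q hp hq => simp only [map_add, TensorProduct.add_tmul, hp, hq]
  | tmul u v =>
  simp only [LinearMap.lTensor_tmul, LinearMap.flip_apply, LinearMap.comp_apply, middle,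
    LinearMap.coe_lTensorHom, LinearEquiv.coe_coe, TensorProduct.assoc_tmul,
    TensorProduct.assoc_symm_tmul, LinearMap.rTensor_tmul, h3]
  generalize cotwist β.Γ (v ⊗ₜ p) = z
  induction z with
  | zero => simp
  | add p q hp hq => simp only [map_add, TensorProduct.add_tmul, TensorProduct.tmul_add, hp, hq]
  | tmul r s => simp [α.smashMul_tmul, lmulC_apply]

/-- As left multiplications, Δ(cd) = Δ(c)Δ(d). Multiplicativity can therefore be checked separately
for c and for d. -/
theorem legAct_smashT₁ (c : C) (d : D) : legAct α.smashMul (smashT₁ α β) (c ⊗ₜ d) =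
    legAct (lmulC C D) (coproductC HC D) c ∘ₗ legAct α.lmulD (coproductD α β) d := by
  refine TensorProduct.ext' fun x y => ?_
  rw [legAct_tmul, LinearMap.comp_apply, legAct_tmul, smashT₁, LinearMap.comp_apply, onSnd_tmul]
  generalize coproductD α β (d ⊗ₜ y) = z
  induction z with
  | zero => simp
  | add p q hp hq => simp only [map_add, hp, hq]
  | tmul p y =>
  rw [LinearMap.rTensor_tmul, TensorProduct.mk_apply, onFst_tmul, LinearMap.rTensor_tmul,
    legAct_tmul]
  generalize coproductC HC D (c ⊗ₜ y) = z
  induction z with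
  | zero => simp
  | add p q hp hq => simp only [map_add, hp, hq]
  | tmul u y => simp [α.smashMul_tmul, lmulC_apply]

theorem smashT₁_lmulC (c : C) (b y : C ⊗[ℂ] D) : smashT₁ α β (lmulC C D c b ⊗ₜ y) =
    legAct (lmulC C D) (coproductC HC D) c (smashT₁ α β (b ⊗ₜ y)) := by
  induction b with
  | zero => simp
  | add p q hp hq => simp only [map_add, TensorProduct.add_tmul, hp, hq]
  | tmul c' d =>
  rw [smashT₁, LinearMap.comp_apply, LinearMap.comp_apply, lmulC_apply, LinearMap.rTensor_tmul,
    onSnd_tmul, onSnd_tmul]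
  generalize coproductD α β (d ⊗ₜ y) = z
  induction z with
  | zero => simp
  | add p q hp hq => simp only [map_add, hp, hq]
  | tmul p y =>
  rw [LinearMap.rTensor_tmul, LinearMap.rTensor_tmul, TensorProduct.mk_apply,
    TensorProduct.mk_apply, onFst_tmul, onFst_tmul, LinearMap.mul_apply', coproductC_mul]
  generalize coproductC HC D (c' ⊗ₜ y) = z
  induction z with
  | zero => simp
  | add p q hp hq => simp only [map_add, hp, hq]
  | tmul u y =>
  rw [legAct_tmul, LinearMap.rTensor_tmul, legAct_tmul]
  generalize coproductC HC D (c ⊗ₜ y) = z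
  induction z with
  | zero => simp
  | add p q hp hq => simp only [map_add, hp, hq]
  | tmul u y => simp [lmulC_apply]

variable {α β} (h : Compatible α β)
include h

theorem Compatible.mapP_mul_left (d d' : D) (c : C) : mapP α β ((d * d') ⊗ₜ c) =
    legAct (LinearMap.mul ℂ D) (mapP α β) d (mapP α β (d' ⊗ₜ c)) := by
  have := LinearMap.congr_fun h.mul (d ⊗ₜ (d' ⊗ₜ c))
  simp only [LinearMap.comp_apply, LinearEquiv.coe_coe, TensorProduct.assoc_symm_tmul,
    LinearMap.rTensor_tmul, LinearMap.mul'_apply, leg23_tmul] at this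
  rw [this]
  generalize mapP α β (d' ⊗ₜ c) = z
  induction z with
  | zero => simp
  | add p q hp hq => simp only [map_add, TensorProduct.tmul_add, hp, hq]
  | tmul p c =>
  rw [leg13_tmul, legAct_tmul]
  generalize mapP α β (d ⊗ₜ c) = z
  induction z with
  | zero => simp
  | add p q hp hq => simp only [map_add, TensorProduct.tmul_add, hp, hq]
  | tmul q c => simp

/-- Multiplicativity of Δ on D inside CD combines multiplicativity of Δ_D with P(m ⊗ ι) = (m ⊗
ι)P₁₃P₂₃. -/
theorem Compatible.coproductD_mul (d d' : D) (y : C ⊗[ℂ] D) : coproductD α β ((d * d') ⊗ₜ y) =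
    legAct (LinearMap.mul ℂ D) (coproductD α β) d (coproductD α β (d' ⊗ₜ y)) := by
  induction y with
  | zero => simp
  | add p q hp hq => simp only [map_add, TensorProduct.tmul_add, hp, hq]
  | tmul c e =>
  have h1 : ∀ (z : D ⊗[ℂ] C) (e : D), legAct (LinearMap.mul ℂ D) (coproductD α β) d
      (TensorProduct.assoc ℂ D C D (z ⊗ₜ e)) = TensorProduct.assoc ℂ D C D
        (((legAct (LinearMap.mul ℂ D) (mapP α β)).flip z).rTensor D (HD.T₁ (d ⊗ₜ e))) := by
    intro z e
    induction z with
    | zero => simp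
    | add p q hp hq => simp only [map_add, TensorProduct.add_tmul, hp, hq, LinearMap.rTensor_add,
        LinearMap.add_apply]
    | tmul r c =>
    rw [TensorProduct.assoc_tmul, legAct_tmul, coproductD, LinearMap.comp_apply, leg13_tmul,
      LinearEquiv.coe_coe]
    generalize HD.T₁ (d ⊗ₜ e) = z
    induction z with
    | zero => simp
    | add p q hp hq => simp only [map_add, TensorProduct.tmul_add, hp, hq]
    | tmul q e => simp [leg12_tmul, rTensor_assoc_tmul]
  have h2 := HD.canonicalMaps.T₁_mul d d' e
  rw [LinearMap.mul_apply'] at h2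
  conv_lhs => rw [coproductD, LinearMap.comp_apply, leg13_tmul, LinearEquiv.coe_coe, h2]
  conv_rhs => rw [coproductD, LinearMap.comp_apply (leg12 D _), leg13_tmul, LinearEquiv.coe_coe]
  generalize HD.T₁ (d' ⊗ₜ e) = z
  induction z with
  | zero => simp
  | add p q hp hq => simp only [map_add, TensorProduct.tmul_add, hp, hq]
  | tmul p e =>
  rw [TensorProduct.leftComm_tmul, leg12_tmul, legAct_tmul]
  change _ = legAct (LinearMap.mul ℂ D) (coproductD α β) d _
  rw [h1, LinearEquiv.coe_coe]
  generalize HD.T₁ (d ⊗ₜ e) = z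
  induction z with
  | zero => simp
  | add p q hp hq => simp only [map_add, TensorProduct.tmul_add, hp, hq]
  | tmul q e => simp [leg12_tmul, h.mapP_mul_left]

/-- This is the covered commutation rule Δ(d)Δ(c) = ∑ Δ(d₁ ▷ c)Δ(d₂). The leg in D is carried along
by `leg12_twist_leg13_T₁`, which reduces the claim to `leg12_twist_leg13_mapP`. -/
theorem Compatible.leg12_twist_leg13_coproductD (t : D ⊗[ℂ] (C ⊗[ℂ] (C ⊗[ℂ] D))) :
    leg12 _ α.twist (leg13 C (coproductD α β) (leg23 D (coproductC HC D) t)) =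
      leg13 D (coproductC HC D) (leg23 C (coproductD α β) (leg12 _ α.twist t)) := by
  induction t using tensor_induction_three with
  | zero => simp
  | add p q hp hq => simp only [map_add, hp, hq]
  | tmul d c y =>
  induction y with
  | zero => simp
  | add p q hp hq => simp only [map_add, TensorProduct.tmul_add, hp, hq]
  | tmul c' e =>
  -- Φ s inserts s between the two legs of D ⊗ D, so that Δ(d)(1 ⊗ e) can be expanded around a fixed
  -- s.
  let Φ (s : C ⊗[ℂ] C) : D ⊗[ℂ] D →ₗ[ℂ] D ⊗[ℂ] (C ⊗[ℂ] (C ⊗[ℂ] D)) := TensorProduct.lift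
    ((appendFactor D C C D).flip ∘ₗ (TensorProduct.mk ℂ D (C ⊗[ℂ] C)).flip s)
  have hΦ : ∀ s p e, Φ s (p ⊗ₜ e) = appendFactor D C C D e (p ⊗ₜ s) := fun s p e => rfl
  have h1 : ∀ s : C ⊗[ℂ] C, leg13 C (leg13 C HD.T₁.toLinearMap) (appendFactor D C C D e (d ⊗ₜ s)) =
      Φ s (HD.T₁ (d ⊗ₜ e)) := by
    intro s
    induction s with
    | zero =>
      have : Φ 0 = 0 := TensorProduct.ext' fun a b => by simp [hΦ]
      simp [this]
    | add p q hp hq =>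
      have : Φ (p + q) = Φ p + Φ q :=
        TensorProduct.ext' fun a b => by simp [hΦ, TensorProduct.tmul_add]
      simp only [map_add, TensorProduct.tmul_add, hp, hq, this, LinearMap.add_apply]
    | tmul a b =>
    rw [appendFactor_tmul, leg13_tmul, leg13_tmul, LinearEquiv.coe_coe]
    generalize HD.T₁ (d ⊗ₜ e) = z
    induction z with
    | zero => simp
    | add p q hp hq => simp only [map_add, TensorProduct.tmul_add, hp, hq]
    | tmul p q => simp [hΦ]
  have h2 : ∀ t : C ⊗[ℂ] (D ⊗[ℂ] D), leg23 C (leg13 C HD.T₁.toLinearMap)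
      (((TensorProduct.mk ℂ C D c').lTensor D).lTensor C t) =
      ((TensorProduct.mk ℂ C D c').lTensor D).lTensor C (leg23 C HD.T₁.toLinearMap t) := by
    intro t
    induction t using tensor_induction_three with
    | zero => simp
    | add p q hp hq => simp only [map_add, hp, hq]
    | tmul x a b =>
    simp only [LinearMap.lTensor_tmul, TensorProduct.mk_apply, leg23_tmul, leg13_tmul]
    generalize HD.T₁.toLinearMap (a ⊗ₜ b) = z
    induction z with
    | zero => simp
    | add p q hp hq => simp only [map_add, TensorProduct.tmul_add, hp, hq]
    | tmul p q => simp
  have h3 : leg23 C (leg13 C HD.T₁.toLinearMap) (leg12 _ α.twist (d ⊗ₜ (c ⊗ₜ (c' ⊗ₜ e)))) =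
      leg12 _ α.twist (Φ (c ⊗ₜ c') (HD.T₁ (d ⊗ₜ e))) := by
    have h4 : d ⊗ₜ[ℂ] (c ⊗ₜ[ℂ] (c' ⊗ₜ[ℂ] e)) =
      ((TensorProduct.mk ℂ C D c').lTensor C).lTensor D (d ⊗ₜ (c ⊗ₜ e)) := by simp
    rw [h4, leg12_third, h2, ← α.leg12_twist_leg13_T₁, ← leg12_third, leg13_tmul,
      LinearEquiv.coe_coe]
    congr 1
    generalize HD.T₁ (d ⊗ₜ e) = z
    induction z with
    | zero => simp
    | add p q hp hq => simp only [map_add, TensorProduct.tmul_add, hp, hq]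
    | tmul p q => simp [hΦ]
  rw [← appendFactor_tmul, coproductC, leg23_appendFactor, leg23_tmul, coproductD, leg13_comp, h1,
    leg23_comp, appendFactor_tmul, h3]
  generalize HD.T₁ (d ⊗ₜ e) = z
  induction z with
  | zero => simp
  | add p q hp hq => simp only [map_add, hp, hq]
  | tmul p q =>
  rw [hΦ, hΦ, leg13_appendFactor, leg12_appendFactor, leg12_appendFactor, leg23_appendFactor,
    leg13_appendFactor, ← h.leg12_twist_leg13_mapP, leg23_tmul]

/-- For b = cd' the product db is R(d ⊗ c)d'. The commutation rule moves Δ(d) past Δ(c), and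
`coproductD_mul` absorbs d'. -/
theorem Compatible.smashT₁_lmulD (d : D) (b y : C ⊗[ℂ] D) : smashT₁ α β (α.lmulD d b ⊗ₜ y) =
    legAct α.lmulD (coproductD α β) d (smashT₁ α β (b ⊗ₜ y)) := by
  induction b with
  | zero => simp
  | add p q hp hq => simp only [map_add, TensorProduct.add_tmul, hp, hq]
  | tmul c d' =>
  let ρ : C ⊗[ℂ] D →ₗ[ℂ] D →ₗ[ℂ] C ⊗[ℂ] D :=
    (LinearMap.lTensorHom C ∘ₗ (LinearMap.mul ℂ D).flip).flip
  have h1 : ∀ w : C ⊗[ℂ] D, smashT₁ α β (((LinearMap.mul ℂ D).flip d').lTensor C w ⊗ₜ y) =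
      legAct ρ (smashT₁ α β) w (coproductD α β (d' ⊗ₜ y)) := by
    intro w
    induction w with
    | zero => simp
    | add p q hp hq => simp only [map_add, TensorProduct.add_tmul, LinearMap.add_apply, hp, hq]
    | tmul c d =>
    rw [LinearMap.lTensor_tmul, LinearMap.flip_apply, LinearMap.mul_apply', smashT₁,
      LinearMap.comp_apply, onSnd_tmul, h.coproductD_mul]
    generalize coproductD α β (d' ⊗ₜ y) = z
    induction z with
    | zero => simp
    | add p q hp hq => simp only [map_add, hp, hq]
    | tmul p y =>
    rw [legAct_tmul, legAct_tmul, LinearMap.comp_apply, onSnd_tmul]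
    generalize coproductD α β (d ⊗ₜ y) = z
    induction z with
    | zero => simp
    | add p q hp hq => simp only [map_add, hp, hq]
    | tmul q y =>
    simp only [LinearMap.rTensor_tmul, TensorProduct.mk_apply, onFst_tmul]
    rw [← LinearMap.rTensor_comp_apply]
    congr 2
  have h2 : ∀ z : D ⊗[ℂ] (C ⊗[ℂ] D), legAct ρ (smashT₁ α β) (α.twist (d ⊗ₜ c)) z =
      legAct α.lmulD (coproductD α β) d (onFst D (coproductC HC D)
        ((TensorProduct.mk ℂ C D c).rTensor _ z)) := by
    intro z
    induction z with
    | zero => simp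
    | add p q hp hq => simp only [map_add, hp, hq]
    | tmul p y =>
    have h3 := h.leg12_twist_leg13_coproductD (d ⊗ₜ (c ⊗ₜ y))
    rw [leg12_tmul, leg23_tmul] at h3
    have h4 : smashT₁ α β (α.twist (d ⊗ₜ c) ⊗ₜ y) = (TensorProduct.assoc ℂ C D _).symm
        (leg12 _ α.twist (leg13 C (coproductD α β) (d ⊗ₜ coproductC HC D (c ⊗ₜ y)))) := by
      rw [h3]
      simp [smashT₁, onFst, onSnd]
    rw [legAct_tmul, h4, LinearMap.rTensor_tmul, TensorProduct.mk_apply, onFst_tmul]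
    generalize coproductC HC D (c ⊗ₜ y) = z
    induction z with
    | zero => simp
    | add p q hp hq => simp only [map_add, TensorProduct.tmul_add, hp, hq]
    | tmul u y =>
    rw [leg13_tmul, LinearMap.rTensor_tmul, legAct_tmul]
    generalize coproductD α β (d ⊗ₜ y) = z
    induction z with
    | zero => simp
    | add p q hp hq => simp only [map_add, TensorProduct.tmul_add, hp, hq]
    | tmul q y => simp [leg12_tmul, α.lmulD_tmul_eq_twist, ρ]
  rw [α.lmulD_tmul_eq_twist, h1, h2, smashT₁, LinearMap.comp_apply, onSnd_tmul]

theorem Compatible.smashT₁_mul (a b y : C ⊗[ℂ] D) : smashT₁ α β (α.smashMul a b ⊗ₜ y) =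
    legAct α.smashMul (smashT₁ α β) a (smashT₁ α β (b ⊗ₜ y)) := by
  induction a with
  | zero => simp
  | add p q hp hq => simp only [map_add, LinearMap.add_apply, TensorProduct.add_tmul, hp, hq]
  | tmul c d =>
  rw [legAct_smashT₁, LinearMap.comp_apply, ← h.smashT₁_lmulD, ← smashT₁_lmulC, α.smashMul_tmul,
    lmulC_apply]

end Compatibility

/-! ### Commutation of maps acting on separate factors. -/

section Legs

variable {A A' X X' Y Y' Z W : Type*} [AddCommGroup A] [Module ℂ A] [AddCommGroup A'] [Module ℂ A']
  [AddCommGroup X] [Module ℂ X] [AddCommGroup X'] [Module ℂ X']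
  [AddCommGroup Y] [Module ℂ Y] [AddCommGroup Y'] [Module ℂ Y'] [AddCommGroup Z] [Module ℂ Z]
  [AddCommGroup W] [Module ℂ W]

theorem middle_tmul (f : X ⊗[ℂ] Y →ₗ[ℂ] X' ⊗[ℂ] Y') (a : A) (x : X) (t : Y ⊗[ℂ] W) :
    middle A W f ((a ⊗ₜ x) ⊗ₜ t) = (TensorProduct.mk ℂ A X' a).rTensor _ (leg12 W f (x ⊗ₜ t)) := by
  change (TensorProduct.assoc ℂ A X' _).symm (a ⊗ₜ leg12 W f (x ⊗ₜ t)) = _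
  generalize leg12 W f (x ⊗ₜ t) = z
  induction z with
  | zero => simp
  | add p q hp hq => simp only [map_add, TensorProduct.tmul_add, hp, hq]
  | tmul r q => simp

theorem onSnd_comp_lTensor {f : X ⊗[ℂ] Y →ₗ[ℂ] X ⊗[ℂ] Y'} {W' : Type*} [AddCommGroup W']
    [Module ℂ W'] {f₁ : X ⊗[ℂ] W →ₗ[ℂ] X ⊗[ℂ] W'} {g : Y →ₗ[ℂ] W} {g' : Y' →ₗ[ℂ] W'}
    (h : f₁ ∘ₗ g.lTensor X = g'.lTensor X ∘ₗ f) :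
    onSnd A f₁ ∘ₗ g.lTensor _ = g'.lTensor _ ∘ₗ onSnd A f := by
  refine TensorProduct.ext_threefold fun a x y => ?_
  have h1 := LinearMap.congr_fun h (x ⊗ₜ y)
  simp only [LinearMap.comp_apply, LinearMap.lTensor_tmul] at h1 ⊢
  rw [onSnd_tmul, onSnd_tmul, h1, lTensor_rTensor_comm]

theorem leg12_onSnd (f : X ⊗[ℂ] Y →ₗ[ℂ] X ⊗[ℂ] Y') (a : A) (x : X) (t : Y ⊗[ℂ] W) :
    leg12 W (onSnd A f) ((a ⊗ₜ x) ⊗ₜ t) =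
      (TensorProduct.mk ℂ A X a).rTensor _ (leg12 W f (x ⊗ₜ t)) := by
  have h : onSnd A f ∘ₗ (TensorProduct.mk ℂ A X a).rTensor Y =
      (TensorProduct.mk ℂ A X a).rTensor Y' ∘ₗ f :=
    TensorProduct.ext' fun x y => by simp [onSnd_tmul]
  rw [← leg12_post_fst, ← h, ← leg12_pre_fst]
  simp

/-- Maps acting on disjoint factors commute. -/
theorem leg12_leg12_leg23_onSnd (q : A ⊗[ℂ] X →ₗ[ℂ] A' ⊗[ℂ] X) (f : Z ⊗[ℂ] Y →ₗ[ℂ] Z ⊗[ℂ] Y') (t) :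
    leg12 Y' (leg12 Z q) (leg23 A (onSnd X f) t) = leg23 A' (onSnd X f) (leg12 Y (leg12 Z q) t) := by
  induction t using tensor_induction_three with
  | zero => simp
  | add p q hp hq => simp only [map_add, hp, hq]
  | tmul a s y =>
  induction s with
  | zero => simp
  | add p q hp hq => simp only [map_add, TensorProduct.add_tmul, TensorProduct.tmul_add, hp, hq]
  | tmul x z =>
  have h : ∀ s : A' ⊗[ℂ] X, leg23 A' (onSnd X f) (TensorProduct.assoc ℂ _ _ _
      (TensorProduct.assoc ℂ _ _ _ (s ⊗ₜ z) ⊗ₜ y)) = TensorProduct.assoc ℂ _ _ _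
        (((TensorProduct.assoc ℂ A' X Z).toLinearMap ∘ₗ TensorProduct.mk ℂ _ Z s).rTensor Y'
          (f (z ⊗ₜ y))) := by
    intro s
    induction s with
    | zero => simp
    | add p q hp hq => simp only [map_add, TensorProduct.add_tmul, hp, hq, LinearMap.rTensor_add,
        LinearMap.comp_add, LinearMap.add_apply]
    | tmul r q =>
    simp only [TensorProduct.assoc_tmul, leg23_tmul, onSnd_tmul]
    generalize f (z ⊗ₜ y) = s
    induction s with
    | zero => simp
    | add p q hp hq => simp only [map_add, TensorProduct.tmul_add, hp, hq]
    | tmul x y => simp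
  rw [leg12_tmul, leg12_tmul, h, leg23_tmul, onSnd_tmul]
  generalize f (z ⊗ₜ y) = s
  induction s with
  | zero => simp
  | add p q hp hq => simp only [map_add, TensorProduct.tmul_add, hp, hq]
  | tmul x y => simp [leg12_tmul]

/-- The commutation hypothesis is unaffected by inserting an idle factor Z next to X. -/
theorem leg12_leg12_leg23_onFst {q : A ⊗[ℂ] X →ₗ[ℂ] A ⊗[ℂ] X} {f : X ⊗[ℂ] Y →ₗ[ℂ] X ⊗[ℂ] Y}
    (h : ∀ t, leg12 Y q (leg23 A f t) = leg23 A f (leg12 Y q t)) (t) :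
    leg12 Y (leg12 Z q) (leg23 A (onFst Z f) t) = leg23 A (onFst Z f) (leg12 Y (leg12 Z q) t) := by
  induction t using tensor_induction_three with
  | zero => simp
  | add p q hp hq => simp only [map_add, hp, hq]
  | tmul a s y =>
  induction s with
  | zero => simp
  | add p q hp hq => simp only [map_add, TensorProduct.add_tmul, TensorProduct.tmul_add, hp, hq]
  | tmul x z =>
  have h1 : leg12 Z q ∘ₗ ((TensorProduct.mk ℂ X Z).flip z).lTensor A =
      ((TensorProduct.mk ℂ X Z).flip z).lTensor A ∘ₗ q := by
    refine TensorProduct.ext' fun a x => ?_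
    simp only [LinearMap.comp_apply, LinearMap.lTensor_tmul, LinearMap.flip_apply,
      TensorProduct.mk_apply, leg12_tmul]
    generalize q (a ⊗ₜ x) = s
    induction s with
    | zero => simp
    | add p q hp hq => simp only [map_add, TensorProduct.add_tmul, hp, hq]
    | tmul x y => simp
  have h2 : ∀ w, leg12 Y (leg12 Z q) ((((TensorProduct.mk ℂ X Z).flip z).rTensor Y).lTensor A w) =
      (((TensorProduct.mk ℂ X Z).flip z).rTensor Y).lTensor A (leg12 Y q w) := by
    intro w
    rw [leg12_pre_snd, h1, leg12_post_snd]
  have h3 : ∀ w, leg23 A (onFst Z f) ((((TensorProduct.mk ℂ X Z).flip z).rTensor Y).lTensor A w) =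
      (((TensorProduct.mk ℂ X Z).flip z).rTensor Y).lTensor A (leg23 A f w) := by
    intro w
    simp only [leg23, ← LinearMap.lTensor_comp_apply]
    congr 2
    refine TensorProduct.ext' fun x y => ?_
    simp [onFst_tmul]
  have h4 : a ⊗ₜ[ℂ] ((x ⊗ₜ[ℂ] z) ⊗ₜ[ℂ] y) =
    (((TensorProduct.mk ℂ X Z).flip z).rTensor Y).lTensor A (a ⊗ₜ (x ⊗ₜ y)) := by simp
  rw [h4, h2, h3, h3, h2, h]

end Legs

/-! ### The map T₂ of the smash product and coassociativity. -/

section Compatibility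

variable {C D : Type*} [NonUnitalRing C] [Module ℂ C] [IsScalarTower ℂ C C] [SMulCommClass ℂ C C]
  [NonUnitalRing D] [Module ℂ D] [IsScalarTower ℂ D D] [SMulCommClass ℂ D D]
  {HC : RegularMultiplierHopfAlgebra (LinearMap.mul ℂ C)}
  {HD : RegularMultiplierHopfAlgebra (LinearMap.mul ℂ D)}

namespace RightComoduleCoalgebra

variable (β : RightComoduleCoalgebra HC HD)

/-- `d' ⊗ c ⊗ d ↦ ∑ (d' ⊗ 1 ⊗ 1)(T ⊗ ι)(c ⊗ Δ(d))` -/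
def coproductLeft : D ⊗[ℂ] (C ⊗[ℂ] D) ≃ₗ[ℂ] D ⊗[ℂ] (C ⊗[ℂ] D) :=
  (LinearEquiv.ofBijective _ (leg23_bijective (W := D) β.cotwist_bijective)).trans
    ((LinearEquiv.ofBijective _ (leg12_bijective (W := C) (f := HD.T₂.toLinearMap)
      HD.T₂.bijective)).trans
    (LinearEquiv.ofBijective _ (leg23_bijective (W := D) β.cotwist_bijective)).symm)

theorem leg23_coproductLeft (t : D ⊗[ℂ] (C ⊗[ℂ] D)) : leg23 D (cotwist β.Γ) (β.coproductLeft t) =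
    leg12 C HD.T₂.toLinearMap (leg23 D (cotwist β.Γ) t) :=
  (LinearEquiv.ofBijective _ (leg23_bijective (W := D) β.cotwist_bijective)).apply_symm_apply _

/-- The element supplied by `comul_left` is pinned down by injectivity of T in the last two legs.
Thus conjugating the T₂ of D by T really computes (d' ⊗ 1 ⊗ 1)(T ⊗ ι)(c ⊗ Δ(d)). -/
theorem coproductLeft_cover (c : C) (d d' e : D) :
    (((LinearMap.mul ℂ D).flip e).lTensor C).lTensor D (β.coproductLeft (d' ⊗ₜ (c ⊗ₜ d))) =
      (LinearMap.mul ℂ D d').rTensor _ (leg12 D (cotwist β.Γ) (c ⊗ₜ HD.T₁ (d ⊗ₜ e))) := by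
  obtain ⟨w, hw, hw'⟩ := β.comul_left c d d'
  have h : w = β.coproductLeft (d' ⊗ₜ (c ⊗ₜ d)) := by
    apply (leg23_bijective (W := D) β.cotwist_bijective).injective
    rw [leg23_coproductLeft, hw', leg23_tmul]
    generalize cotwist β.Γ (c ⊗ₜ d) = z
    induction z with
    | zero => simp
    | add p q hp hq => simp only [map_add, TensorProduct.tmul_add, hp, hq]
    | tmul x y => simp [leg12_tmul]
  rw [← h]
  exact hw e

/-- `β.coproductLeft` commutes with `d ⊗ e ↦ Δ(d)(1 ⊗ e)` applied to its last factor. -/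
theorem coproductLeft_comm_T₁ (t : D ⊗[ℂ] ((C ⊗[ℂ] D) ⊗[ℂ] D)) :
    leg12 D β.coproductLeft.toLinearMap (leg23 D (onSnd C HD.T₁.toLinearMap) t) =
      leg23 D (onSnd C HD.T₁.toLinearMap) (leg12 D β.coproductLeft.toLinearMap t) := by
  induction t using tensor_induction_three with
  | zero => simp
  | add p q hp hq => simp only [map_add, hp, hq]
  | tmul d' x e =>
  induction x with
  | zero => simp
  | add p q hp hq => simp only [map_add, TensorProduct.add_tmul, TensorProduct.tmul_add, hp, hq]
  | tmul c d =>
  -- Ξ is x ↦ (d' ⊗ 1 ⊗ 1 ⊗ 1)(T ⊗ ι ⊗ ι)(c ⊗ x).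
  let Ξ : D ⊗[ℂ] (D ⊗[ℂ] D) →ₗ[ℂ] D ⊗[ℂ] ((C ⊗[ℂ] D) ⊗[ℂ] D) :=
    (LinearMap.mul ℂ D d').rTensor _ ∘ₗ (TensorProduct.assoc ℂ C D D).symm.toLinearMap.lTensor D ∘ₗ
      leg12 (D ⊗[ℂ] D) (cotwist β.Γ) ∘ₗ TensorProduct.mk ℂ C _ c
  have hΞ : ∀ z e, Ξ (TensorProduct.assoc ℂ D D D (z ⊗ₜ e)) = TensorProduct.assoc ℂ D _ D
      ((LinearMap.mul ℂ D d').rTensor _ (leg12 D (cotwist β.Γ) (c ⊗ₜ z)) ⊗ₜ e) := by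
    intro z e
    induction z with
    | zero => simp
    | add p q hp hq => simp only [map_add, TensorProduct.add_tmul, TensorProduct.tmul_add, hp, hq]
    | tmul p q =>
    simp only [Ξ, LinearMap.comp_apply, TensorProduct.assoc_tmul, TensorProduct.mk_apply,
      leg12_tmul]
    generalize cotwist β.Γ (c ⊗ₜ p) = z
    induction z with
    | zero => simp
    | add p q hp hq => simp only [map_add, TensorProduct.add_tmul, hp, hq]
    | tmul x y => simp
  have hΞ' : ∀ t, leg23 D (onSnd C HD.T₁.toLinearMap) (Ξ t) = Ξ (leg23 D HD.T₁.toLinearMap t) := by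
    intro t
    have h1 : c ⊗ₜ leg23 D HD.T₁.toLinearMap t =
      (HD.T₁.toLinearMap.lTensor D).lTensor C (c ⊗ₜ t) := rfl
    simp only [Ξ, LinearMap.comp_apply, TensorProduct.mk_apply]
    rw [← leg23_rTensor, h1, leg12_third, leg23, ← LinearMap.lTensor_comp_apply,
      ← LinearMap.lTensor_comp_apply]
    congr 3
    refine LinearMap.ext fun x => ?_
    simp [onSnd, leg23]
  -- B w s applies Δ_D to the last leg of w and multiplies it into s.
  let B (w : D ⊗[ℂ] (C ⊗[ℂ] D)) (s : D ⊗[ℂ] D) : D ⊗[ℂ] ((C ⊗[ℂ] D) ⊗[ℂ] D) :=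
    ((TensorProduct.assoc ℂ C D D).symm.toLinearMap ∘ₗ
      ((legAct (LinearMap.mul ℂ D) HD.T₁.toLinearMap).flip s).lTensor C).lTensor D w
  have hB_add : ∀ w s s', B w (s + s') = B w s + B w s' := by
    intro w s s'
    simp only [B, map_add, LinearMap.lTensor_add, LinearMap.comp_add, LinearMap.add_apply]
  have hB_zero : ∀ w, B w 0 = 0 := by
    intro w
    simp [B]
  have hB : ∀ w f e, ((((LinearMap.mul ℂ D).flip f).lTensor C).rTensor D).lTensor D
      (leg23 D (onSnd C HD.T₁.toLinearMap) (TensorProduct.assoc ℂ D _ D (w ⊗ₜ e))) =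
        B w (f ⊗ₜ e) := by
    intro w f e
    induction w using tensor_induction_three with
    | zero => simp [B]
    | add p q hp hq => simp only [map_add, TensorProduct.add_tmul, hp, hq, B]
    | tmul r c a =>
    simp only [B, TensorProduct.assoc_tmul, leg23_tmul, onSnd_tmul, LinearMap.lTensor_tmul,
      LinearMap.comp_apply, LinearMap.flip_apply, legAct_tmul]
    generalize HD.T₁.toLinearMap (a ⊗ₜ e) = z
    induction z with
    | zero => simp
    | add p q hp hq => simp only [map_add, TensorProduct.tmul_add, hp, hq]
    | tmul x y => simp
  have hB' : ∀ w f e, B w (HD.T₁ (f ⊗ₜ e)) = leg23 D (onSnd C HD.T₁.toLinearMap)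
      (TensorProduct.assoc ℂ D _ D
        ((((LinearMap.mul ℂ D).flip f).lTensor C).lTensor D w ⊗ₜ e)) := by
    intro w f e
    induction w using tensor_induction_three with
    | zero => simp [B]
    | add p q hp hq =>
      rw [map_add, TensorProduct.add_tmul, map_add, map_add, ← hp, ← hq]
      simp only [B, map_add]
    | tmul r c a =>
    have h1 := HD.canonicalMaps.T₁_mul a f e
    rw [LinearMap.mul_apply'] at h1
    simp only [B, TensorProduct.assoc_tmul, leg23_tmul, onSnd_tmul, LinearMap.lTensor_tmul,
      LinearMap.comp_apply, LinearMap.flip_apply, LinearMap.mul_apply', LinearEquiv.coe_coe, h1]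
    generalize legAct (LinearMap.mul ℂ D) HD.T₁.toLinearMap a (HD.T₁ (f ⊗ₜ e)) = z
    induction z with
    | zero => simp
    | add p q hp hq => simp only [map_add, TensorProduct.tmul_add, hp, hq]
    | tmul x y => simp
  -- Both sides express (ι ⊗ ι ⊗ Δ) of the covered coproduct applied to s. For s = T₁(f ⊗ e) the
  -- pentagon identity identifies them, and T₁ is onto.
  have key : ∀ s : D ⊗[ℂ] D, Ξ (leg12 D HD.T₁.toLinearMap (leg13 D HD.T₁.toLinearMap
      (d ⊗ₜ s))) = B (β.coproductLeft (d' ⊗ₜ (c ⊗ₜ d))) s := by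
    intro s
    obtain ⟨s, rfl⟩ := HD.T₁.surjective s
    induction s with
    | zero => simp [hB_zero]
    | add p q hp hq => simp only [map_add, TensorProduct.tmul_add, hp, hq, hB_add]
    | tmul f e =>
    have h1 := LinearMap.congr_fun HD.pentagon (d ⊗ₜ (f ⊗ₜ e))
    simp only [LinearMap.comp_apply, leg23_tmul, leg12_tmul, LinearEquiv.coe_coe] at h1
    rw [hB', coproductLeft_cover, ← hΞ, ← h1, hΞ']
  refine lTensor_jointly_injective
    (fun f => (((LinearMap.mul ℂ D).flip f).lTensor C).rTensor D) (fun z hz => ?_) fun f => ?_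
  · refine rTensor_jointly_injective (fun f => ((LinearMap.mul ℂ D).flip f).lTensor C)
      (fun z hz => ?_) (fun p => (hz p).trans (map_zero _).symm)
    exact lTensor_jointly_injective (LinearMap.mul ℂ D).flip HD.nondegenerate_left
      (fun p => (hz p).trans (map_zero _).symm)
  rw [leg12_tmul _ d', hB, LinearEquiv.coe_coe, ← key, leg13_tmul, leg23_tmul, onSnd_tmul,
    LinearEquiv.coe_coe]
  generalize HD.T₁ (d ⊗ₜ e) = z
  induction z with
  | zero => simp
  | add p q hp hq => simp only [map_add, TensorProduct.tmul_add, hp, hq]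
  | tmul x y =>
  rw [LinearMap.rTensor_tmul, TensorProduct.mk_apply, leg12_tmul, lTensor_assoc_tmul,
    LinearEquiv.coe_coe, coproductLeft_cover, TensorProduct.leftComm_tmul, leg12_tmul, hΞ,
    LinearEquiv.coe_coe]

/-- Commutation with `coproductLeft` passes along intertwiners of the last leg. It is proved once
for T₁ of D and then transported to `coprodAct` and `coprodActMul`. -/
theorem coproductLeft_comm_of_intertwine {Z Z' Z₁ Z₁' : Type*} [AddCommGroup Z] [Module ℂ Z]
    [AddCommGroup Z'] [Module ℂ Z'] [AddCommGroup Z₁] [Module ℂ Z₁] [AddCommGroup Z₁'] [Module ℂ Z₁']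
    {f : D ⊗[ℂ] Z →ₗ[ℂ] D ⊗[ℂ] Z'}
    (hf : ∀ t, leg12 Z' β.coproductLeft.toLinearMap (leg23 D (onSnd C f) t) =
      leg23 D (onSnd C f) (leg12 Z β.coproductLeft.toLinearMap t))
    {f₁ : D ⊗[ℂ] Z₁ →ₗ[ℂ] D ⊗[ℂ] Z₁'} {g : Z →ₗ[ℂ] Z₁} {g' : Z' →ₗ[ℂ] Z₁'}
    (hg : f₁ ∘ₗ g.lTensor D = g'.lTensor D ∘ₗ f) (d : D) (x : C ⊗[ℂ] D) (z : Z) :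
    leg12 Z₁' β.coproductLeft.toLinearMap (leg23 D (onSnd C f₁) (d ⊗ₜ (x ⊗ₜ g z))) =
      leg23 D (onSnd C f₁) (leg12 Z₁ β.coproductLeft.toLinearMap (d ⊗ₜ (x ⊗ₜ g z))) := by
  have h1 := onSnd_comp_lTensor (A := C) hg
  have h2 : ∀ t : D ⊗[ℂ] ((C ⊗[ℂ] D) ⊗[ℂ] Z), leg23 D (onSnd C f₁) ((g.lTensor _).lTensor D t) =
      (g'.lTensor _).lTensor D (leg23 D (onSnd C f) t) := by
    intro t
    simp only [leg23, ← LinearMap.lTensor_comp_apply, h1]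
  have h3 : d ⊗ₜ[ℂ] (x ⊗ₜ[ℂ] g z) = (g.lTensor _).lTensor D (d ⊗ₜ (x ⊗ₜ z)) := by simp
  rw [h3, h2, leg12_third, hf, leg12_third, h2]

theorem coproductLeft_comm_coprodAct (α : LeftModuleAlgebra HD C) (t : D ⊗[ℂ] ((C ⊗[ℂ] D) ⊗[ℂ] C)) :
    leg12 C β.coproductLeft.toLinearMap (leg23 D (onSnd C α.coprodAct) t) =
      leg23 D (onSnd C α.coprodAct) (leg12 C β.coproductLeft.toLinearMap t) := by
  induction t using tensor_induction_three with
  | zero => simp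
  | add p q hp hq => simp only [map_add, hp, hq]
  | tmul d x c =>
  induction c using α.act_induction with
  | zero => simp
  | add p q hp hq => simp only [map_add, TensorProduct.tmul_add, hp, hq]
  | act e c =>
    exact β.coproductLeft_comm_of_intertwine β.coproductLeft_comm_T₁ (α.coprodAct_comp_act c) d x e

theorem coproductLeft_comm_coprodActMul (α : LeftModuleAlgebra HD C)
    (t : D ⊗[ℂ] ((C ⊗[ℂ] D) ⊗[ℂ] (C ⊗[ℂ] D))) :
    leg12 _ β.coproductLeft.toLinearMap (leg23 D (onSnd C α.coprodActMul) t) =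
      leg23 D (onSnd C α.coprodActMul) (leg12 _ β.coproductLeft.toLinearMap t) := by
  have h1 : ∀ t : D ⊗[ℂ] ((C ⊗[ℂ] D) ⊗[ℂ] (C ⊗[ℂ] D)),
      leg12 _ β.coproductLeft.toLinearMap (leg23 D (onSnd C (leg13 C HD.T₁.toLinearMap)) t) =
        leg23 D (onSnd C (leg13 C HD.T₁.toLinearMap))
          (leg12 _ β.coproductLeft.toLinearMap t) := by
    intro t
    induction t using tensor_induction_three with
    | zero => simp
    | add p q hp hq => simp only [map_add, hp, hq]
    | tmul d x y =>
    induction y with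
    | zero => simp
    | add p q hp hq => simp only [map_add, TensorProduct.tmul_add, hp, hq]
    | tmul c e =>
    refine β.coproductLeft_comm_of_intertwine β.coproductLeft_comm_T₁
      (g := TensorProduct.mk ℂ C D c) (g' := TensorProduct.mk ℂ C D c) ?_ d x e
    refine TensorProduct.ext' fun a b => ?_
    simp only [LinearMap.comp_apply, LinearMap.lTensor_tmul, TensorProduct.mk_apply, leg13_tmul]
    generalize HD.T₁.toLinearMap (a ⊗ₜ b) = z
    induction z with
    | zero => simp
    | add p q hp hq => simp only [map_add, TensorProduct.tmul_add, hp, hq]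
    | tmul x y => simp
  have h2 : ∀ t : D ⊗[ℂ] ((C ⊗[ℂ] D) ⊗[ℂ] (C ⊗[ℂ] D)),
      leg12 _ β.coproductLeft.toLinearMap (leg23 D (onSnd C (leg12 D α.coprodAct)) t) =
        leg23 D (onSnd C (leg12 D α.coprodAct)) (leg12 _ β.coproductLeft.toLinearMap t) := by
    intro t
    induction t using tensor_induction_three with
    | zero => simp
    | add p q hp hq => simp only [map_add, hp, hq]
    | tmul d x y =>
    induction y with
    | zero => simp
    | add p q hp hq => simp only [map_add, TensorProduct.tmul_add, hp, hq]
    | tmul c e =>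
    refine β.coproductLeft_comm_of_intertwine (β.coproductLeft_comm_coprodAct α)
      (g := (TensorProduct.mk ℂ C D).flip e) (g' := (TensorProduct.mk ℂ C D).flip e) ?_ d x c
    refine TensorProduct.ext' fun a b => ?_
    simp only [LinearMap.comp_apply, LinearMap.lTensor_tmul, LinearMap.flip_apply,
      TensorProduct.mk_apply, leg12_tmul]
    generalize α.coprodAct (a ⊗ₜ b) = z
    induction z with
    | zero => simp
    | add p q hp hq => simp only [map_add, TensorProduct.add_tmul, hp, hq]
    | tmul x y => simp
  have h3 : ∀ t : D ⊗[ℂ] ((C ⊗[ℂ] D) ⊗[ℂ] (C ⊗[ℂ] D)), leg23 D (onSnd C α.coprodActMul) t =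
      leg23 D (onSnd C (leg12 D α.coprodAct))
        (leg23 D (onSnd C (leg13 C HD.T₁.toLinearMap)) t) := by
    intro t
    simp only [leg23, ← LinearMap.lTensor_comp_apply]
    congr 2
    refine LinearMap.ext fun x => ?_
    simp [onSnd, LeftModuleAlgebra.coprodActMul, leg23_comp]
  rw [h3, h3, h2, h1]

/-- `(T ⊗ ι)(ι ⊗ Δ)(c ⊗ d ⊗ a)` in terms of `Γ`. -/
theorem rTensor_cotwist_onFst (s : (C ⊗[ℂ] D) ⊗[ℂ] (C ⊗[ℂ] D)) :
    (cotwist β.Γ).rTensor _ (onFst D (coproductC HC D) (onSnd C (leg12 D β.coactMul) s)) =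
      onSnd D (coproductC HC D) ((cotwist β.Γ).rTensor _ s) := by
  obtain ⟨s, rfl⟩ := (TensorProduct.assoc ℂ C D (C ⊗[ℂ] D)).symm.surjective s
  have h1 : ∀ t : C ⊗[ℂ] (D ⊗[ℂ] (C ⊗[ℂ] D)),
      (cotwist β.Γ).rTensor _ ((TensorProduct.assoc ℂ C D (C ⊗[ℂ] D)).symm t) =
        (TensorProduct.assoc ℂ D C (C ⊗[ℂ] D)).symm (leg12 _ (cotwist β.Γ) t) := by
    intro t
    simp [leg12]
  simp only [onFst, onSnd, LinearMap.comp_apply, LinearEquiv.coe_coe, LinearEquiv.apply_symm_apply,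
    h1]
  congr 1
  induction s using tensor_induction_three with
  | zero => simp
  | add p q hp hq => simp only [map_add, hp, hq]
  | tmul c d y =>
  induction y with
  | zero => simp
  | add p q hp hq => simp only [map_add, TensorProduct.tmul_add, hp, hq]
  | tmul a e =>
  rw [← appendFactor_tmul, leg23_appendFactor, coproductC, leg13_appendFactor, leg12_appendFactor,
    leg12_appendFactor, leg23_appendFactor, β.leg12_cotwist_leg13_T₁]

/-- T on the middle leg turns `coproductLeft` into T₂ of D on two D-factors. It turns the part of
`smashT₁` left after `coprodActMul` into T₁ of C on other factors, so the two commute. -/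
theorem coproductLeft_comm_smashT₁ (α : LeftModuleAlgebra HD C)
    (t : D ⊗[ℂ] ((C ⊗[ℂ] D) ⊗[ℂ] (C ⊗[ℂ] D))) :
    leg12 _ β.coproductLeft.toLinearMap (leg23 D (smashT₁ α β) t) =
      leg23 D (smashT₁ α β) (leg12 _ β.coproductLeft.toLinearMap t) := by
  set F : (C ⊗[ℂ] D) ⊗[ℂ] (C ⊗[ℂ] D) →ₗ[ℂ] (C ⊗[ℂ] D) ⊗[ℂ] (C ⊗[ℂ] D) :=
    onFst D (coproductC HC D) ∘ₗ onSnd C (leg12 D β.coactMul) with hF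
  have h1 : ∀ t, leg23 D (smashT₁ α β) t = F.lTensor D (leg23 D (onSnd C α.coprodActMul) t) := by
    intro t
    simp only [leg23, ← LinearMap.lTensor_comp_apply, smashT₁, coproductD_eq, hF]
    congr 2
    refine LinearMap.ext fun x => ?_
    simp [onSnd, leg23_comp]
  have hT : Function.Injective ((((cotwist β.Γ).rTensor (C ⊗[ℂ] D))).lTensor D) :=
    (((LinearEquiv.ofBijective _ β.cotwist_bijective).rTensor (C ⊗[ℂ] D)).lTensor D).injective
  have h2 : ∀ t, ((cotwist β.Γ).rTensor (C ⊗[ℂ] D)).lTensor D (F.lTensor D t) =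
      leg23 D (onSnd D (coproductC HC D)) (((cotwist β.Γ).rTensor (C ⊗[ℂ] D)).lTensor D t) := by
    intro t
    simp only [leg23, ← LinearMap.lTensor_comp_apply]
    congr 2
    exact LinearMap.ext fun s => β.rTensor_cotwist_onFst s
  have h3 : ∀ t : D ⊗[ℂ] ((C ⊗[ℂ] D) ⊗[ℂ] (C ⊗[ℂ] D)), ((cotwist β.Γ).rTensor _).lTensor D
      (leg12 _ β.coproductLeft.toLinearMap t) =
      leg12 _ (leg12 C HD.T₂.toLinearMap) (((cotwist β.Γ).rTensor _).lTensor D t) := by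
    intro t
    rw [← leg12_post_snd, leg12_pre_snd]
    congr 2
    exact LinearMap.ext fun s => β.leg23_coproductLeft s
  have h4 : ∀ t, leg12 _ β.coproductLeft.toLinearMap (F.lTensor D t) =
      F.lTensor D (leg12 _ β.coproductLeft.toLinearMap t) := by
    intro t
    apply hT
    rw [h3, h2, h2, h3, leg12_leg12_leg23_onSnd]
  rw [h1, h4, coproductLeft_comm_coprodActMul, h1]

end RightComoduleCoalgebra

namespace LeftModuleAlgebra

variable (HC) (α : LeftModuleAlgebra HD C)

/-- `a ⊗ c ↦ (a ⊗ 1)Δ(c)` for `c ∈ C` and `a` in the smash product. -/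
def coproductCLeft : (C ⊗[ℂ] D) ⊗[ℂ] C ≃ₗ[ℂ] (C ⊗[ℂ] D) ⊗[ℂ] C :=
  ((LinearEquiv.ofBijective _ α.twist_bijective).rTensor C).symm.trans
    (((TensorProduct.assoc ℂ D C C).trans ((HC.T₂.lTensor D).trans
      (TensorProduct.assoc ℂ D C C).symm)).trans
    ((LinearEquiv.ofBijective _ α.twist_bijective).rTensor C))

theorem coproductCLeft_twist (d : D) (c c' : C) :
    α.coproductCLeft HC (α.twist (d ⊗ₜ c) ⊗ₜ c') =
      (α.twist ∘ₗ TensorProduct.mk ℂ D C d).rTensor C (HC.T₂ (c ⊗ₜ c')) := by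
  have h : α.twist (d ⊗ₜ c) ⊗ₜ[ℂ] c' = (LinearEquiv.ofBijective _ α.twist_bijective).rTensor C
    ((d ⊗ₜ c) ⊗ₜ c') := by simp
  rw [h]
  simp only [coproductCLeft, LinearEquiv.trans_apply, LinearEquiv.symm_apply_apply,
    TensorProduct.assoc_tmul, LinearEquiv.lTensor_tmul]
  generalize HC.T₂ (c ⊗ₜ c') = z
  induction z with
  | zero => simp
  | add p q hp hq => simp only [map_add, TensorProduct.tmul_add, hp, hq]
  | tmul x y => simp

/-- Writing elements of CD as dc leaves D as a spectator, and the claim is coassociativity of C. -/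
theorem coproductCLeft_comm (t : (C ⊗[ℂ] D) ⊗[ℂ] (C ⊗[ℂ] (C ⊗[ℂ] D))) :
    leg12 _ (α.coproductCLeft HC).toLinearMap (leg23 _ (coproductC HC D) t) =
      leg23 _ (coproductC HC D) (leg12 _ (α.coproductCLeft HC).toLinearMap t) := by
  induction t using tensor_induction_three with
  | zero => simp
  | add p q hp hq => simp only [map_add, hp, hq]
  | tmul a c y =>
  obtain ⟨a, rfl⟩ := α.twist_surjective a
  induction a with
  | zero => simp
  | add p q hp hq => simp only [map_add, TensorProduct.add_tmul, hp, hq]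
  | tmul d b =>
  induction y with
  | zero => simp
  | add p q hp hq => simp only [map_add, TensorProduct.tmul_add, hp, hq]
  | tmul c' e =>
  set ψ : C ⊗[ℂ] (C ⊗[ℂ] C) →ₗ[ℂ] (C ⊗[ℂ] D) ⊗[ℂ] (C ⊗[ℂ] (C ⊗[ℂ] D)) :=
    (α.twist ∘ₗ TensorProduct.mk ℂ D C d).rTensor _ ∘ₗ appendFactor C C C D e with hψ
  have h1 : ∀ w, leg23 _ (coproductC HC D) (ψ w) = ψ (leg23 C HC.T₁.toLinearMap w) := by
    intro w
    rw [hψ, LinearMap.comp_apply, LinearMap.comp_apply, ← leg23_rTensor, coproductC,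
      leg23_appendFactor]
  have h2 : ∀ w, leg12 _ (α.coproductCLeft HC).toLinearMap (ψ w) =
      ψ (leg12 C HC.T₂.toLinearMap w) := by
    intro w
    induction w using tensor_induction_three with
    | zero => simp
    | add p q hp hq => simp only [map_add, hp, hq]
    | tmul x y z =>
    rw [hψ, LinearMap.comp_apply, LinearMap.comp_apply, appendFactor_tmul, LinearMap.rTensor_tmul,
      leg12_tmul, LinearMap.comp_apply, TensorProduct.mk_apply, LinearEquiv.coe_coe,
      coproductCLeft_twist, leg12_tmul, LinearEquiv.coe_coe]
    generalize HC.T₂ (x ⊗ₜ y) = z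
    induction z with
    | zero => simp
    | add p q hp hq => simp only [map_add, TensorProduct.add_tmul, hp, hq]
    | tmul x y => simp
  have h3 : α.twist (d ⊗ₜ b) ⊗ₜ[ℂ] (c ⊗ₜ[ℂ] (c' ⊗ₜ[ℂ] e)) = ψ (b ⊗ₜ (c ⊗ₜ c')) := rfl
  rw [h3, h1, h2, h2, h1, leg12_tmul]
  congr 1
  exact HC.coassoc b c c'

end LeftModuleAlgebra

variable (α : LeftModuleAlgebra HD C) (β : RightComoduleCoalgebra HC HD)

/-- `a ⊗ b ↦ (a ⊗ 1)Δ(b)` for the smash product. -/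
def smashT₂ : (C ⊗[ℂ] D) ⊗[ℂ] (C ⊗[ℂ] D) →ₗ[ℂ] (C ⊗[ℂ] D) ⊗[ℂ] (C ⊗[ℂ] D) :=
  onSnd C β.coproductLeft.toLinearMap ∘ₗ leg12 D (α.coproductCLeft HC).toLinearMap

theorem smashT₂_bijective : Function.Bijective (smashT₂ α β) :=
  (onSnd_bijective β.coproductLeft.bijective).comp
    (leg12_bijective (f := (α.coproductCLeft HC).toLinearMap) (α.coproductCLeft HC).bijective)

/-- Each of the two factors of `smashT₂` commutes with `smashT₁` on its own. -/
theorem leg12_smashT₂_leg23_smashT₁ (t : (C ⊗[ℂ] D) ⊗[ℂ] ((C ⊗[ℂ] D) ⊗[ℂ] (C ⊗[ℂ] D))) :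
    leg12 _ (smashT₂ α β) (leg23 _ (smashT₁ α β) t) =
      leg23 _ (smashT₁ α β) (leg12 _ (smashT₂ α β) t) := by
  have h1 : ∀ t, leg12 (C ⊗[ℂ] D) (leg12 D (α.coproductCLeft HC).toLinearMap)
      (leg23 _ (smashT₁ α β) t) =
      leg23 _ (smashT₁ α β) (leg12 _ (leg12 D (α.coproductCLeft HC).toLinearMap) t) := by
    intro t
    rw [smashT₁, leg23_comp, leg12_leg12_leg23_onFst (α.coproductCLeft_comm HC),
      leg12_leg12_leg23_onSnd, leg23_comp]
  have h2 : ∀ t, leg12 (C ⊗[ℂ] D) (onSnd C β.coproductLeft.toLinearMap)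
      (leg23 _ (smashT₁ α β) t) =
      leg23 _ (smashT₁ α β) (leg12 _ (onSnd C β.coproductLeft.toLinearMap) t) := by
    intro t
    induction t using TensorProduct.induction_on with
    | zero => simp
    | add p q hp hq => simp only [map_add, hp, hq]
    | tmul a s =>
    induction a with
    | zero => simp
    | add p q hp hq => simp only [map_add, TensorProduct.add_tmul, hp, hq]
    | tmul c d =>
    have h3 := β.coproductLeft_comm_smashT₁ α (d ⊗ₜ s)
    rw [leg23_tmul] at h3
    rw [leg23_tmul, leg12_onSnd, leg12_onSnd, h3, leg23_rTensor]
  rw [smashT₂, leg12_comp, leg12_comp, h1, h2]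

include HC in
-- With a = d₀c₀ and y replaced by d'y, both sides are the covered formula of `smashT₁_cover`,
-- multiplied on the left by d₀.
theorem smashT₁_mul_eq (a b y : C ⊗[ℂ] D) :
    (α.smashMul a).rTensor _ (smashT₁ α β (b ⊗ₜ y)) =
      (α.smashMul.flip y).lTensor _ (smashT₂ α β (a ⊗ₜ b)) := by
  obtain ⟨a, rfl⟩ := α.twist_surjective a
  obtain ⟨y, rfl⟩ := α.lift_lmulD_surjective HC y
  induction y with
  | zero => simp
  | add p q hp hq => simp only [map_add, TensorProduct.tmul_add, hp, hq, LinearMap.lTensor_add,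
      LinearMap.add_apply]
  | tmul d' y =>
  induction b with
  | zero => simp
  | add p q hp hq => simp only [map_add, TensorProduct.add_tmul, TensorProduct.tmul_add, hp, hq]
  | tmul c d =>
  induction a with
  | zero => simp
  | add p q hp hq => simp only [map_add, TensorProduct.add_tmul, hp, hq, LinearMap.rTensor_add,
      LinearMap.add_apply]
  | tmul d₀ c₀ =>
  have h1 : α.smashMul (α.twist (d₀ ⊗ₜ c₀)) =
      α.lmulD d₀ ∘ₗ (LinearMap.mul ℂ C c₀).rTensor D :=
    LinearMap.ext fun y => α.smashMul_twist d₀ c₀ y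
  have h2 : α.smashMul.flip (α.lmulD d' y) =
      α.smashMul.flip y ∘ₗ ((LinearMap.mul ℂ D).flip d').lTensor C :=
    TensorProduct.ext' fun c d => by simp [α.smashMul_tmul, α.lmulD_mul]
  let ρ : C ⊗[ℂ] D →ₗ[ℂ] D →ₗ[ℂ] C ⊗[ℂ] D :=
    (LinearMap.lTensorHom C ∘ₗ (LinearMap.mul ℂ D).flip).flip
  rw [TensorProduct.lift.tmul, h1, LinearMap.rTensor_comp_apply, smashT₁_cover, h2,
    LinearMap.lTensor_comp_apply, ← lTensor_rTensor_comm, smashT₂, LinearMap.comp_apply, leg12_tmul,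
    LinearEquiv.coe_coe, α.coproductCLeft_twist]
  congr 1
  generalize HC.T₂ (c₀ ⊗ₜ c) = z
  induction z with
  | zero => simp
  | add p q hp hq => simp only [map_add, TensorProduct.add_tmul, hp, hq]
  | tmul u v =>
  have h3 : ∀ z : C ⊗[ℂ] D, (((LinearMap.mul ℂ D).flip d').lTensor C).lTensor _
      (onSnd C β.coproductLeft.toLinearMap (z ⊗ₜ (v ⊗ₜ d))) =
      (ρ z).rTensor _ (leg12 D (cotwist β.Γ) (v ⊗ₜ HD.T₁ (d ⊗ₜ d'))) := by
    intro z
    induction z with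
    | zero => simp
    | add p q hp hq => simp only [map_add, TensorProduct.add_tmul, hp, hq, LinearMap.rTensor_add,
        LinearMap.add_apply]
    | tmul x y =>
    rw [onSnd_tmul, lTensor_rTensor_comm, LinearEquiv.coe_coe, β.coproductLeft_cover,
      ← LinearMap.rTensor_comp_apply]
    congr 2
  have h4 : α.lmulD d₀ ∘ₗ TensorProduct.mk ℂ C D u = ρ (α.twist (d₀ ⊗ₜ u)) :=
    LinearMap.ext fun r => α.lmulD_tmul_eq_twist d₀ u r
  rw [middle_tmul, ← LinearMap.rTensor_comp_apply, h4, ← h3, LinearMap.rTensor_tmul,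
    TensorProduct.assoc_tmul, LinearMap.comp_apply, TensorProduct.mk_apply]

end Compatibility

/-! ### Counit, antipode and uniqueness for the smash coproduct. -/

section Compatibility

variable {C D : Type*} [NonUnitalRing C] [Module ℂ C] [IsScalarTower ℂ C C] [SMulCommClass ℂ C C]
  [NonUnitalRing D] [Module ℂ D] [IsScalarTower ℂ D D] [SMulCommClass ℂ D D]
  {HC : RegularMultiplierHopfAlgebra (LinearMap.mul ℂ C)}
  {HD : RegularMultiplierHopfAlgebra (LinearMap.mul ℂ D)}
  {α : LeftModuleAlgebra HD C} {β : RightComoduleCoalgebra HC HD}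

namespace Compatible

variable (h : Compatible α β)
include h

theorem smashT₁_bijective : Function.Bijective (smashT₁ α β) :=
  (onFst_bijective (leg12_bijective (f := HC.T₁.toLinearMap) HC.T₁.bijective)).comp
    (onSnd_bijective ((leg12_bijective h.mapP_bijective).comp
      (leg13_bijective (f := HD.T₁.toLinearMap) HD.T₁.bijective)))

theorem sliceL_smashT₁ (a y : C ⊗[ℂ] D) :
    sliceL _ (smashCounit HC HD) (smashT₁ α β (a ⊗ₜ y)) = α.smashMul a y := by
  induction a with
  | zero => simp
  | add p q hp hq => simp only [map_add, TensorProduct.add_tmul, LinearMap.add_apply, hp, hq]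
  | tmul c d =>
  have h1 : ∀ c (y : C ⊗[ℂ] D), sliceL _ HC.counit (coproductC HC D (c ⊗ₜ y)) = lmulC C D c y := by
    intro c y
    induction y with
    | zero => simp
    | add p q hp hq => simp only [map_add, TensorProduct.tmul_add, hp, hq]
    | tmul a e =>
    rw [coproductC, leg12_tmul, LinearEquiv.coe_coe, lmulC_apply, LinearMap.rTensor_tmul,
      ← HC.sliceL_T₁]
    generalize HC.T₁ (c ⊗ₜ a) = z
    induction z with
    | zero => simp
    | add p q hp hq => simp only [map_add, TensorProduct.add_tmul, hp, hq]
    | tmul u v => simp [TensorProduct.smul_tmul']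
  have h2 : sliceL _ HD.counit (coproductD α β (d ⊗ₜ y)) = α.lmulD d y := by
    induction y with
    | zero => simp
    | add p q hp hq => simp only [map_add, TensorProduct.tmul_add, hp, hq]
    | tmul a e =>
    rw [coproductD, LinearMap.comp_apply, leg13_tmul, LinearEquiv.coe_coe, α.lmulD_tmul]
    generalize HD.T₁ (d ⊗ₜ e) = z
    induction z with
    | zero => simp
    | add p q hp hq => simp only [map_add, TensorProduct.tmul_add, hp, hq]
    | tmul p e =>
    rw [TensorProduct.leftComm_tmul, leg12_tmul, LinearMap.rTensor_tmul, LinearMap.flip_apply,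
      ← h.sliceL_mapP]
    generalize mapP α β (p ⊗ₜ a) = z
    induction z with
    | zero => simp
    | add p q hp hq => simp only [map_add, TensorProduct.add_tmul, hp, hq]
    | tmul u v => simp [TensorProduct.smul_tmul']
  rw [α.smashMul_tmul, ← lmulC_apply, ← h2, smashT₁, LinearMap.comp_apply, onSnd_tmul]
  generalize coproductD α β (d ⊗ₜ y) = z
  induction z with
  | zero => simp
  | add p q hp hq => simp only [map_add, hp, hq]
  | tmul p y =>
  rw [LinearMap.rTensor_tmul, TensorProduct.mk_apply, onFst_tmul, sliceL_tmul, map_smul, ← h1]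
  generalize coproductC HC D (c ⊗ₜ y) = z
  induction z with
  | zero => simp
  | add p q hp hq => simp only [map_add, smul_add, hp, hq]
  | tmul u y => simp [smashCounit, smul_smul, mul_comm]

omit h in
theorem smashAntipode_bijective : Function.Bijective (smashAntipode α β) :=
  α.twist_bijective.comp ((TensorProduct.congr
    (LinearEquiv.ofBijective _ HD.isAntipode_antipode.bijective)
    (LinearEquiv.ofBijective _ HC.isAntipode_antipode.bijective)).bijective.comp
      β.cotwist_bijective)

omit h in
theorem lift_smashAntipode_smashT₁ (a y : C ⊗[ℂ] D) :
    TensorProduct.lift (α.smashMul ∘ₗ smashAntipode α β) (smashT₁ α β (a ⊗ₜ y)) =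
      smashCounit HC HD a • y := by
  induction a with
  | zero => simp
  | add p q hp hq => simp only [map_add, TensorProduct.add_tmul, add_smul, hp, hq]
  | tmul c d =>
  have h1 : ∀ c (y : C ⊗[ℂ] D), TensorProduct.lift (lmulC C D ∘ₗ HC.antipode)
      (coproductC HC D (c ⊗ₜ y)) = HC.counit c • y := by
    intro c y
    induction y with
    | zero => simp
    | add p q hp hq => simp only [map_add, TensorProduct.tmul_add, smul_add, hp, hq]
    | tmul a e =>
    rw [coproductC, leg12_tmul, LinearEquiv.coe_coe, TensorProduct.smul_tmul',
      ← HC.lift_antipode_T₁]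
    generalize HC.T₁ (c ⊗ₜ a) = z
    induction z with
    | zero => simp
    | add p q hp hq => simp only [map_add, TensorProduct.add_tmul, hp, hq]
    | tmul u v => simp [lmulC_apply]
  -- Λ sends r ⊗ q ⊗ y to S_D(r)S_C(q)y, which is S_# with its factor T already applied.
  let Λ : (D ⊗[ℂ] C) ⊗[ℂ] (C ⊗[ℂ] D) →ₗ[ℂ] C ⊗[ℂ] D := TensorProduct.lift
    (α.smashMul ∘ₗ α.twist ∘ₗ TensorProduct.map HD.antipode HC.antipode)
  have hΛ : ∀ t, TensorProduct.lift (α.smashMul ∘ₗ smashAntipode α β) t =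
      Λ ((cotwist β.Γ).rTensor _ t) := by
    intro t
    induction t with
    | zero => simp
    | add p q hp hq => simp only [map_add, hp, hq]
    | tmul x y => simp [Λ, smashAntipode]
  -- The C-leg collapses by S_C(q₁)q₂ = ε(q), so only the slice of z in D survives.
  have h2 : ∀ (z : D ⊗[ℂ] C) y, Λ (onSnd D (coproductC HC D) (z ⊗ₜ y)) =
      α.lmulD (HD.antipode (sliceR D HC.counit z)) y := by
    intro z y
    induction z with
    | zero => simp
    | add p q hp hq => simp only [map_add, TensorProduct.add_tmul, LinearMap.add_apply, hp, hq]
    | tmul r q =>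
    rw [onSnd_tmul, sliceR_tmul, map_smul, map_smul, LinearMap.smul_apply, ← map_smul, ← h1]
    generalize coproductC HC D (q ⊗ₜ y) = z
    induction z with
    | zero => simp
    | add p q hp hq => simp only [map_add, hp, hq]
    | tmul u y => simp [Λ, α.smashMul_twist, lmulC_apply]
  have h3 : TensorProduct.lift (α.lmulD ∘ₗ HD.antipode) (α.coprodActMul (d ⊗ₜ y)) =
      HD.counit d • y := by
    obtain ⟨y, rfl⟩ := α.lift_lmulD_surjective HC y
    induction y with
    | zero => simp
    | add p q hp hq => simp only [map_add, TensorProduct.tmul_add, smul_add, hp, hq]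
    | tmul d' y =>
    rw [TensorProduct.lift.tmul, α.coprodActMul_lmulD, ← LinearMap.smul_apply, ← map_smul,
      ← HD.lift_antipode_T₁]
    generalize HD.T₁ (d ⊗ₜ d') = z
    induction z with
    | zero => simp
    | add p q hp hq => simp only [map_add, LinearMap.add_apply, hp, hq]
    | tmul p q => simp [α.lmulD_mul]
  have h4 : smashT₁ α β ((c ⊗ₜ d) ⊗ₜ y) = onFst D (coproductC HC D) (onSnd C (leg12 D β.coactMul)
      ((TensorProduct.mk ℂ C D c).rTensor _ (α.coprodActMul (d ⊗ₜ y)))) := by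
    rw [smashT₁, LinearMap.comp_apply, ← onSnd_tmul, coproductD_eq]
    simp [onSnd, leg23_comp]
  rw [hΛ, h4, β.rTensor_cotwist_onFst]
  have h5 : smashCounit HC HD (c ⊗ₜ d) = HC.counit c * HD.counit d := by simp [smashCounit]
  rw [h5, mul_smul, ← h3]
  generalize α.coprodActMul (d ⊗ₜ y) = z
  induction z with
  | zero => simp
  | add p q hp hq => simp only [map_add, smul_add, hp, hq]
  | tmul p y =>
  rw [LinearMap.rTensor_tmul, LinearMap.rTensor_tmul, h2, TensorProduct.mk_apply, β.sliceR_cotwist]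
  simp

theorem canonicalMaps : CanonicalMaps α.smashMul (LinearEquiv.ofBijective _ h.smashT₁_bijective)
    (LinearEquiv.ofBijective _ (smashT₂_bijective α β)) where
  assoc := α.smashMul_assoc
  nondegenerate_left := α.smashMul_nondegenerate_left HC
  nondegenerate_right := α.smashMul_nondegenerate_right HC
  mul_T₁ a b c := smashT₁_mul_eq α β a b c
  T₁_mul a b c := h.smashT₁_mul a b c
  coassoc a b c := by
    have := leg12_smashT₂_leg23_smashT₁ α β (a ⊗ₜ (b ⊗ₜ c))
    rwa [leg23_tmul, leg12_tmul] at this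

end Compatible

theorem isSmashCoproduct_of_fst
    (Δ : C ⊗[ℂ] D →ₗ[ℂ] multiplierAlgebra (tensorMul α.smashMul))
    (hΔ : ∀ a, (Δ a : PreMult ((C ⊗[ℂ] D) ⊗[ℂ] (C ⊗[ℂ] D))).1 =
      legAct α.smashMul (smashT₁ α β) a) : IsSmashCoproduct α β Δ := by
  intro c d c' d'
  refine multiplier_ext (tensorMul_nondegenerate_left (α.smashMul_nondegenerate_left HC))
    (mul_mem (mul_mem (inFirst_mem (α.inclC_mem c')) (Δ _).2) (inSecond_mem (α.inclD_mem d')))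
    (embed_mem (tensorMul_assoc α.smashMul_assoc) _) ?_
  refine TensorProduct.ext' fun x y => ?_
  have h1 : (LinearMap.mul ℂ C c').rTensor D ∘ₗ α.smashMul.flip x =
      α.smashMul.flip x ∘ₗ (LinearMap.mul ℂ C c').rTensor D :=
    LinearMap.ext fun a => (α.smashMul_mulC c' a x).symm
  simp only [Prod.fst_mul, Module.End.mul_apply, inFirst_fst, inSecond_fst, embed_fst, hΔ,
    LinearMap.lTensor_tmul, LeftModuleAlgebra.inclD_fst, LeftModuleAlgebra.inclC_fst, legAct_tmul]
  rw [tensorMul_tmul_right, ← LinearMap.rTensor_comp_apply, h1, LinearMap.rTensor_comp_apply,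
    smashT₁_cover, lTensor_rTensor_comm]

/-- The covered formula determines Δ(cd): the elements d'y span CD, and the elements c' on the left
are jointly cancellable by non-degeneracy of C. -/
theorem IsSmashCoproduct.unique {Δ Δ' : C ⊗[ℂ] D →ₗ[ℂ] multiplierAlgebra (tensorMul α.smashMul)}
    (hΔ : IsSmashCoproduct α β Δ) (hΔ' : IsSmashCoproduct α β Δ') : Δ = Δ' := by
  refine TensorProduct.ext' fun c d => Subtype.ext ?_
  refine multiplier_ext (tensorMul_nondegenerate_left (α.smashMul_nondegenerate_left HC))
    (Δ _).2 (Δ' _).2 ?_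
  refine TensorProduct.ext' fun x y => ?_
  obtain ⟨y, rfl⟩ := α.lift_lmulD_surjective HC y
  induction y with
  | zero => simp
  | add p q hp hq => simp only [map_add, TensorProduct.tmul_add, hp, hq]
  | tmul d' y =>
  refine rTensor_jointly_injective (fun c' => (LinearMap.mul ℂ C c').rTensor D) (fun z hz => ?_)
    fun c' => ?_
  · exact rTensor_jointly_injective (LinearMap.mul ℂ C) HC.nondegenerate_right
      (fun p => (hz p).trans (map_zero _).symm)
  have h1 := congrArg (fun t : PreMult ((C ⊗[ℂ] D) ⊗[ℂ] (C ⊗[ℂ] D)) => t.1 (x ⊗ₜ y))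
    ((hΔ c d c' d').trans (hΔ' c d c' d').symm)
  simpa only [Prod.fst_mul, Module.End.mul_apply, inFirst_fst, inSecond_fst,
    LinearMap.lTensor_tmul, LeftModuleAlgebra.inclD_fst, LeftModuleAlgebra.inclC_fst,
    TensorProduct.lift.tmul] using h1

end Compatibility

theorem theorem4p4 {C D : Type*}
    [NonUnitalRing C] [Module ℂ C] [IsScalarTower ℂ C C] [SMulCommClass ℂ C C]
    [NonUnitalRing D] [Module ℂ D] [IsScalarTower ℂ D D] [SMulCommClass ℂ D D]
    (HC : RegularMultiplierHopfAlgebra (LinearMap.mul ℂ C))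
    (HD : RegularMultiplierHopfAlgebra (LinearMap.mul ℂ D))
    (α : LeftModuleAlgebra HD C) (β : RightComoduleCoalgebra HC HD) (h : Compatible α β) :
    ∃ H : RegularMultiplierHopfAlgebra α.smashMul,
      IsSmashCoproduct α β H.Δ ∧
      (∀ Δ', IsSmashCoproduct α β Δ' → Δ' = H.Δ) ∧
      H.IsCounit (smashCounit HC HD) ∧
      H.IsAntipode (smashCounit HC HD) (smashAntipode α β) := by
  obtain ⟨H, -, -, hΔ, hε, hS⟩ := h.canonicalMaps.exists_regularMultiplierHopfAlgebra
    h.sliceL_smashT₁ Compatible.smashAntipode_bijective Compatible.lift_smashAntipode_smashT₁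
  have h1 := isSmashCoproduct_of_fst H.Δ hΔ
  exact ⟨H, h1, fun Δ' hΔ' => hΔ'.unique h1, hε, hS⟩
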